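/- Fix the set $\Sigma=\{0,1\}^*$ of predicate labels. A \emph{graph} $G$ consists of a finite set $N_G$ of nodes and a finite set $E_G$ of edges, where each edge $e$ has an origin and an end point in $N_G$, a label in $\Sigma$, and an occurrence interval $\mathrm{occur}_G(e)=[n;m]$ with $n\in\mathbb{N}$, $n\le m\le\infty$, which stands for $\{i\in\mathbb{N}\mid n\le i\le m\}$. Parallel edges with the same label are allowed. A graph is a \emph{shape graph} if all its intervals are among $[1;1]$, $[0;1]$, $[1;\infty]$, $[0;\infty]$. It is \emph{simple} if all its intervals are $[1;1]$ and no two distinct edges have the same origin, end point and label. Write $\mathrm{out}_G(n)$ for the set of edges of $G$ with origin $n$. A relation $R\subseteq N_G\times N_H$ is a \emph{simulation} of $G$ in $H$ if for every $(n,m)\in R$ there is a function $\lambda:\mathrm{out}_G(n)\to\mathrm{out}_H(m)$ such that every $e\in\mathrm{out}_G(n)$ has the same label as $\lambda(e)$, the pair of end points of $e$ and $\lambda(e)$ belongs to $R$, and every $f\in\mathrm{out}_H(m)$ satisfies $\bigoplus_{\lambda(e)=f}\mathrm{occur}_G(e)\subseteq\mathrm{occur}_H(f)$. Here $[n_1;m_1]\oplus[n_2;m_2]=[n_1+n_2;m_1+m_2]$,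 and the empty sum is $[0;0]$. The graph $G$ \emph{can be embedded} in $H$ if there is a simulation $R$ of $G$ in $H$ such that every node of $G$ occurs as the first component of a pair in $R$. The \emph{language} $L(H)$ is the set of all simple graphs that can be embedded in $H$, and $H$ is \emph{contained} in $K$ if $L(H)\subseteq L(K)$. \textbf{Theorem.} The containment problem for shape graphs, namely ``given shape graphs $H$ and $K$, is $L(H)\subseteq L(K)$?'', is in $\mathrm{coNEXP}$. In other words, let $\mathcal{C}$ be the language of all words that encode a pair $(H,K)$ of shape graphs with $L(H)\subseteq L(K)$, where a graph is written as a list of its nodes and a list of its labelled edges. Then there are a nondeterministic Turing machine and a polynomial $p$ such that, on every word $w$, all computations of the machine halt within $2^{p(|w|)}$ steps, and some computation accepts if and only if $w\notin\mathcal{C}$. -/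

import Mathlib

namespace ShEx

/-! ### Intervals -/

/-- An interval `[lo; hi]` of natural numbers, with `lo ≤ hi ≤ ∞`. -/
@[ext]
structure Interval where
  lo : ℕ
  hi : ℕ∞
  le : (lo : ℕ∞) ≤ hi

namespace Interval

/-- The set `{i | lo ≤ i ≤ hi}` of natural numbers that an interval stands for. -/
def toSet (I : Interval) : Set ℕ := {i | I.lo ≤ i ∧ (i : ℕ∞) ≤ I.hi}

/-- The neutral element is `[0; 0]`. -/
instance : Zero Interval := ⟨⟨0, 0, by simp⟩⟩

/-- Point-wise addition `[n₁; m₁] ⊕ [n₂; m₂] = [n₁ + n₂; m₁ + m₂]`. -/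
instance : Add Interval :=
  ⟨fun I J => ⟨I.lo + J.lo, I.hi + J.hi, by
    rw [Nat.cast_add]; exact add_le_add I.le J.le⟩⟩

instance : AddCommMonoid Interval where
  add_assoc I J K := Interval.ext (Nat.add_assoc I.lo J.lo K.lo) (add_assoc I.hi J.hi K.hi)
  zero_add I := Interval.ext (Nat.zero_add I.lo) (zero_add I.hi)
  add_zero I := Interval.ext (Nat.add_zero I.lo) (add_zero I.hi)
  add_comm I J := Interval.ext (Nat.add_comm I.lo J.lo) (add_comm I.hi J.hi)
  nsmul := nsmulRec

end Interval

/-- Names of the four basic intervals. -/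
inductive Basic where
  | one
  | opt
  | plus
  | star

/-- `1 = [1;1]`, `? = [0;1]`, `+ = [1;∞]`, `* = [0;∞]`. -/
def Basic.toInterval : Basic → Interval
  | .one => ⟨1, 1, by simp⟩
  | .opt => ⟨0, 1, by simp⟩
  | .plus => ⟨1, ⊤, by simp⟩
  | .star => ⟨0, ⊤, by simp⟩

/-! ### Graphs, embeddings, languages, containment -/

/-- A (general) graph over a set `P` of predicate labels: finitely many nodes and edges, where each
edge has an origin, an end point, a label and an occurrence interval. -/
structure Graph (P : Type) where
  N : Type
  E : Type
  [finN : Fintype N]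
  [finE : Fintype E]
  source : E → N
  target : E → N
  lab : E → P
  occur : E → Interval

attribute [instance] Graph.finN Graph.finE

namespace Graph

variable {P : Type}

/-- The type of outgoing edges of a node. -/
abbrev Out (G : Graph P) (n : G.N) : Type := {e : G.E // G.source e = n}

/-- Only the interval `1` is used, and no two edges share origin, end point and label. -/
def IsSimple (G : Graph P) : Prop :=
  (∀ e, G.occur e = Basic.one.toInterval) ∧
  ∀ e e', G.source e = G.source e' → G.target e = G.target e' → G.lab e = G.lab e' → e = e'

/-- Shape graphs use basic occurrence intervals only. -/
def IsShapeGraph (G : Graph P) : Prop :=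
  ∀ e, ∃ M : Basic, G.occur e = M.toInterval

open Classical in
/-- `w` is a witness of simulation of `n` by `m` with respect to `R`. -/
def IsWitness (G H : Graph P) (R : G.N → H.N → Prop) (n : G.N) (m : H.N)
    (w : G.Out n → H.Out m) : Prop :=
  (∀ e : G.Out n, G.lab e.1 = H.lab (w e).1) ∧
  (∀ e : G.Out n, R (G.target e.1) (H.target (w e).1)) ∧
  ∀ f : H.Out m,
    (∑ e ∈ Finset.univ.filter (fun e : G.Out n => w e = f), G.occur e.1).toSet ⊆
      (H.occur f.1).toSet

/-- `R` is a simulation of `G` in `H`. -/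
def IsSimulation (G H : Graph P) (R : G.N → H.N → Prop) : Prop :=
  ∀ n m, R n m → ∃ w : G.Out n → H.Out m, IsWitness G H R n m w

/-- `G` can be embedded in `H`: some simulation of `G` in `H` has all nodes of `G` in its domain. -/
def Embeds (G H : Graph P) : Prop :=
  ∃ R : G.N → H.N → Prop, IsSimulation G H R ∧ ∀ n, ∃ m, R n m

/-- The language `L(H)`: all simple graphs that can be embedded in `H`. -/
def language (H : Graph P) : Set (Graph P) := {G | G.IsSimple ∧ G.Embeds H}

/-- Containment `H ⊆ K` of graphs seen as schemas, that is, `L(H) ⊆ L(K)`. -/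
def Contained (H K : Graph P) : Prop := H.language ⊆ K.language

end Graph

/-! ### Shape graphs as inputs of a decision problem -/

/-- A shape graph written down explicitly: the nodes are `0, …, nodes - 1`, and each edge is listed
as (origin, label, occurrence interval, end point). Predicate labels are arbitrary bit strings. -/
structure ShapeGraph where
  nodes : ℕ
  edges : List (Fin nodes × List Bool × Basic × Fin nodes)

/-- The graph that is written down. Repeated entries of the list are distinct (parallel) edges. -/
def ShapeGraph.toGraph (D : ShapeGraph) : Graph (List Bool) where
  N := Fin D.nodes
  E := Fin D.edges.length
  source i := (D.edges.get i).1
  target i := (D.edges.get i).2.2.2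
  lab i := (D.edges.get i).2.1
  occur i := (D.edges.get i).2.2.1.toInterval

/-- What is written down is a shape graph. -/
theorem ShapeGraph.isShapeGraph (D : ShapeGraph) : D.toGraph.IsShapeGraph :=
  fun i => ⟨(D.edges.get i).2.2.1, rfl⟩

/-- Every shape graph can be written down, up to a renaming of its nodes and edges. -/
theorem Graph.IsShapeGraph.exists_shapeGraph {H : Graph (List Bool)} (hH : H.IsShapeGraph) :
    ∃ (D : ShapeGraph) (φ : H.N ≃ D.toGraph.N) (ψ : H.E ≃ D.toGraph.E), ∀ e,
      D.toGraph.source (ψ e) = φ (H.source e) ∧ D.toGraph.target (ψ e) = φ (H.target e) ∧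
      D.toGraph.lab (ψ e) = H.lab e ∧ D.toGraph.occur (ψ e) = H.occur e := by
  choose M hM using hH
  let φ := Fintype.equivFin H.N
  let ε := Fintype.equivFin H.E
  let f : H.E → Fin (Fintype.card H.N) × List Bool × Basic × Fin (Fintype.card H.N) :=
    fun e => (φ (H.source e), H.lab e, M e, φ (H.target e))
  let l := List.ofFn fun i => f (ε.symm i)
  have hl : Fintype.card H.E = l.length := by simp [l]
  have hg : ∀ e, l.get (finCongr hl (ε e)) = f e := fun e => by
    rw [List.get_ofFn]
    exact congrArg f (ε.symm_apply_apply e)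
  refine ⟨⟨_, l⟩, φ, ε.trans (finCongr hl), fun e => ⟨?_, ?_, ?_, ?_⟩⟩
  · exact congrArg (fun x => x.1) (hg e)
  · exact congrArg (fun x => x.2.2.2) (hg e)
  · exact congrArg (fun x => x.2.1) (hg e)
  · exact (congrArg (fun x => x.2.2.1.toInterval) (hg e)).trans (hM e).symm

/-- The symbols with which shape graphs are written. -/
inductive Symbol where
  | node
  | arc
  | tally
  | occ (M : Basic)
  | bit (b : Bool)
  | sep

/-- The word for an edge. Node numbers are in unary; as the word for a graph spells out all of its
nodes, its length is polynomially related to that with node numbers in binary. -/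
def encodeEdge {n : ℕ} (e : Fin n × List Bool × Basic × Fin n) : List Symbol :=
  Symbol.arc :: (List.replicate e.1 Symbol.tally ++ Symbol.occ e.2.2.1 ::
    (e.2.1.map Symbol.bit ++ List.replicate e.2.2.2 Symbol.tally))

/-- The word for a shape graph: a mark for each node, followed by the words for the edges. -/
def ShapeGraph.encode (D : ShapeGraph) : List Symbol :=
  List.replicate D.nodes Symbol.node ++ D.edges.flatMap encodeEdge

/-- The containment problem for shape graphs, as a language: all words that encode a pair `(H, K)`
of shape graphs with `H ⊆ K`. -/
def containmentProblem : Set (List Symbol) :=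
  {w | ∃ H K : ShapeGraph, w = H.encode ++ Symbol.sep :: K.encode ∧
    H.toGraph.Contained K.toGraph}

/-! ### Nondeterministic machines and the class coNEXP -/

/-- A nondeterministic Turing machine with input alphabet `A`, in Mathlib's multi-stack model `TM2`
(two stacks make up a tape). Stacks, stack alphabets, labels and internal states are finite.
Nondeterminism: there are two programs, and each step follows either one of them. -/
structure NTM (A : Type) where
  K : Type
  [decK : DecidableEq K]
  [finK : Fintype K]
  Γ : K → Type
  [finΓ : ∀ k, Fintype (Γ k)]
  Λ : Type
  [finΛ : Fintype Λ]
  σ : Type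
  [finσ : Fintype σ]
  /-- the stack that holds the input at the start, its first symbol on top -/
  input : K
  /-- how an input symbol is written on that stack -/
  letter : A → Γ input
  start : Λ
  initial : σ
  program : Bool → Λ → Turing.TM2.Stmt Γ Λ σ
  /-- a computation that halts accepts if its final internal state is in this set -/
  accept : Set σ

namespace NTM

attribute [instance] NTM.decK NTM.finK NTM.finΓ NTM.finΛ NTM.finσ

variable {A : Type} (M : NTM A)

/-- Configurations; a configuration is halting if its label `l` is `none`. -/
abbrev Cfg : Type := Turing.TM2.Cfg M.Γ M.Λ M.σ

/-- The initial configuration on input `w`: all stacks but the input stack are empty. -/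
def init (w : List A) : M.Cfg where
  l := some M.start
  var := M.initial
  stk := Function.update (fun _ => []) M.input (w.map M.letter)

/-- One step, following the program `b`; a halting configuration does not change any more. -/
def step (c : M.Cfg) (b : Bool) : M.Cfg := (Turing.TM2.step (M.program b) c).getD c

/-- The configuration reached from input `w` along a sequence of choices, one for each step. -/
def run (w : List A) (choices : List Bool) : M.Cfg := choices.foldl M.step (M.init w)

/-- `M` decides `L` in time `T`: on each input `w`, every computation halts within `T |w|` steps,
and `w ∈ L` if and only if some computation halts and accepts. -/
def DecidesInTime (L : Set (List A)) (T : ℕ → ℕ) : Prop :=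
  ∀ w : List A,
    (∀ choices : List Bool, choices.length = T w.length → (M.run w choices).l = none) ∧
    (w ∈ L ↔ ∃ choices : List Bool,
      (M.run w choices).l = none ∧ (M.run w choices).var ∈ M.accept)

end NTM

/-- Languages decided by a nondeterministic machine in time `2 ^ p(n)` for a polynomial `p`. -/
def NEXP (A : Type) : Set (Set (List A)) :=
  {L | ∃ (M : NTM A) (p : Polynomial ℕ), M.DecidesInTime L fun n => 2 ^ p.eval n}

/-- Languages whose complement is in NEXP. -/
def coNEXP (A : Type) : Set (Set (List A)) := {L | Lᶜ ∈ NEXP A}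

end ShEx

/-! Non-containment has certificates of exponential size that can be checked in exponential time: a
counterexample together with a proof that it is one.

Let `G` be a simple graph that embeds in `H` by `R` but not in `K`. The largest simulation of `G` in
`K` is the limit of decreasing approximations (`approx`), and as `G` does not embed, some node has
lost all nodes of `K` after finitely many rounds (`exists_approx_empty`). Assign a node in round `i`
to the class `(h, S)`, where `h` is a node of `H` that simulates it and `S` is the set of nodes of
`K` that it still has. The rank of a class is the first round in which it occurs. Take a node that
represents a class of rank `i > 0`. Its successors, looked at in round `i - 1`, belong to classes of
smaller rank, and these classes alone explain why each `k` outside `S` has been lost. So the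
classes, numbered along their ranks, again form a counterexample, and its failure to embed in `K` is
proved by induction on the numbers. There are at most `|N_H| * 2 ^ |N_K|` classes.

It remains to bound the number of edges. Basic intervals only demand "at least one" or "at most
one", so the existence of a witness of simulation is a matching problem. By `exists_assignment` it
fails only if one of two conditions of Hall is violated: more than `|C|` edges can go only into a
set `C` of bounded edges of `K`, or fewer than `|C|` edges can go into a set `C` of required edges.
As `|C| ≤ |E_K|`, multiplicities above `|E_K| + 1` do not matter (`card_truncation`), and this many
copies of each class suffice. `Refutes` collects the edges, the sets `S` and the violations `C`;
`exists_refutes` and `Refutes.not_contained` say that such data exist, within the size bound,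
exactly for non-contained pairs.

For the machine, being a certificate is expressed by an arithmetic term with bounded sums over the
input, the guessed bits and the number `16 ^ |w|`. Any fixed term is evaluated in unary by a
structured program, in time polynomial in `16 ^ (|w| + 1)` (`det_code`), and structured programs are
compiled into stack machines (`foldl_stepWith_of_runs`). This gives the criterion `mem_NEXP`; what
is left is to define well-formed words and refutations by terms (`DefP.wellFormed`,
`DefP.refutedBy`). -/

namespace ShEx

/-! ### Structured programs on stacks -/

/-- Structured programs on stacks numbered by natural numbers, with stack alphabet `Γ`. -/
inductive Prog (Γ : Type) where
  | push (k : ℕ) (a : Γ)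
  | drop (k : ℕ)
  | move (k k' : ℕ)
  | guess (k : ℕ) (a : Bool → Γ)
  | seq (p q : Prog Γ)
  | loop (k : ℕ) (p : Prog Γ)
  | cond (k : ℕ) (a : Γ) (p : Prog Γ)

/-- The contents of all stacks. -/
abbrev Store (Γ : Type) : Type := ℕ → List Γ

namespace Prog

variable {Γ : Type}

/-- `Runs p S cs S'`: with the choices `cs`, one for each step, `p` transforms `S` into `S'`. -/
inductive Runs : Prog Γ → Store Γ → List Bool → Store Γ → Prop
  | push (k a S b) : Runs (.push k a) S [b] (Function.update S k (a :: S k))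
  | drop (k S b) : Runs (.drop k) S [b] (Function.update S k (S k).tail)
  | move_nil (k k' S b) : S k = [] → Runs (.move k k') S [b] S
  | move_cons (k k' a l S b) : S k = a :: l → k ≠ k' →
      Runs (.move k k') S [b]
        (Function.update (Function.update S k l) k' (a :: S k'))
  | guess (k a S b) : Runs (.guess k a) S [b] (Function.update S k (a b :: S k))
  | seq {p q S S' S'' cs cs'} : Runs p S cs S' → Runs q S' cs' S'' →
      Runs (.seq p q) S (cs ++ cs') S''
  | loop_nil (k p S b) : S k = [] → Runs (.loop k p) S [b] S
  | loop_cons {k p S S' S'' b cs cs'} : S k ≠ [] → Runs p S cs S' → Runs (.loop k p) S' cs' S'' →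
      Runs (.loop k p) S (b :: (cs ++ cs')) S''
  | cond_true {k a p S S' b cs} : (S k).head? = some a → Runs p S cs S' →
      Runs (.cond k a p) S (b :: cs) S'
  | cond_false (k a p S b) : (S k).head? ≠ some a → Runs (.cond k a p) S [b] S

/-- All stacks used by a program have a number at most this bound. -/
def bound : Prog Γ → ℕ
  | .push k _ => k
  | .drop k => k
  | .move k k' => max k k'
  | .guess k _ => k
  | .seq p q => max p.bound q.bound
  | .loop k p => max k p.bound
  | .cond k _ p => max k p.bound

/-- The control locations of a program. -/
def Loc : Prog Γ → Type
  | .push _ _ => Unit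
  | .drop _ => Unit
  | .move _ _ => Unit
  | .guess _ _ => Unit
  | .seq p q => Loc p ⊕ Loc q
  | .loop _ p => Option (Loc p)
  | .cond _ _ p => Option (Loc p)

instance finite_loc : ∀ p : Prog Γ, Finite (Loc p)
  | .push _ _ => inferInstanceAs (Finite Unit)
  | .drop _ => inferInstanceAs (Finite Unit)
  | .move _ _ => inferInstanceAs (Finite Unit)
  | .guess _ _ => inferInstanceAs (Finite Unit)
  | .seq p q =>
    haveI := finite_loc p
    haveI := finite_loc q
    inferInstanceAs (Finite (Loc p ⊕ Loc q))
  | .loop _ p =>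
    haveI := finite_loc p
    inferInstanceAs (Finite (Option (Loc p)))
  | .cond _ _ p =>
    haveI := finite_loc p
    inferInstanceAs (Finite (Option (Loc p)))

/-- The location where a program starts. -/
def entry : ∀ p : Prog Γ, Loc p
  | .push _ _ => ()
  | .drop _ => ()
  | .move _ _ => ()
  | .guess _ _ => ()
  | .seq p _ => Sum.inl (entry p)
  | .loop _ _ => none
  | .cond _ _ _ => none

/-! ### Translation of structured programs into stack machines. -/

section Compile

variable {Λ : Type} (m : ℕ)

/-- The stack of a machine with stacks `0, …, m` that serves as the one numbered `k`. -/
def stackNo (k : ℕ) : Fin (m + 1) := Fin.ofNat (m + 1) k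

/-- The stacks with numbers up to `m`. -/
def restrict (S : Store Γ) : ∀ _ : Fin (m + 1), List Γ := fun k => S k

theorem val_stackNo {k : ℕ} (hk : k ≤ m) : (stackNo m k : ℕ) = k :=
  Nat.mod_eq_of_lt (Nat.lt_succ_of_le hk)

theorem restrict_stackNo (S : Store Γ) {k : ℕ} (hk : k ≤ m) :
    restrict m S (stackNo m k) = S k := by
  rw [restrict, val_stackNo m hk]

theorem update_restrict (S : Store Γ) {k : ℕ} (hk : k ≤ m) (l : List Γ) :
    Function.update (restrict m S) (stackNo m k) l = restrict m (Function.update S k l) := by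
  funext j
  by_cases hj : j = stackNo m k
  · subst hj
    rw [Function.update_self, restrict, val_stackNo m hk, Function.update_self]
  · rw [Function.update_of_ne hj, restrict, restrict, Function.update_of_ne]
    intro hjk
    exact hj (Fin.ext (hjk.trans (val_stackNo m hk).symm))

/-- The step function of a machine with the given two programs. -/
def stepWith {K : Type} [DecidableEq K] {Γ : K → Type} {σ : Type}
    (prog : Bool → Λ → Turing.TM2.Stmt Γ Λ σ) (c : Turing.TM2.Cfg Γ Λ σ) (b : Bool) :
    Turing.TM2.Cfg Γ Λ σ := (Turing.TM2.step (prog b) c).getD c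

theorem stepWith_some {K : Type} [DecidableEq K] {Γ : K → Type} {σ : Type}
    (prog : Bool → Λ → Turing.TM2.Stmt Γ Λ σ) (l : Λ) (v : σ) (S : ∀ k, List (Γ k)) (b : Bool) :
    stepWith prog ⟨some l, v, S⟩ b = Turing.TM2.stepAux (prog b l) v S := rfl

variable [Inhabited Γ]

open Classical in
/-- The statements of a stack machine that perform a program: `e` embeds the locations of the
program into the labels of the machine, `x` is the label where control goes at the end, and the
stack numbered `k` is `stackNo m k`. -/
noncomputable def compile : (p : Prog Γ) → (Loc p → Λ) → Λ → Bool → Loc p →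
    Turing.TM2.Stmt (fun _ : Fin (m + 1) => Γ) Λ (Option Γ)
  | .push k a, _, x, _, _ => .push (stackNo m k) (fun _ => a) (.goto fun _ => x)
  | .drop k, _, x, _, _ => .pop (stackNo m k) (fun _ _ => none) (.goto fun _ => x)
  | .move k k', _, x, _, _ =>
    .pop (stackNo m k) (fun _ o => o)
      (.branch Option.isSome
        (.push (stackNo m k') (fun o => o.getD default)
          (.load (fun _ => none) (.goto fun _ => x)))
        (.goto fun _ => x))
  | .guess k a, _, x, b, _ => .push (stackNo m k) (fun _ => a b) (.goto fun _ => x)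
  | .seq p q, e, _, b, .inl l => compile p (e ∘ Sum.inl) (e (Sum.inr (entry q))) b l
  | .seq _ q, e, x, b, .inr l => compile q (e ∘ Sum.inr) x b l
  | .loop k p, e, x, _, none =>
    .peek (stackNo m k) (fun _ o => o)
      (.branch Option.isSome (.load (fun _ => none) (.goto fun _ => e (some (entry p))))
        (.goto fun _ => x))
  | .loop _ p, e, _, b, some l => compile p (e ∘ some) (e none) b l
  | .cond k a p, e, x, _, none =>
    .peek (stackNo m k) (fun _ o => o)
      (.branch (fun o => decide (o = some a))
        (.load (fun _ => none) (.goto fun _ => e (some (entry p))))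
        (.load (fun _ => none) (.goto fun _ => x)))
  | .cond _ _ p, e, x, b, some l => compile p (e ∘ some) x b l

/-- Each step of a run is exactly one step of the machine. The induction closes because every test
resets the internal state, so that it is `none` at all locations. The exit label `x` is arbitrary:
the first part of a sequence exits to the entry of the second part, and the body of a loop exits to
the test. -/
theorem foldl_stepWith_of_runs (prog : Bool → Λ → Turing.TM2.Stmt (fun _ : Fin (m + 1) => Γ) Λ
    (Option Γ)) {p : Prog Γ} {S S' : Store Γ} {cs : List Bool} (h : Runs p S cs S') :
    ∀ (e : Loc p → Λ) (x : Λ), p.bound ≤ m → (∀ b l, prog b (e l) = compile m p e x b l) →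
      cs.foldl (stepWith prog) ⟨some (e (entry p)), none, restrict m S⟩ =
        ⟨some x, none, restrict m S'⟩ := by
  induction h with
  | push k a S b =>
    intro e x hb hp
    simp only [bound] at hb
    simp [stepWith_some, hp, compile, restrict_stackNo m _ hb, update_restrict m _ hb]
  | drop k S b =>
    intro e x hb hp
    simp only [bound] at hb
    simp [stepWith_some, hp, compile, restrict_stackNo m _ hb, update_restrict m _ hb]
  | move_nil k k' S b hS =>
    intro e x hb hp
    simp only [bound, max_le_iff] at hb
    have : Function.update S k [] = S := by rw [← hS, Function.update_eq_self]
    simp [stepWith_some, hp, compile, restrict_stackNo m _ hb.1, update_restrict m _ hb.1, hS,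
      this]
  | move_cons k k' a l S b hS hk =>
    intro e x hb hp
    simp only [bound, max_le_iff] at hb
    simp [stepWith_some, hp, compile, restrict_stackNo m _ hb.1, restrict_stackNo m _ hb.2,
      update_restrict m _ hb.1, update_restrict m _ hb.2, hS, Function.update_of_ne hk.symm]
  | guess k a S b =>
    intro e x hb hp
    simp only [bound] at hb
    simp [stepWith_some, hp, compile, restrict_stackNo m _ hb, update_restrict m _ hb]
  | @seq p q S S' S'' cs cs' h₁ h₂ ih₁ ih₂ =>
    intro e x hb hp
    simp only [bound, max_le_iff] at hb
    rw [List.foldl_append]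
    have := ih₁ (e ∘ Sum.inl) (e (Sum.inr (entry q))) hb.1 (fun b l => hp b (.inl l))
    simp only [entry, Function.comp] at this ⊢
    rw [this]
    exact ih₂ (e ∘ Sum.inr) x hb.2 (fun b l => hp b (.inr l))
  | loop_nil k p S b hS =>
    intro e x hb hp
    simp only [bound, max_le_iff] at hb
    rw [List.foldl_cons, stepWith_some, hp]
    simp [entry, compile, restrict_stackNo m _ hb.1, hS]
  | @loop_cons k p S S' S'' b cs cs' hS h₁ h₂ ih₁ ih₂ =>
    intro e x hb hp
    have hb' := hb
    simp only [bound, max_le_iff] at hb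
    rw [List.foldl_cons, List.foldl_append]
    have h0 : stepWith prog ⟨some (e (entry (.loop k p))), none, restrict m S⟩ b =
        ⟨some (e (some (entry p))), none, restrict m S⟩ := by
      obtain ⟨a, l, hal⟩ := List.exists_cons_of_ne_nil hS
      rw [stepWith_some, hp]
      simp [entry, compile, restrict_stackNo m _ hb.1, hal]
    have := ih₁ (e ∘ some) (e none) hb.2 (fun b l => hp b (some l))
    simp only [Function.comp] at this
    rw [h0, this]
    exact ih₂ e x hb' hp
  | @cond_true k a p S S' b cs hS h₁ ih₁ =>
    intro e x hb hp
    simp only [bound, max_le_iff] at hb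
    rw [List.foldl_cons]
    have h0 : stepWith prog ⟨some (e (entry (.cond k a p))), none, restrict m S⟩ b =
        ⟨some (e (some (entry p))), none, restrict m S⟩ := by
      rw [stepWith_some, hp]
      simp [entry, compile, restrict_stackNo m _ hb.1, hS]
    rw [h0]
    exact ih₁ (e ∘ some) x hb.2 (fun b l => hp b (some l))
  | cond_false k a p S b hS =>
    intro e x hb hp
    simp only [bound, max_le_iff] at hb
    rw [List.foldl_cons, stepWith_some, hp]
    simp [entry, compile, restrict_stackNo m _ hb.1, hS]

end Compile
end Prog
end ShEx

/-! ### Programs whose effect does not depend on the choices, and their running times. -/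

namespace ShEx
namespace Prog

variable {Γ : Type}

/-- Within `T` steps, whatever the choices, `p` transforms `S` into `S'`. -/
def Det (p : Prog Γ) (S S' : Store Γ) (T : ℕ) : Prop :=
  ∃ t ≤ T, ∀ cs : List Bool, cs.length = t → Runs p S cs S'

namespace Det

theorem mono {p : Prog Γ} {S S' : Store Γ} {T T' : ℕ} (h : Det p S S' T) (hT : T ≤ T') :
    Det p S S' T' := by
  obtain ⟨t, ht, h⟩ := h
  exact ⟨t, ht.trans hT, h⟩

theorem of_one {p : Prog Γ} {S S' : Store Γ} (h : ∀ b, Runs p S [b] S') : Det p S S' 1 := by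
  refine ⟨1, le_rfl, fun cs hcs => ?_⟩
  obtain ⟨b, rfl⟩ := List.length_eq_one_iff.mp hcs
  exact h b

theorem push {k : ℕ} {a : Γ} {S S' : Store Γ} (h : S' = Function.update S k (a :: S k)) :
    Det (.push k a) S S' 1 := by
  subst h
  exact of_one fun b => .push k a S b

theorem drop {k : ℕ} {S S' : Store Γ} (h : S' = Function.update S k (S k).tail) :
    Det (.drop k) S S' 1 := by
  subst h
  exact of_one fun b => .drop k S b

theorem move_nil {k k' : ℕ} {S : Store Γ} (h : S k = []) : Det (.move k k') S S 1 :=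
  of_one fun b => .move_nil k k' S b h

theorem move_cons {k k' : ℕ} {S S' : Store Γ} {a : Γ} {l : List Γ} (h : S k = a :: l)
    (hk : k ≠ k') (h' : S' = Function.update (Function.update S k l) k' (a :: S k')) :
    Det (.move k k') S S' 1 := by
  subst h'
  exact of_one fun b => .move_cons k k' a l S b h hk

theorem seq {p q : Prog Γ} {S S' S'' : Store Γ} {T T' : ℕ} (h : Det p S S' T)
    (h' : Det q S' S'' T') : Det (.seq p q) S S'' (T + T') := by
  obtain ⟨t, ht, h⟩ := h
  obtain ⟨t', ht', h'⟩ := h'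
  refine ⟨t + t', add_le_add ht ht', fun cs hcs => ?_⟩
  rw [← List.take_append_drop t cs]
  exact .seq (h _ (by simp [hcs])) (h' _ (by simp [hcs]))

theorem loop_nil {k : ℕ} {p : Prog Γ} {S : Store Γ} (h : S k = []) : Det (.loop k p) S S 1 :=
  of_one fun b => .loop_nil k p S b h

theorem loop_cons {k : ℕ} {p : Prog Γ} {S S' S'' : Store Γ} {T T' : ℕ} (hS : S k ≠ [])
    (h : Det p S S' T) (h' : Det (.loop k p) S' S'' T') :
    Det (.loop k p) S S'' (T + 1 + T') := by
  obtain ⟨t, ht, h⟩ := h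
  obtain ⟨t', ht', h'⟩ := h'
  refine ⟨t + 1 + t', by omega, fun cs hcs => ?_⟩
  obtain _ | ⟨b, cs⟩ := cs
  · simp at hcs
    omega
  · simp only [List.length_cons] at hcs
    rw [← List.take_append_drop t cs]
    refine .loop_cons hS (h _ ?_) (h' _ ?_)
    · rw [List.length_take]
      omega
    · rw [List.length_drop]
      omega

/-- The loop invariant is an explicit sequence `I` of stores, one for each turn. Loops with a known
number of turns below are instances: write down `I`, check one turn. -/
theorem loop {k : ℕ} {p : Prog Γ} {T : ℕ} (n : ℕ) (I : ℕ → Store Γ)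
    (hne : ∀ i < n, I i k ≠ []) (hnil : I n k = [])
    (h : ∀ i < n, Det p (I i) (I (i + 1)) T) :
    Det (.loop k p) (I 0) (I n) (n * (T + 1) + 1) := by
  induction n generalizing I with
  | zero => exact (loop_nil hnil).mono (by simp)
  | succ n ih =>
    have := ih (fun i => I (i + 1)) (fun i hi => hne _ (by omega)) hnil
      (fun i hi => h _ (by omega))
    exact (loop_cons (hne 0 (by omega)) (h 0 (by omega)) this).mono
      (by rw [Nat.add_mul]; omega)

theorem cond_true {k : ℕ} {a : Γ} {p : Prog Γ} {S S' : Store Γ} {T : ℕ}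
    (hS : (S k).head? = some a) (h : Det p S S' T) : Det (.cond k a p) S S' (T + 1) := by
  obtain ⟨t, ht, h⟩ := h
  refine ⟨t + 1, by omega, fun cs hcs => ?_⟩
  obtain _ | ⟨b, cs⟩ := cs
  · simp at hcs
  · exact .cond_true hS (h _ (by simpa using hcs))

theorem cond_false {k : ℕ} {a : Γ} {p : Prog Γ} {S : Store Γ} (hS : (S k).head? ≠ some a) :
    Det (.cond k a p) S S 1 :=
  of_one fun b => .cond_false k a p S b hS

end Det

theorem reverse_take_succ {l : List Γ} {i : ℕ} (hi : i < l.length) :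
    (l.take (i + 1)).reverse = l[i] :: (l.take i).reverse := by
  rw [List.take_succ_eq_append_getElem hi, List.reverse_append]
  rfl

theorem det_loop_move {k d : ℕ} (hkd : k ≠ d) {S S' : Store Γ} {l : List Γ} (hl : S k = l)
    (hS' : S' = Function.update (Function.update S k []) d (l.reverse ++ S d)) :
    Det (.loop k (.move k d)) S S' (l.length * 2 + 1) := by
  subst hS'
  have := Det.loop (k := k) (p := .move k d) (T := 1) l.length
    (fun i => Function.update (Function.update S k (l.drop i)) d ((l.take i).reverse ++ S d))
    (fun i hi => by simp [Function.update_of_ne hkd, hi])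
    (by simp [Function.update_of_ne hkd])
    (fun i hi => by
      refine Det.move_cons (a := l[i]) (l := l.drop (i + 1)) ?_ hkd ?_
      · simp [Function.update_of_ne hkd]
      · funext j
        simp only [Function.update_apply]
        split_ifs <;> simp_all
        rw [reverse_take_succ hi, List.cons_append])
  simpa [← hl] using this

theorem det_loop_move_push {k d dst : ℕ} (u : Γ) (hkd : d ≠ k) (hd : d ≠ dst) (hk : k ≠ dst)
    {S S' : Store Γ} {l : List Γ} (hl : S d = l)
    (hS' : S' = Function.update (Function.update (Function.update S d []) k (l.reverse ++ S k)) dst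
      (List.replicate l.length u ++ S dst)) :
    Det (.loop d (.seq (.move d k) (.push dst u))) S S' (l.length * 3 + 1) := by
  subst hS'
  have := Det.loop (k := d) (p := .seq (.move d k) (.push dst u)) (T := 2) l.length
    (fun i => Function.update (Function.update (Function.update S d (l.drop i)) k
      ((l.take i).reverse ++ S k)) dst (List.replicate i u ++ S dst))
    (fun i hi => by simp [Function.update_of_ne hkd, Function.update_of_ne hd, hi])
    (by simp [Function.update_of_ne hkd, Function.update_of_ne hd])
    (fun i hi => by
      refine Det.seq (T := 1) (T' := 1) (Det.move_cons (a := l[i]) (l := l.drop (i + 1)) ?_ hkd rfl)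
        (Det.push ?_)
      · simp [Function.update_of_ne hkd, Function.update_of_ne hd]
      · funext j
        simp only [Function.update_apply]
        split_ifs <;> simp_all [List.replicate_succ]
        rw [reverse_take_succ hi, List.cons_append])
  simpa [← hl] using this

/-- Push the symbol `u` on `dst` as many times as there are symbols on `k`. -/
def copy (u : Γ) (k dst d : ℕ) : Prog Γ :=
  .seq (.loop k (.move k d)) (.loop d (.seq (.move d k) (.push dst u)))

/-- Emptying `k` into `d` and `d` back into `k` reverses the content twice and so restores it; the
second pass pushes one `u` for each symbol. -/
theorem det_copy (u : Γ) {k dst d : ℕ} (hkd : k ≠ d) (hd : d ≠ dst) (hk : k ≠ dst)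
    {S : Store Γ} (hS : S d = []) :
    Det (copy u k dst d) S
      (Function.update S dst (List.replicate (S k).length u ++ S dst)) ((S k).length * 5 + 2) := by
  refine (Det.seq (det_loop_move hkd rfl rfl)
    (det_loop_move_push u hkd.symm hd hk (l := (S k).reverse)
    ?_ ?_)).mono ?_
  · simp [hS]
  · funext j
    simp only [Function.update_apply]
    split_ifs <;> simp_all
  · simp
    omega

theorem det_loop_drop {d : ℕ} {S S' : Store Γ} (hS' : S' = Function.update S d []) :
    Det (.loop d (.drop d)) S S' ((S d).length * 2 + 1) := by
  subst hS'
  have := Det.loop (k := d) (p := .drop d) (T := 1) (S d).length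
    (fun i => Function.update S d ((S d).drop i))
    (fun i hi => by simp [hi]) (by simp) (fun i hi => Det.drop (by simp))
  simpa using this

theorem det_loop_drop_push {d dst : ℕ} (u : Γ) (hd : d ≠ dst) {S S' : Store Γ}
    (hS' : S' = Function.update (Function.update S d []) dst
      (List.replicate (S d).length u ++ S dst)) :
    Det (.loop d (.seq (.drop d) (.push dst u))) S S' ((S d).length * 3 + 1) := by
  subst hS'
  have := Det.loop (k := d) (p := .seq (.drop d) (.push dst u)) (T := 2) (S d).length
    (fun i => Function.update (Function.update S d ((S d).drop i)) dst
      (List.replicate i u ++ S dst))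
    (fun i hi => by simp [Function.update_of_ne hd, hi])
    (by simp [Function.update_of_ne hd])
    (fun i hi => by
      refine Det.seq (T := 1) (T' := 1) (Det.drop rfl) (Det.push ?_)
      funext j
      simp only [Function.update_apply]
      split_ifs <;> simp_all [List.replicate_succ])
  simpa using this

/-- This is subtraction of unary numbers. It is truncated at `0`, as dropping from an empty stack
has no effect. -/
theorem det_loop_drop_drop {d d' : ℕ} (hd : d ≠ d') {S S' : Store Γ}
    (hS' : S' = Function.update (Function.update S d' []) d ((S d).drop (S d').length)) :
    Det (.loop d' (.seq (.drop d') (.drop d))) S S' ((S d').length * 3 + 1) := by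
  subst hS'
  have := Det.loop (k := d') (p := .seq (.drop d') (.drop d)) (T := 2) (S d').length
    (fun i => Function.update (Function.update S d' ((S d').drop i)) d ((S d).drop i))
    (fun i hi => by simp [Function.update_of_ne hd.symm, hi])
    (by simp [Function.update_of_ne hd.symm])
    (fun i hi => by
      refine Det.seq (T := 1) (T' := 1) (Det.drop rfl) (Det.drop ?_)
      funext j
      simp only [Function.update_apply]
      split_ifs <;> simp_all)
  simpa using this

/-- Random access to a tape: with a position in unary on `d`, this brings the symbol at that
position to the top of `k` and keeps the symbols before it on `d'`, from where they can be moved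
back. -/
theorem det_loop_drop_move {d k d' : ℕ} (hdk : d ≠ k) (hd : d ≠ d') (hk : k ≠ d')
    {S S' : Store Γ}
    (hS' : S' = Function.update (Function.update (Function.update S d []) k
      ((S k).drop (S d).length)) d' (((S k).take (S d).length).reverse ++ S d')) :
    Det (.loop d (.seq (.drop d) (.move k d'))) S S' ((S d).length * 3 + 1) := by
  subst hS'
  have := Det.loop (k := d) (p := .seq (.drop d) (.move k d')) (T := 2) (S d).length
    (fun i => Function.update (Function.update (Function.update S d ((S d).drop i)) k
      ((S k).drop i)) d' (((S k).take i).reverse ++ S d'))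
    (fun i hi => by simp [Function.update_of_ne hdk, Function.update_of_ne hd, hi])
    (by simp [Function.update_of_ne hdk, Function.update_of_ne hd])
    (fun i hi => by
      refine Det.seq (T := 1) (T' := 1) (Det.drop rfl) ?_
      by_cases hik : i < (S k).length
      · refine Det.move_cons (a := (S k)[i]) (l := (S k).drop (i + 1)) ?_ hk ?_
        · simp [Function.update_of_ne hk, Function.update_of_ne hdk.symm]
        · funext j
          simp only [Function.update_apply]
          split_ifs <;> simp_all
          rw [reverse_take_succ hik, List.cons_append]
      -- Past the end of the tape, further moves have no effect.
      · have h1 : (S k).drop i = [] := List.drop_eq_nil_of_le (by omega)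
        have h2 : (S k).drop (i + 1) = [] := List.drop_eq_nil_of_le (by omega)
        have h3 : (S k).take i = S k := List.take_of_length_le (by omega)
        have h4 : (S k).take (i + 1) = S k := List.take_of_length_le (by omega)
        have : ∀ S₁ S₂ : Store Γ, S₁ = S₂ → S₁ k = [] → Det (.move k d') S₁ S₂ 1 :=
          fun _ _ h h' => h ▸ Det.move_nil h'
        refine this _ _ ?_ ?_
        · funext j
          simp only [Function.update_apply]
          split_ifs <;> simp_all
        · simp [Function.update_of_ne hk, Function.update_of_ne hdk.symm, h1])
  simpa using this

end Prog
end ShEx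

namespace ShEx

/-! ### Arithmetic terms with bounded sums, evaluated by programs -/

/-- Extension of a valuation of de Bruijn variables. -/
def extend (x : ℕ) (e : ℕ → ℕ) : ℕ → ℕ
  | 0 => x
  | i + 1 => e i

/-- Arithmetic terms over three tapes; variables are de Bruijn indices. -/
inductive Term (Γ : Type) where
  | var (i : ℕ)
  | one
  | add (a b : Term Γ)
  | sub (a b : Term Γ)
  /-- the sum of the values of `b` where its variable `0` runs over the numbers below `a` -/
  | sum (a b : Term Γ)
  /-- `1` if the symbol of tape `k` at position `a` is `c`, otherwise `0` -/
  | read (k : Fin 3) (c : Γ) (a : Term Γ)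
  /-- the length of tape `k` -/
  | len (k : Fin 3)

namespace Term

variable {Γ : Type}

open Classical in
/-- The value of a term. -/
noncomputable def eval (T : Fin 3 → List Γ) : Term Γ → (ℕ → ℕ) → ℕ
  | var i, e => e i
  | one, _ => 1
  | add a b, e => eval T a e + eval T b e
  | sub a b, e => eval T a e - eval T b e
  | sum a b, e => ∑ x ∈ Finset.range (eval T a e), eval T b (extend x e)
  | read k c a, e => if (T k)[eval T a e]? = some c then 1 else 0
  | len k, _ => (T k).length

/-- A bound on the value of a term if variables and lengths of tapes are at most `B`. -/
def size : Term Γ → ℕ → ℕ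
  | var _, B => B
  | one, _ => 1
  | add a b, B => size a B + size b B
  | sub a _, B => size a B
  | sum a b, B => size a B * size b (B + size a B)
  | read _ _ _, _ => 1
  | len _, B => B

/-- A bound on the time to evaluate a term if variables and lengths of tapes are at most `B`. -/
def time : Term Γ → ℕ → ℕ
  | var _, B => B * 5 + 2
  | one, _ => 1
  | add a b, B => time a B + time b B
  | sub a b, B => time a B + (time b B + (size b B * 3 + 1 + (size a B * 3 + 1)))
  | sum a b, B =>
    time a B + (size a B * (time b (B + size a B) + 3) + 1 + (size a B * 2 + 1))
  | read _ _ a, B => time a B + (size a B * 3 + 1 + (2 + (size a B * 2 + 1)))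
  | len _, B => B * 5 + 2

theorem extend_le {x B C : ℕ} {e : ℕ → ℕ} (he : ∀ i, e i ≤ B) (hx : x ≤ C) (i : ℕ) :
    extend x e i ≤ B + C := by
  cases i with
  | zero => exact hx.trans (Nat.le_add_left _ _)
  | succ i => exact (he i).trans (Nat.le_add_right _ _)

theorem eval_le_size (T : Fin 3 → List Γ) (t : Term Γ) : ∀ (e : ℕ → ℕ) (B : ℕ),
    (∀ k, (T k).length ≤ B) → (∀ i, e i ≤ B) → eval T t e ≤ size t B := by
  induction t with
  | var i => exact fun e B _ he => he i
  | one => exact fun e B _ _ => le_rfl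
  | add a b iha ihb => exact fun e B hT he => add_le_add (iha e B hT he) (ihb e B hT he)
  | sub a b iha ihb => exact fun e B hT he => (Nat.sub_le _ _).trans (iha e B hT he)
  | sum a b iha ihb =>
    intro e B hT he
    have ha := iha e B hT he
    refine (Finset.sum_le_card_nsmul _ _ (size b (B + size a B)) fun x hx => ?_).trans ?_
    · refine ihb _ _ (fun k => (hT k).trans (Nat.le_add_right _ _)) (extend_le he ?_)
      exact (Finset.mem_range.mp hx).le.trans ha
    · rw [Finset.card_range, smul_eq_mul]
      exact Nat.mul_le_mul_right _ ha
  | read k c a iha =>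
    intro e B _ _
    simp only [eval, size]
    split_ifs <;> simp
  | len k => exact fun e B hT _ => hT k

/-! ### Polynomial bounds for values and evaluation times. -/

/-- Functions with a polynomial bound. -/
def PolyBounded (f : ℕ → ℕ) : Prop := ∃ c, ∀ B, 2 ≤ B → f B ≤ B ^ c

namespace PolyBounded

theorem const (n : ℕ) : PolyBounded fun _ => n :=
  ⟨n, fun _ hB => (Nat.lt_two_pow_self).le.trans (Nat.pow_le_pow_left hB n)⟩

theorem id : PolyBounded fun B => B := ⟨1, fun B _ => by simp⟩

theorem mul {f g : ℕ → ℕ} (hf : PolyBounded f) (hg : PolyBounded g) :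
    PolyBounded fun B => f B * g B := by
  obtain ⟨c, hc⟩ := hf
  obtain ⟨d, hd⟩ := hg
  exact ⟨c + d, fun B hB => (Nat.mul_le_mul (hc B hB) (hd B hB)).trans_eq (pow_add _ _ _).symm⟩

/-- For `B ≥ 2` a sum of two powers of `B` is absorbed by one more factor `B`, so bounds need no
coefficients. -/
theorem add {f g : ℕ → ℕ} (hf : PolyBounded f) (hg : PolyBounded g) :
    PolyBounded fun B => f B + g B := by
  obtain ⟨c, hc⟩ := hf
  obtain ⟨d, hd⟩ := hg
  refine ⟨c + d + 1, fun B hB => ?_⟩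
  have h1 : B ^ c ≤ B ^ (c + d) := Nat.pow_le_pow_right (by omega) (by omega)
  have h2 : B ^ d ≤ B ^ (c + d) := Nat.pow_le_pow_right (by omega) (by omega)
  have h3 : B ^ (c + d) * 2 ≤ B ^ (c + d + 1) := by
    rw [pow_succ]
    exact Nat.mul_le_mul_left _ hB
  have := hc B hB
  have := hd B hB
  show f B + g B ≤ _
  omega

theorem comp {f g : ℕ → ℕ} (hf : PolyBounded f) (hg : PolyBounded g) (h : ∀ B, 2 ≤ B → 2 ≤ g B) :
    PolyBounded fun B => f (g B) := by
  obtain ⟨c, hc⟩ := hf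
  obtain ⟨d, hd⟩ := hg
  exact ⟨d * c, fun B hB => (hc _ (h B hB)).trans
    ((Nat.pow_le_pow_left (hd B hB) c).trans_eq (pow_mul _ _ _).symm)⟩

end PolyBounded

/-- The term is fixed and only `B` varies: each bounded sum substitutes a polynomial into a
polynomial, and this happens a constant number of times. -/
theorem polyBounded_size (t : Term Γ) : PolyBounded (size t) := by
  induction t with
  | var i => exact .id
  | one => exact .const 1
  | add a b iha ihb => exact iha.add ihb
  | sub a b iha ihb => exact iha
  | sum a b iha ihb =>
    exact iha.mul (ihb.comp (PolyBounded.id.add iha) fun B hB => hB.trans (Nat.le_add_right _ _))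
  | read k c a iha => exact .const 1
  | len k => exact .id

theorem polyBounded_time (t : Term Γ) : PolyBounded (time t) := by
  induction t with
  | var i => exact (PolyBounded.id.mul (.const 5)).add (.const 2)
  | one => exact .const 1
  | add a b iha ihb => exact iha.add ihb
  | sub a b iha ihb =>
    exact iha.add (ihb.add ((((polyBounded_size b).mul (.const 3)).add (.const 1)).add
      (((polyBounded_size a).mul (.const 3)).add (.const 1))))
  | sum a b iha ihb =>
    have ha := polyBounded_size a
    exact iha.add (((ha.mul ((ihb.comp (PolyBounded.id.add ha) fun B hB =>
      hB.trans (Nat.le_add_right _ _)).add (.const 3))).add (.const 1)).add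
        ((ha.mul (.const 2)).add (.const 1)))
  | read k c a iha =>
    have ha := polyBounded_size a
    exact iha.add (((ha.mul (.const 3)).add (.const 1)).add
      ((PolyBounded.const 2).add ((ha.mul (.const 2)).add (.const 1))))
  | len k => exact (PolyBounded.id.mul (.const 5)).add (.const 2)

/-! ### Programs that evaluate terms in unary. -/

/-- The tapes in a store. -/
def tapes (S : Store Γ) : Fin 3 → List Γ := fun k => S k

/-- The valuation given by the heights of the stacks listed in `ρ`. -/
def heights (S : Store Γ) (ρ : List ℕ) (i : ℕ) : ℕ :=
  match ρ[i]? with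
  | some r => (S r).length
  | none => 0

/-- The stacks `dst`, those in `ρ`, the tapes and the workspace do not interfere, and the workspace
is empty. -/
structure Ready (S : Store Γ) (ρ : List ℕ) (dst d : ℕ) : Prop where
  three_le : 3 ≤ dst
  lt : dst < d
  mem : ∀ r ∈ ρ, r < d ∧ r ≠ dst
  nil : ∀ j, d ≤ j → S j = []

theorem tapes_update (S : Store Γ) {j : ℕ} (hj : 3 ≤ j) (l : List Γ) :
    tapes (Function.update S j l) = tapes S := by
  funext k
  exact Function.update_of_ne (by omega) _ _

theorem heights_update (S : Store Γ) {ρ : List ℕ} {j : ℕ} (hj : j ∉ ρ) (l : List Γ) :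
    heights (Function.update S j l) ρ = heights S ρ := by
  funext i
  unfold heights
  split
  · next r hr =>
    rw [Function.update_of_ne]
    rintro rfl
    exact hj (List.mem_of_getElem? hr)
  · rfl

theorem heights_cons (S : Store Γ) (r : ℕ) (ρ : List ℕ) :
    heights S (r :: ρ) = extend (S r).length (heights S ρ) := by
  funext i
  cases i <;> rfl

theorem Ready.not_mem {S : Store Γ} {ρ : List ℕ} {dst d : ℕ} (h : Ready S ρ dst d) :
    dst ∉ ρ := fun hm => (h.mem _ hm).2 rfl

theorem Ready.not_mem_of_le {S : Store Γ} {ρ : List ℕ} {dst d j : ℕ} (h : Ready S ρ dst d)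
    (hj : d ≤ j) : j ∉ ρ := fun hm => absurd (h.mem _ hm).1 (by omega)

variable [Inhabited Γ]

open Prog in
/-- A program that pushes as many symbols on the stack `dst` as the value of the term says. The
tapes are the stacks `0`, `1`, `2`, variables are represented by the heights of the stacks listed
in `ρ`, and the stacks from `d` on serve as workspace. -/
def code : Term Γ → List ℕ → ℕ → ℕ → Prog Γ
  | var i, ρ, dst, d =>
    match ρ[i]? with
    | some r => copy default r dst d
    | none => .loop d (.drop d)
  | one, _, dst, _ => .push dst default
  | add a b, ρ, dst, d => .seq (code a ρ dst d) (code b ρ dst d)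
  | sub a b, ρ, dst, d =>
    .seq (code a ρ d (d + 1)) (.seq (code b ρ (d + 1) (d + 2))
      (.seq (.loop (d + 1) (.seq (.drop (d + 1)) (.drop d)))
        (.loop d (.seq (.drop d) (.push dst default)))))
  | sum a b, ρ, dst, d =>
    .seq (code a ρ d (d + 1))
      (.seq (.loop d (.seq (.drop d) (.seq (code b ((d + 1) :: ρ) dst (d + 2))
          (.push (d + 1) default))))
        (.loop (d + 1) (.drop (d + 1))))
  | read k c a, ρ, dst, d =>
    .seq (code a ρ d (d + 1))
      (.seq (.loop d (.seq (.drop d) (.move k (d + 1))))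
        (.seq (.cond k c (.push dst default)) (.loop (d + 1) (.move (d + 1) k))))
  | len k, _, dst, d => copy default k dst d

/-- Results are pushed on top of what `dst` already holds, so addition is sequential composition and
a bounded sum is a loop that evaluates its summand again and again. Intermediate results go to the
stacks from `d` on, which are empty again at the end. -/
theorem det_code (t : Term Γ) : ∀ (S : Store Γ) (ρ : List ℕ) (dst d B : ℕ), Ready S ρ dst d →
    (∀ k, (tapes S k).length ≤ B) → (∀ i, heights S ρ i ≤ B) →
    Prog.Det (code t ρ dst d) S (Function.update S dst
      (List.replicate (eval (tapes S) t (heights S ρ)) default ++ S dst)) (time t B) := by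
  induction t with
  | var i =>
    intro S ρ dst d B hR hT he
    have hi := he i
    simp only [code, eval, heights, time] at hi ⊢
    split
    · next r hr =>
      simp only [hr] at hi
      have hm := hR.mem r (List.mem_of_getElem? hr)
      have := hR.lt
      exact (Prog.det_copy default (by omega) (by omega) (by omega) (hR.nil d le_rfl)).mono
        (by omega)
    · simp only [List.replicate_zero, List.nil_append, Function.update_eq_self]
      exact (Prog.Det.loop_nil (hR.nil d le_rfl)).mono (by omega)
  | one =>
    intro S ρ dst d B hR hT he
    exact Prog.Det.push rfl
  | add a b iha ihb =>
    intro S ρ dst d B hR hT he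
    have h3 := hR.three_le
    have hd := hR.lt
    set n := eval (tapes S) a (heights S ρ) with hn
    have h1 := tapes_update S h3 (List.replicate n default ++ S dst)
    have h2 := heights_update S hR.not_mem (List.replicate n default ++ S dst)
    refine Prog.Det.seq (iha S ρ dst d B hR hT he) ?_
    have := ihb (Function.update S dst (List.replicate n default ++ S dst)) ρ dst d B
      ⟨h3, hd, hR.mem, fun j hj => by
        rw [Function.update_of_ne (by omega), hR.nil j hj]⟩ (by rwa [h1]) (by rwa [h2])
    rw [h1, h2] at this
    convert this using 1
    rw [Function.update_idem, Function.update_self, ← List.append_assoc,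
      ← List.replicate_add, eval, add_comm]
  | sub a b iha ihb =>
    intro S ρ dst d B hR hT he
    have h3 := hR.three_le
    have hd := hR.lt
    set m := eval (tapes S) a (heights S ρ) with hm
    set n := eval (tapes S) b (heights S ρ) with hn
    have h1 := tapes_update S (j := d) (by omega) (List.replicate m default ++ S d)
    have h2 := heights_update S (hR.not_mem_of_le le_rfl) (List.replicate m default ++ S d)
    have hsa : m ≤ size a B := eval_le_size _ _ _ _ hT he
    have hsb : n ≤ size b B := eval_le_size _ _ _ _ hT he
    refine Prog.Det.seq (iha S ρ d (d + 1) B ⟨by omega, by omega, fun r hr => ?_, fun j hj =>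
      hR.nil j (by omega)⟩ hT he) ?_
    · have := hR.mem r hr
      omega
    have := ihb (Function.update S d (List.replicate m default ++ S d)) ρ (d + 1) (d + 2) B
      ⟨by omega, by omega, fun r hr => by have := hR.mem r hr; omega, fun j hj => by
        rw [Function.update_of_ne (by omega), hR.nil j (by omega)]⟩ (by rwa [h1]) (by rwa [h2])
    rw [h1, h2, ← hn] at this
    refine Prog.Det.seq this ?_
    have e1 := hR.nil d le_rfl
    have e2 := hR.nil (d + 1) (by omega)
    refine Prog.Det.seq ((Prog.det_loop_drop_drop (d := d) (d' := d + 1) (by omega) rfl).mono ?_)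
      ((Prog.det_loop_drop_push default (by omega) ?_).mono ?_)
    · simp [e2]
      omega
    · funext j
      simp only [Function.update_apply]
      split_ifs <;> first | omega | rfl | simp [eval, e1, e2, ← hm, ← hn] | (subst_vars; assumption)
    · simp [e1, e2]
      omega
  | sum a b iha ihb =>
    intro S ρ dst d B hR hT he
    have h3 := hR.three_le
    have hd := hR.lt
    set m := eval (tapes S) a (heights S ρ) with hm
    have hsa : m ≤ size a B := eval_le_size _ _ _ _ hT he
    have e1 := hR.nil d le_rfl
    have e2 := hR.nil (d + 1) (by omega)
    refine Prog.Det.seq (iha S ρ d (d + 1) B ⟨by omega, by omega, fun r hr => ?_, fun j hj =>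
      hR.nil j (by omega)⟩ hT he) ?_
    · have := hR.mem r hr
      omega
    let f : ℕ → ℕ := fun x => eval (tapes S) b (extend x (heights S ρ))
    -- Before turn `i`, the stack `d` counts the turns that remain, `d + 1` is the summation
    -- variable with value `i`, and `dst` has received the first `i` summands.
    let I : ℕ → Store Γ := fun i => Function.update (Function.update (Function.update S d
      (List.replicate (m - i) default)) (d + 1) (List.replicate i default)) dst
        (List.replicate (∑ x ∈ Finset.range i, f x) default ++ S dst)
    have hI0 : I 0 = Function.update S d (List.replicate m default ++ S d) := by
      funext j
      simp only [I, Function.update_apply]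
      split_ifs <;> first | omega | simp [*]
    have hloop := Prog.Det.loop (k := d)
      (p := .seq (.drop d) (.seq (code b ((d + 1) :: ρ) dst (d + 2))
      (.push (d + 1) default))) (T := time b (B + size a B) + 2) m I ?_ ?_ ?_
    · rw [← hm, ← hI0]
      refine Prog.Det.seq (hloop.mono ?_) ((Prog.det_loop_drop ?_).mono ?_)
      · exact Nat.add_le_add_right (Nat.mul_le_mul_right _ hsa) _
      · funext j
        simp only [I, Function.update_apply, eval, ← hm]
        split_ifs <;> first | omega | simp [f, *]
      · simp only [I, Function.update_apply]
        split_ifs <;> first | omega | (rw [List.length_replicate]; omega)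
    · intro i hi
      simp only [I, Function.update_apply]
      split_ifs <;> first | omega | (simp; omega)
    · simp only [I, Function.update_apply]
      split_ifs <;> first | omega | simp
    · intro i hi
      set S₁ := Function.update (I i) d (I i d).tail with hS₁
      have hdd : S₁ = Function.update (Function.update (Function.update S d
          (List.replicate (m - (i + 1)) default)) (d + 1) (List.replicate i default)) dst
          (List.replicate (∑ x ∈ Finset.range i, f x) default ++ S dst) := by
        funext j
        simp only [hS₁, I, Function.update_apply]
        split_ifs <;> first | omega | (simp; omega) | rfl
      have ht : tapes S₁ = tapes S := by
        rw [hdd, tapes_update _ (by omega), tapes_update _ (by omega), tapes_update _ (by omega)]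
      have hh : heights S₁ ((d + 1) :: ρ) = extend i (heights S ρ) := by
        rw [heights_cons, hdd, heights_update _ hR.not_mem,
          heights_update _ (hR.not_mem_of_le (by omega)),
          heights_update _ (hR.not_mem_of_le (by omega)), Function.update_of_ne (by omega),
          Function.update_self, List.length_replicate]
      -- The summation variable stays below `m ≤ size a B`, hence the bound `B + size a B` for the
      -- extended valuation.
      have hb := ihb S₁ ((d + 1) :: ρ) dst (d + 2) (B + size a B) ⟨h3, by omega, ?_, ?_⟩ ?_ ?_
      · refine (Prog.Det.seq (Prog.Det.drop rfl) (Prog.Det.seq hb (Prog.Det.push ?_))).mono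
          (by omega)
        rw [ht, hh, hdd]
        funext j
        simp only [I, Function.update_apply]
        split_ifs <;> first | omega | rfl | skip
        rw [← List.append_assoc, ← List.replicate_add, Finset.sum_range_succ, add_comm]
      · intro r hr
        rcases List.mem_cons.mp hr with rfl | hr
        · omega
        · have := hR.mem r hr
          omega
      · intro j hj
        rw [hdd, Function.update_of_ne (by omega), Function.update_of_ne (by omega),
          Function.update_of_ne (by omega), hR.nil j (by omega)]
      · rw [ht]
        exact fun k => (hT k).trans (Nat.le_add_right _ _)
      · rw [hh]
        exact extend_le he (by omega)
  | read k c a iha =>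
    intro S ρ dst d B hR hT he
    have h3 := hR.three_le
    have hd := hR.lt
    have hk := k.2
    set m := eval (tapes S) a (heights S ρ) with hm
    have hsa : m ≤ size a B := eval_le_size _ _ _ _ hT he
    have e1 := hR.nil d le_rfl
    have e2 := hR.nil (d + 1) (by omega)
    refine Prog.Det.seq (iha S ρ d (d + 1) B ⟨by omega, by omega, fun r hr => ?_, fun j hj =>
      hR.nil j (by omega)⟩ hT he) ?_
    · have := hR.mem r hr
      omega
    refine Prog.Det.seq ((Prog.det_loop_drop_move (d := d) (k := k) (d' := d + 1) (by omega)
      (by omega) (by omega) (S' := Function.update (Function.update S k ((S k).drop m)) (d + 1)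
        ((S k).take m).reverse) ?_).mono ?_) ?_
    · funext j
      simp only [Function.update_apply]
      split_ifs <;> simp_all <;> omega
    · simp [e1]
      omega
    -- After the first `m` symbols have been moved aside, the test of the top of tape `k` reads
    -- position `m`; past the end there is no top symbol and the value is `0`.
    have hread : ((S k).drop m).head? = (S k)[m]? := by simp
    refine Prog.Det.seq (S' := Function.update (Function.update (Function.update S k
      ((S k).drop m)) (d + 1) ((S k).take m).reverse) dst
        (List.replicate (eval (tapes S) (read k c a) (heights S ρ)) default ++ S dst)) ?_
        ((Prog.det_loop_move (by omega) rfl ?_).mono ?_)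
    · by_cases hc : (S k)[m]? = some c
      · refine Prog.Det.cond_true ?_ (Prog.Det.push ?_)
        · rw [Function.update_of_ne (by omega), Function.update_self, hread, hc]
        · have : eval (tapes S) (read k c a) (heights S ρ) = 1 := if_pos hc
          rw [this, Function.update_of_ne (by omega), Function.update_of_ne (by omega)]
          rfl
      · have : eval (tapes S) (read k c a) (heights S ρ) = 0 := if_neg hc
        rw [this]
        have hself : S dst = Function.update (Function.update S (k : ℕ) ((S k).drop m)) (d + 1)
          ((S k).take m).reverse dst := by
          rw [Function.update_of_ne (by omega), Function.update_of_ne (by omega)]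
        rw [List.replicate_zero, List.nil_append, hself, Function.update_eq_self]
        refine (Prog.Det.cond_false ?_).mono (by omega)
        rw [Function.update_of_ne (by omega), Function.update_self, hread]
        exact hc
    · have k1 : ¬ (k : ℕ) = dst := by omega
      have k2 : ¬ (k : ℕ) = d + 1 := by omega
      have k3 : ¬ d + 1 = dst := by omega
      funext j
      simp only [Function.update_apply]
      split_ifs <;> simp_all
    · rw [Function.update_of_ne (by omega), Function.update_self, List.length_reverse]
      have := List.length_take_le m (S k)
      omega
  | len k =>
    intro S ρ dst d B hR hT he
    have h3 := hR.three_le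
    have hd := hR.lt
    have hk := k.2
    have := hT k
    refine (Prog.det_copy default (by omega) (by omega) (by omega) (hR.nil d le_rfl)).mono ?_
    simp only [tapes] at this
    simp only [time]
    omega

end Term
end ShEx

namespace ShEx

/-! ### A sufficient condition for membership in NEXP -/

open Prog in
-- A turn takes three steps (test, drop, guess), and only the guess depends on its choice; the final
-- test accounts for the `+ 1`. So every sequence of choices of this length guesses some bits, and
-- every list of bits is guessed by some choices. The bit guessed first ends up last in the list.
theorem Prog.runs_loop_guess {Γ : Type} (a : Bool → Γ) {d k : ℕ} (hdk : d ≠ k) :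
    ∀ (n : ℕ) (S : Store Γ), (S d).length = n →
      (∀ cs : List Bool, cs.length = n * 3 + 1 → ∃ bits : List Bool, bits.length = n ∧
        Runs (.loop d (.seq (.drop d) (.guess k a))) S cs
          (Function.update (Function.update S d []) k (bits.map a ++ S k))) ∧
      ∀ bits : List Bool, bits.length = n → ∃ cs : List Bool, cs.length = n * 3 + 1 ∧
        Runs (.loop d (.seq (.drop d) (.guess k a))) S cs
          (Function.update (Function.update S d []) k (bits.map a ++ S k)) := by
  intro n
  induction n with
  | zero =>
    intro S hS
    have hnil : S d = [] := List.eq_nil_of_length_eq_zero hS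
    have hup : Function.update (Function.update S d []) k (([] : List Bool).map a ++ S k) = S := by
      rw [← hnil, Function.update_eq_self, List.map_nil, List.nil_append, Function.update_eq_self]
    refine ⟨fun cs hcs => ⟨[], rfl, ?_⟩, fun bits hbits => ⟨[true], rfl, ?_⟩⟩
    · obtain ⟨b, rfl⟩ := List.length_eq_one_iff.mp hcs
      rw [hup]
      exact .loop_nil _ _ _ _ hnil
    · rw [List.eq_nil_of_length_eq_zero hbits, hup]
      exact .loop_nil _ _ _ _ hnil
  | succ n ih =>
    intro S hS
    have hne : S d ≠ [] := fun h => by simp [h] at hS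
    have step : ∀ b₁ b₂ b₃ cs bits, Runs (.loop d (.seq (.drop d) (.guess k a)))
        (Function.update (Function.update S d (S d).tail) k (a b₃ :: S k)) cs
        (Function.update (Function.update (Function.update (Function.update S d (S d).tail) k
          (a b₃ :: S k)) d []) k (bits.map a ++ (a b₃ :: S k))) →
        Runs (.loop d (.seq (.drop d) (.guess k a))) S (b₁ :: ([b₂, b₃] ++ cs))
          (Function.update (Function.update S d []) k ((bits ++ [b₃]).map a ++ S k)) := by
      intro b₁ b₂ b₃ cs bits h
      refine .loop_cons hne (.seq (cs := [b₂]) (cs' := [b₃]) (.drop d S b₂) (.guess k a _ b₃)) ?_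
      rw [Function.update_of_ne hdk.symm]
      convert h using 1
      funext j
      simp only [Function.update_apply]
      split_ifs <;> simp_all
    have ih := fun b₃ => ih (Function.update (Function.update S d (S d).tail) k (a b₃ :: S k))
      (by rw [Function.update_of_ne hdk, Function.update_self, List.length_tail]; omega)
    simp only [Function.update_self] at ih
    constructor
    · intro cs hcs
      obtain _ | ⟨b₁, _ | ⟨b₂, _ | ⟨b₃, cs⟩⟩⟩ := cs
      · simp at hcs
      · simp at hcs
      · simp at hcs
      · obtain ⟨bits, hbits, h⟩ := (ih b₃).1 cs (by simp only [List.length_cons] at hcs; omega)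
        exact ⟨bits ++ [b₃], by simp [hbits], step b₁ b₂ b₃ cs bits h⟩
    · intro bits hbits
      obtain rfl | ⟨bits, b₃, rfl⟩ := List.eq_nil_or_concat bits
      · exact absurd hbits (by simp)
      · obtain ⟨cs, hcs, h⟩ := (ih b₃).2 bits (by simpa using hbits)
        rw [List.concat_eq_append]
        refine ⟨true :: ([true, b₃] ++ cs), ?_, step true true b₃ cs bits h⟩
        simp only [List.length_cons, List.length_append, hcs, List.length_nil]
        omega

/-! ### The machine that guesses bits and evaluates a term. -/

namespace Term

variable {A : Type}

instance : Inhabited (A ⊕ Bool) := ⟨Sum.inr true⟩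

/-- A constant. -/
def const {Γ : Type} : ℕ → Term Γ
  | 0 => sub one one
  | n + 1 => add (const n) one

@[simp]
theorem eval_const {Γ : Type} (T : Fin 3 → List Γ) (n : ℕ) (e : ℕ → ℕ) :
    eval T (const n) e = n := by
  induction n with
  | zero => rfl
  | succ n ih => simp [const, eval, ih]

/-- The input tape, the tape with guessed bits, and a tape of length `16 ^ |w|`. -/
def workTapes (w : List A) (bits : List Bool) : Fin 3 → List (A ⊕ Bool) :=
  ![w.map Sum.inl, bits.map Sum.inr, List.replicate (16 ^ w.length) default]

/-- The stacks with the given tapes, and a unary number on stack `4`. -/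
def workStore (w : List A) (bits : List Bool) (n : ℕ) : Store (A ⊕ Bool)
  | 0 => w.map Sum.inl
  | 1 => bits.map Sum.inr
  | 2 => List.replicate (16 ^ w.length) default
  | 4 => List.replicate n default
  | _ => []

theorem tapes_workStore (w : List A) (bits : List Bool) (n : ℕ) :
    tapes (workStore w bits n) = workTapes w bits := by
  funext k
  fin_cases k <;> rfl

/-- One round of the initialisation: multiply the height of stack `2` by `16`. -/
def growProg : Prog (A ⊕ Bool) :=
  .seq (code (sum (len 2) (const 16)) [] 6 7) (.seq (.loop 2 (.drop 2)) (.loop 6 (.move 6 2)))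

/-- The initialisation. -/
def initProg : Prog (A ⊕ Bool) :=
  .seq (.push 2 default) (.seq (.loop 0 (.seq (.move 0 5) growProg)) (.loop 5 (.move 5 0)))

theorem heights_nil {Γ : Type} (S : Store Γ) : heights S [] = fun _ => 0 := rfl

theorem det_growProg {S S' : Store (A ⊕ Bool)} {n B : ℕ} (h2 : S 2 = List.replicate n default)
    (h6 : ∀ j, 6 ≤ j → S j = []) (hB : ∀ k, (tapes S k).length ≤ B) (hnB : n * 16 ≤ B)
    (hS' : S' = Function.update S 2 (List.replicate (n * 16) default)) :
    Prog.Det growProg S S' (time (sum (len 2) (const 16) : Term (A ⊕ Bool)) B +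
      (B * 2 + 1 + (B * 2 + 1))) := by
  have h := det_code (sum (len 2) (const 16)) S [] 6 7 B
    ⟨by omega, by omega, by simp, fun j hj => h6 j (by omega)⟩ hB (by simp [heights_nil])
  have hev : eval (tapes S) (sum (len 2) (const 16)) (heights S []) = n * 16 := by
    simp [eval, tapes, h2]
  rw [hev] at h
  refine Prog.Det.seq h (Prog.Det.seq ((Prog.det_loop_drop rfl).mono ?_)
    ((Prog.det_loop_move (by omega) rfl ?_).mono ?_))
  · rw [Function.update_of_ne (by omega), h2, List.length_replicate]
    omega
  · subst hS'
    have := h6 6 le_rfl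
    funext j
    simp only [Function.update_apply]
    split_ifs <;> simp_all
  · rw [Function.update_of_ne (by omega), Function.update_self, h6 6 le_rfl]
    simp
    omega

/-- A bound on the time of the initialisation. -/
def initTime (A : Type) (B : ℕ) : ℕ :=
  1 + (B * (1 + (time (sum (len 2) (const 16) : Term (A ⊕ Bool)) B +
      (B * 2 + 1 + (B * 2 + 1))) + 1) + 1 + (B * 2 + 1))

/-- The input serves as a loop counter: each symbol is moved aside to stack `5` while stack `2`,
which starts with one symbol, becomes `16` times as high; then the input is moved back. `B` bounds
all tapes throughout. -/
theorem det_initProg (w : List A) :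
    Prog.Det initProg (Function.update (fun _ => []) 0 (w.map Sum.inl)) (workStore w [] 0)
      (initTime A (16 ^ (w.length + 1))) := by
  set B := 16 ^ (w.length + 1) with hB
  have hwB : w.length ≤ B := (Nat.le_succ _).trans
    (Nat.lt_pow_self (show 1 < 16 by omega)).le
  let I : ℕ → Store (A ⊕ Bool) := fun i => Function.update (Function.update (Function.update
    (fun _ => []) 0 ((w.map Sum.inl).drop i)) 5 ((w.map Sum.inl).take i).reverse) 2
      (List.replicate (16 ^ i) default)
  have hI0 : Function.update (Function.update (fun _ => []) 0 (w.map Sum.inl) : Store (A ⊕ Bool)) 2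
      [default] = I 0 := by
    funext j
    simp only [I, Function.update_apply]
    split_ifs <;> first | omega | simp
  have hloop := Prog.Det.loop (k := 0) (p := .seq (.move 0 5) growProg) (T := 1 +
    (time (sum (len 2) (const 16) : Term (A ⊕ Bool)) B + (B * 2 + 1 + (B * 2 + 1))))
    w.length I ?_ ?_ ?_
  · refine Prog.Det.seq (Prog.Det.push hI0.symm) (Prog.Det.seq (hloop.mono ?_)
      ((Prog.det_loop_move (by omega) rfl ?_).mono ?_))
    · exact Nat.add_le_add_right (Nat.mul_le_mul_right _ hwB) _
    · funext j
      simp only [I, Function.update_apply]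
      split_ifs <;> first | contradiction | omega | (subst_vars; simp [workStore]; done) | skip
      unfold workStore
      split <;> first | omega | rfl
    · simp [I]
      omega
  · intro i hi
    simp [I, hi]
  · simp [I]
  · intro i hi
    have hi' : i < (w.map (Sum.inl (β := Bool))).length := by simpa using hi
    have hpow : 16 ^ (i + 1) ≤ B := Nat.pow_le_pow_right (by omega) (by omega)
    refine Prog.Det.seq (Prog.Det.move_cons (a := (w.map Sum.inl)[i])
      (l := (w.map Sum.inl).drop (i + 1)) ?_ (by omega) rfl)
      (det_growProg (n := 16 ^ i) ?_ ?_ ?_ ?_ ?_)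
    · simp only [I, Function.update_apply]
      exact List.drop_eq_getElem_cons hi'
    · simp [I]
    · intro j hj
      simp only [I, Function.update_apply]
      split_ifs <;> first | omega | rfl
    · intro k
      rw [pow_succ] at hpow
      fin_cases k <;> simp [tapes, I] <;> omega
    · rwa [← pow_succ]
    · rw [← pow_succ]
      funext j
      simp only [I, Function.update_apply]
      split_ifs <;> first | omega | rfl | skip
      exact Prog.reverse_take_succ hi'

/-- The whole program: initialise, guess bits, evaluate a term. -/
def guessAndEval (l t : Term (A ⊕ Bool)) : Prog (A ⊕ Bool) :=
  .seq initProg (.seq (code l [] 4 5) (.seq (.loop 4 (.seq (.drop 4) (.guess 1 Sum.inr)))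
    (code t [] 3 5)))

/-- A bound on the time of the whole program. -/
def totalTime (l t : Term (A ⊕ Bool)) (B : ℕ) : ℕ :=
  initTime A B + (time l B + (size l B * 3 + 1 + time t (B + size l B)))

theorem workTapes_length_le (w : List A) (bits : List Bool) {B : ℕ} (hB : 16 ^ (w.length + 1) ≤ B)
    (hb : bits.length ≤ B) (k : Fin 3) : (workTapes w bits k).length ≤ B := by
  have h1 : w.length < 16 ^ w.length := Nat.lt_pow_self (by omega)
  rw [pow_succ] at hB
  fin_cases k <;> simp [workTapes] <;> omega

/-- The stacks when the program halts. -/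
noncomputable def finalStore (t : Term (A ⊕ Bool)) (w : List A) (bits : List Bool) :
    Store (A ⊕ Bool) :=
  Function.update (workStore w bits 0) 3
    (List.replicate (eval (workTapes w bits) t fun _ => 0) default)

variable (l t : Term (A ⊕ Bool)) (w : List A)

/-- The phases before the guess take a number `t₀` of steps that does not depend on the choices, and
leave the number of bits to be guessed on stack `4`. -/
theorem guessAndEval_aux : ∃ t₀ ≤ initTime A (16 ^ (w.length + 1)) + time l (16 ^ (w.length + 1)),
    (∀ cs : List Bool, cs.length = t₀ → ∀ cs' S,
      Prog.Runs (.seq (.loop 4 (.seq (.drop 4) (.guess 1 Sum.inr))) (code t [] 3 5))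
        (workStore w [] (eval (workTapes w []) l fun _ => 0)) cs' S →
      Prog.Runs (guessAndEval l t) (Function.update (fun _ => []) 0 (w.map Sum.inl))
        (cs ++ cs') S) := by
  obtain ⟨t₁, ht₁, h₁⟩ := det_initProg w
  obtain ⟨t₂, ht₂, h₂⟩ := det_code l (workStore w [] 0) [] 4 5 (16 ^ (w.length + 1))
    ⟨by omega, by omega, by simp, fun j hj => by
      unfold workStore; split <;> first | omega | rfl⟩
    (by rw [tapes_workStore]; exact workTapes_length_le w [] le_rfl (by simp))
    (by simp [heights_nil])
  rw [tapes_workStore, heights_nil] at h₂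
  have e : Function.update (workStore w [] 0) 4 (List.replicate (eval (workTapes w []) l fun _ => 0)
      default ++ workStore w [] 0 4) = workStore w [] (eval (workTapes w []) l fun _ => 0) := by
    funext j
    by_cases hj : j = 4
    · subst hj
      simp [workStore]
    · rw [Function.update_of_ne hj]
      unfold workStore
      split <;> first | omega | rfl
  rw [e] at h₂
  refine ⟨t₁ + t₂, by omega, fun cs hcs cs' S h => ?_⟩
  rw [← List.take_append_drop t₁ cs, List.append_assoc]
  exact .seq (h₁ _ (by simp [hcs])) (.seq (h₂ _ (by simp [hcs])) h)

theorem det_final {bits : List Bool} (hb : bits.length ≤ size l (16 ^ (w.length + 1))) :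
    Prog.Det (code t [] 3 5) (workStore w bits 0) (finalStore t w bits)
      (time t (16 ^ (w.length + 1) + size l (16 ^ (w.length + 1)))) := by
  have h := det_code t (workStore w bits 0) [] 3 5 (16 ^ (w.length + 1) +
    size l (16 ^ (w.length + 1)))
    ⟨by omega, by omega, by simp, fun j hj => by
      unfold workStore; split <;> first | omega | rfl⟩
    (by
      rw [tapes_workStore]
      exact workTapes_length_le w bits (Nat.le_add_right _ _) (hb.trans (Nat.le_add_left _ _)))
    (by simp [heights_nil])
  rw [tapes_workStore, heights_nil, show workStore w bits 0 3 = [] from rfl, List.append_nil] at h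
  exact h

theorem eval_le_size_workTapes : (eval (workTapes w []) l fun _ => 0) ≤
    size l (16 ^ (w.length + 1)) :=
  eval_le_size _ _ _ _ (workTapes_length_le w [] le_rfl (by simp)) (by simp)

theorem update_workStore (bits : List Bool) (n : ℕ) :
    Function.update (Function.update (workStore w [] n) 4 []) 1
      (bits.map Sum.inr ++ workStore w [] n 1) = workStore w bits 0 := by
  funext j
  simp only [Function.update_apply]
  split_ifs
  · subst_vars
    simp [workStore]
  · subst_vars
    rfl
  · unfold workStore
    split <;> first | omega | rfl

/-- Every sufficiently long sequence of choices starts with a complete run. A prefix is needed,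
rather than a common length, because the duration of the last phase may depend on the guessed bits.
-/
theorem guessAndEval_total (cs : List Bool)
    (hcs : totalTime l t (16 ^ (w.length + 1)) ≤ cs.length) :
    ∃ cs₁ cs₂ bits, cs = cs₁ ++ cs₂ ∧ cs₁.length ≤ totalTime l t (16 ^ (w.length + 1)) ∧
      bits.length = (eval (workTapes w []) l fun _ => 0) ∧
      Prog.Runs (guessAndEval l t) (Function.update (fun _ => []) 0 (w.map Sum.inl)) cs₁
        (finalStore t w bits) := by
  set B := 16 ^ (w.length + 1) with hB
  obtain ⟨t₀, ht₀, h₀⟩ := guessAndEval_aux l t w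
  have hn := eval_le_size_workTapes l w
  set n := eval (workTapes w []) l fun _ => 0 with hn'
  rw [← hB] at ht₀
  have hn : n ≤ size l B := hn
  have hcs' := hcs
  unfold totalTime at hcs
  have hg := (Prog.runs_loop_guess (Γ := A ⊕ Bool) Sum.inr (d := 4) (k := 1) (by omega) n
    (workStore w [] n) (by simp [workStore])).1
  obtain ⟨bits, hbits, hg⟩ := hg ((cs.drop t₀).take (n * 3 + 1)) (by
    rw [List.length_take, List.length_drop]
    omega)
  obtain ⟨t₁, ht₁, h₁⟩ := det_final l t w (bits := bits) (by rw [← hB]; omega)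
  rw [← hB] at ht₁
  rw [update_workStore] at hg
  refine ⟨cs.take (t₀ + ((n * 3 + 1) + t₁)), cs.drop (t₀ + ((n * 3 + 1) + t₁)), bits,
    (List.take_append_drop _ _).symm, ?_, hbits, ?_⟩
  · rw [List.length_take]
    unfold totalTime
    omega
  · rw [List.take_add, List.take_add]
    refine h₀ _ ?_ _ _ (.seq hg (h₁ _ ?_))
    · rw [List.length_take]
      omega
    · rw [List.length_take, List.length_drop, List.length_drop]
      omega

theorem guessAndEval_exists {bits : List Bool}
    (hbits : bits.length = (eval (workTapes w []) l fun _ => 0)) :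
    ∃ cs, Prog.Runs (guessAndEval l t) (Function.update (fun _ => []) 0 (w.map Sum.inl)) cs
      (finalStore t w bits) := by
  obtain ⟨t₀, -, h₀⟩ := guessAndEval_aux l t w
  have hn := eval_le_size_workTapes l w
  obtain ⟨cs, -, hg⟩ := (Prog.runs_loop_guess (Γ := A ⊕ Bool) Sum.inr (d := 4) (k := 1) (by omega)
    _ (workStore w [] (eval (workTapes w []) l fun _ => 0)) rfl).2 bits
      (by simp [workStore, hbits])
  obtain ⟨t₁, -, h₁⟩ := det_final l t w (bits := bits) (by omega)
  rw [update_workStore] at hg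
  exact ⟨_, h₀ (List.replicate t₀ true) (by simp) _ _ (.seq hg (h₁ (List.replicate t₁ true)
    (by simp)))⟩

theorem polyBounded_totalTime : PolyBounded (totalTime l t) := by
  have h1 : PolyBounded fun B => B * 2 + 1 := (PolyBounded.id.mul (.const 2)).add (.const 1)
  have hs := polyBounded_size l
  refine PolyBounded.add ?_ ((polyBounded_time l).add (((hs.mul (.const 3)).add (.const 1)).add
    ((polyBounded_time t).comp (PolyBounded.id.add hs) fun B hB =>
      hB.trans (Nat.le_add_right _ _))))
  exact (PolyBounded.const 1).add (((PolyBounded.id.mul (((PolyBounded.const 1).add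
    ((polyBounded_time _).add (h1.add h1))).add (.const 1))).add (.const 1)).add h1)

/-- The machine that guesses bits and evaluates a term. -/
noncomputable def machine [Finite A] : NTM A where
  K := Fin (max (guessAndEval l t).bound 3 + 1)
  Γ _ := A ⊕ Bool
  finΓ _ := Fintype.ofFinite _
  Λ := Option (Prog.Loc (guessAndEval l t))
  finΛ := Fintype.ofFinite _
  σ := Option (A ⊕ Bool)
  finσ := Fintype.ofFinite _
  input := Prog.stackNo _ 0
  letter := Sum.inl
  start := some (Prog.entry _)
  initial := none
  program b
    | some a => Prog.compile _ (guessAndEval l t) some none b a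
    | none => .peek (Prog.stackNo _ 3) (fun _ o => o) .halt
  accept := {o | o.isSome}

theorem machine_step_none [Finite A] {c : (machine l t).Cfg} (hc : c.l = none) (b : Bool) :
    (machine l t).step c b = c := by
  obtain ⟨_ | _, _, _⟩ := c
  · rfl
  · simp at hc

theorem machine_foldl_none [Finite A] {c : (machine l t).Cfg} (hc : c.l = none) (cs : List Bool) :
    cs.foldl (machine l t).step c = c := by
  induction cs with
  | nil => rfl
  | cons b cs ih => rw [List.foldl_cons, machine_step_none l t hc, ih]

/-- One more step, with choice `b`, loads the top of stack `3` into the internal state. As the value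
of the term stands there in unary, the state is `some _` exactly if the value is not `0`. -/
theorem machine_run [Finite A] {cs : List Bool} {S : Store (A ⊕ Bool)}
    (h : Prog.Runs (guessAndEval l t) (Function.update (fun _ => []) 0 (w.map Sum.inl)) cs S)
    (b : Bool) (cs' : List Bool) :
    (machine l t).run w (cs ++ b :: cs') = ⟨none, (S 3).head?, Prog.restrict _ S⟩ := by
  have h1 := Prog.foldl_stepWith_of_runs (max (guessAndEval l t).bound 3) (machine l t).program h
    some none (le_max_left _ _) (fun _ _ => rfl)
  have h0 : (machine l t).init w = ⟨some (some (Prog.entry (guessAndEval l t))), none,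
      Prog.restrict (max (guessAndEval l t).bound 3)
        (Function.update (fun _ => []) 0 (w.map Sum.inl))⟩ := by
    rw [← Prog.update_restrict _ _ (Nat.zero_le _)]
    rfl
  rw [NTM.run, List.foldl_append, List.foldl_cons, h0]
  have h2 : cs.foldl (machine l t).step ⟨some (some (Prog.entry (guessAndEval l t))), none,
      Prog.restrict (max (guessAndEval l t).bound 3)
        (Function.update (fun _ => []) 0 (w.map Sum.inl))⟩ = ⟨some none, none,
          Prog.restrict (max (guessAndEval l t).bound 3) S⟩ := h1
  have h3 : (machine l t).step ⟨some none, none,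
      Prog.restrict (max (guessAndEval l t).bound 3) S⟩ b = ⟨none, (S 3).head?,
          Prog.restrict (max (guessAndEval l t).bound 3) S⟩ := by
    rw [← Prog.restrict_stackNo _ S (le_max_right (guessAndEval l t).bound 3)]
    rfl
  rw [h2, h3, machine_foldl_none]
  rfl

/-- A time bound `B ^ c` with `B = 16 ^ (n + 1)` equals `2 ^ (4 * c * (n + 1))`, with a polynomial
in the exponent. -/
theorem mem_NEXP [Finite A] {L : Set (List A)}
    (hL : ∀ w, w ∈ L ↔ ∃ bits : List Bool, bits.length = (eval (workTapes w []) l fun _ => 0) ∧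
      (eval (workTapes w bits) t fun _ => 0) ≠ 0) : L ∈ NEXP A := by
  obtain ⟨c, hc⟩ := (polyBounded_totalTime l t).add (.const 1)
  have htime : ∀ n, totalTime l t (16 ^ (n + 1)) + 1 ≤
      2 ^ (Polynomial.C (4 * c) * (Polynomial.X + 1)).eval n := by
    intro n
    refine (hc _ ?_).trans_eq ?_
    · calc 2 ≤ 16 ^ 1 := by norm_num
        _ ≤ 16 ^ (n + 1) := Nat.pow_le_pow_right (by omega) (by omega)
    · rw [show 16 = 2 ^ 4 from rfl, ← pow_mul, ← pow_mul]
      simp only [Polynomial.eval_mul, Polynomial.eval_C, Polynomial.eval_add, Polynomial.eval_X,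
        Polynomial.eval_one]
      ring
  have hfinal : ∀ (w : List A) bits, ((finalStore t w bits 3).head?).isSome ↔
      (eval (workTapes w bits) t fun _ => 0) ≠ 0 := by
    intro w bits
    rw [finalStore, Function.update_self]
    cases eval (workTapes w bits) t fun _ => 0 <;> simp [List.replicate_succ]
  have htotal : ∀ (w : List A) (cs : List Bool), totalTime l t (16 ^ (w.length + 1)) + 1 ≤
      cs.length → ∃ bits : List Bool, bits.length = (eval (workTapes w []) l fun _ => 0) ∧
        ((machine l t).run w cs).l = none ∧
        ((machine l t).run w cs).var = (finalStore t w bits 3).head? := by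
    intro w cs hcs
    obtain ⟨cs₁, cs₂, bits, rfl, hcs₁, hbits, h⟩ := guessAndEval_total l t w cs (by omega)
    obtain _ | ⟨b, cs₂⟩ := cs₂
    · simp at hcs
      omega
    · rw [machine_run l t w h]
      exact ⟨bits, hbits, rfl, rfl⟩
  refine ⟨machine l t, Polynomial.C (4 * c) * (Polynomial.X + 1), fun w => ⟨fun cs hcs => ?_, ?_⟩⟩
  · obtain ⟨bits, -, h, -⟩ := htotal w cs ((htime _).trans_eq hcs.symm)
    exact h
  · rw [hL]
    constructor
    · rintro ⟨bits, hbits, h⟩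
      obtain ⟨cs, hcs⟩ := guessAndEval_exists l t w hbits
      refine ⟨cs ++ [true], ?_⟩
      rw [machine_run l t w hcs]
      exact ⟨rfl, (hfinal w bits).mpr h⟩
    · rintro ⟨cs, hl, hacc⟩
      -- An accepting sequence of choices may have any length. Padding does not change the halting
      -- configuration and makes the sequence long enough to contain a complete run, which exhibits
      -- the bits.
      obtain ⟨bits, hbits, -, hvar⟩ := htotal w
        (cs ++ List.replicate (totalTime l t (16 ^ (w.length + 1)) + 1) true) (by simp)
      have : (machine l t).run w
          (cs ++ List.replicate (totalTime l t (16 ^ (w.length + 1)) + 1) true) =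
          (machine l t).run w cs := by
        rw [NTM.run, List.foldl_append]
        exact machine_foldl_none l t hl _
      rw [this] at hvar
      rw [hvar] at hacc
      exact ⟨bits, hbits, (hfinal w bits).mp hacc⟩

end Term
end ShEx

namespace ShEx

/-! ### Assignments with lower and upper bounds -/

section Assignment

variable {X F : Type}

/-- The elements reached by alternating paths that start outside the image of `gr`. -/
inductive Alternating (X₀ : X → Prop) (fr : X → F → Prop) (gr : F → X → Prop) : X → Prop
  | base {x} : X₀ x → (∀ y, ¬ gr y x) → Alternating X₀ fr gr x
  | step {x x' y} : Alternating X₀ fr gr x → fr x y → gr y x' → X₀ x' → Alternating X₀ fr gr x'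

theorem Alternating.mem {X₀ : X → Prop} {fr : X → F → Prop} {gr : F → X → Prop} {x : X}
    (h : Alternating X₀ fr gr x) : X₀ x := by
  cases h with
  | base h _ => exact h
  | step _ _ _ h => exact h

open Classical in
/-- A theorem of Mendelsohn and Dulmage: under the two conditions of Hall there is an assignment
that is injective on what is sent to bounded elements and that hits all required elements. -/
theorem exists_assignment [Fintype X] [Fintype F] (compat : X → F → Prop) (bdd req : F → Prop)
    (h₁ : ∀ C : Finset F, (∀ f ∈ C, bdd f) →
      (Finset.univ.filter fun x => ∀ f, compat x f → f ∈ C).card ≤ C.card)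
    (h₂ : ∀ C : Finset F, (∀ f ∈ C, req f) →
      C.card ≤ (Finset.univ.filter fun x => ∃ f ∈ C, compat x f).card) :
    ∃ w : X → F, (∀ x, compat x (w x)) ∧ (∀ x y, w x = w y → bdd (w x) → x = y) ∧
      ∀ f, req f → ∃ x, w x = f := by
  -- The elements of `X₀` must be matched injectively, as all their options are bounded; Hall's
  -- theorem does this by `f`. Dually, `g` chooses distinct elements for all required ones. The two
  -- matchings are now to be merged.
  let X₀ : X → Prop := fun x => ∀ f, compat x f → bdd f
  obtain ⟨f, hfinj, hf⟩ := (Finset.all_card_le_biUnion_card_iff_exists_injective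
    (fun x : {x // X₀ x} => Finset.univ.filter fun y => compat x y)).mp (by
      intro s
      have := h₁ (s.biUnion fun x => Finset.univ.filter fun y => compat x y) (by
        intro y hy
        simp only [Finset.mem_biUnion, Finset.mem_filter, Finset.mem_univ, true_and] at hy
        obtain ⟨x, -, hx⟩ := hy
        exact x.2 y hx)
      refine le_trans ?_ this
      rw [← Finset.card_map (Function.Embedding.subtype _)]
      refine Finset.card_le_card fun x hx => ?_
      simp only [Finset.mem_map, Function.Embedding.coe_subtype] at hx
      obtain ⟨x, hx, rfl⟩ := hx
      simp only [Finset.mem_filter, Finset.mem_univ, true_and, Finset.mem_biUnion]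
      exact fun y hy => ⟨x, hx, hy⟩)
  obtain ⟨g, hginj, hg⟩ := (Finset.all_card_le_biUnion_card_iff_exists_injective
    (fun y : {y // req y} => Finset.univ.filter fun x => compat x y)).mp (by
      intro s
      have := h₂ (s.map (Function.Embedding.subtype _)) (by
        intro y hy
        simp only [Finset.mem_map, Function.Embedding.coe_subtype] at hy
        obtain ⟨y, -, rfl⟩ := hy
        exact y.2)
      rw [Finset.card_map] at this
      refine this.trans (Finset.card_le_card fun x hx => ?_)
      simp only [Finset.mem_filter, Finset.mem_univ, true_and, Finset.mem_map,
        Function.Embedding.coe_subtype, Finset.mem_biUnion] at hx ⊢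
      obtain ⟨_, ⟨y, hy, rfl⟩, hx⟩ := hx
      exact ⟨y, hy, hx⟩)
  simp only [Finset.mem_filter, Finset.mem_univ, true_and] at hf hg
  let fr : X → F → Prop := fun x y => ∃ h : X₀ x, f ⟨x, h⟩ = y
  let gr : F → X → Prop := fun y x => ∃ h : req y, g ⟨y, h⟩ = x
  have fr_inj : ∀ {x x' y}, fr x y → fr x' y → x = x' := by
    rintro x x' y ⟨h, rfl⟩ ⟨h', e⟩
    exact (congrArg Subtype.val (hfinj e)).symm
  have fr_fun : ∀ {x y y'}, fr x y → fr x y' → y = y' := by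
    rintro x y y' ⟨h, rfl⟩ ⟨h', rfl⟩
    rfl
  have gr_inj : ∀ {x y y'}, gr y x → gr y' x → y = y' := by
    rintro x y y' ⟨h, rfl⟩ ⟨h', e⟩
    exact (congrArg Subtype.val (hginj e)).symm
  have gr_fun : ∀ {x x' y}, gr y x → gr y x' → x = x' := by
    rintro x x' y ⟨h, rfl⟩ ⟨h', rfl⟩
    rfl
  -- Follow `f` on `Z`. Outside, follow `g` backwards to a target that `f` does not use on `Z`, or
  -- else go to some unbounded target.
  let Z := Alternating X₀ fr gr
  let W : X → F → Prop := fun x y => (Z x ∧ fr x y) ∨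
    (¬ Z x ∧ gr y x ∧ ∀ x', Z x' → ¬ fr x' y) ∨ (¬ Z x ∧ compat x y ∧ ¬ bdd y)
  -- An element of `X₀` outside `Z` is chosen by `g` for some `y`, otherwise a path starts at it.
  -- This `y` is not used by `f` on `Z`, otherwise a path could be prolonged to the element.
  have hW : ∀ x, ∃ y, W x y := by
    intro x
    by_cases hx : Z x
    · exact ⟨_, Or.inl ⟨hx, Alternating.mem hx, rfl⟩⟩
    by_cases hx₀ : X₀ x
    · have : ∃ y, gr y x := by
        by_contra h
        push Not at h
        exact hx (.base hx₀ h)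
      obtain ⟨y, hy⟩ := this
      exact ⟨y, Or.inr (Or.inl ⟨hx, hy, fun x' hx' h => hx (.step hx' h hy hx₀)⟩)⟩
    · simp only [X₀] at hx₀
      push Not at hx₀
      obtain ⟨y, hy, hb⟩ := hx₀
      exact ⟨y, Or.inr (Or.inr ⟨hx, hy, hb⟩)⟩
  -- If `f` does not hit `y` from `Z`, then `g y` lies outside `Z`: a path that ends at `g y` cannot
  -- start there, and its last step would come from an element of `Z` that `f` sends to `y`.
  have hreq : ∀ y, req y → (∃ x, Z x ∧ fr x y) ∨
      ∃ x, ¬ Z x ∧ gr y x ∧ ∀ x', Z x' → ¬ fr x' y := by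
    intro y hy
    by_cases h : ∃ x, Z x ∧ fr x y
    · exact Or.inl h
    · push Not at h
      have hgr : gr y (g ⟨y, hy⟩) := ⟨hy, rfl⟩
      refine Or.inr ⟨g ⟨y, hy⟩, fun hZ => ?_, hgr, h⟩
      cases hZ with
      | base _ h' => exact h' _ hgr
      | step hZ' hfr hgr' _ => exact h _ hZ' (gr_inj hgr hgr' ▸ hfr)
  -- The second clause takes precedence over the third one.
  have hW' : ∀ x, ∃ y, W x y ∧ ((∃ y, ¬ Z x ∧ gr y x ∧ ∀ x', Z x' → ¬ fr x' y) → gr y x) := by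
    intro x
    by_cases h : ∃ y, ¬ Z x ∧ gr y x ∧ ∀ x', Z x' → ¬ fr x' y
    · obtain ⟨y, hy⟩ := h
      exact ⟨y, Or.inr (Or.inl hy), fun _ => hy.2.1⟩
    · obtain ⟨y, hy⟩ := hW x
      exact ⟨y, hy, fun h' => absurd h' h⟩
  choose w hw hw' using hW'
  refine ⟨w, fun x => ?_, fun x y hxy hb => ?_, fun y hy => ?_⟩
  · rcases hw x with ⟨-, h, e⟩ | ⟨-, ⟨h, e⟩, -⟩ | ⟨-, h, -⟩
    · exact e ▸ hf ⟨x, h⟩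
    · have := hg ⟨w x, h⟩
      rwa [e] at this
    · exact h
  · rcases hw x with ⟨hx, h⟩ | ⟨-, h, hx⟩ | ⟨-, -, h⟩
    · rcases hw y with ⟨hy, h'⟩ | ⟨-, h', hy⟩ | ⟨-, -, h'⟩
      · exact fr_inj h (hxy ▸ h')
      · exact absurd (hxy ▸ h) (hy x hx)
      · exact absurd (hxy ▸ hb) h'
    · rcases hw y with ⟨hy, h'⟩ | ⟨-, h', hy⟩ | ⟨-, -, h'⟩
      · exact absurd (hxy ▸ h') (hx y hy)
      · exact gr_fun h (hxy ▸ h')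
      · exact absurd (hxy ▸ hb) h'
    · exact absurd hb h
  · rcases hreq y hy with ⟨x, hx, h⟩ | ⟨x, hx⟩
    · refine ⟨x, ?_⟩
      rcases hw x with ⟨-, h'⟩ | ⟨h', -⟩ | ⟨h', -⟩
      · exact fr_fun h' h
      · exact absurd hx h'
      · exact absurd hx h'
    · exact ⟨x, gr_inj (hw' x ⟨y, hx⟩) hx.2.1⟩

end Assignment

/-! ### Refutations of containment -/

namespace Interval

/-- The interval does not contain `0`. -/
def Required (I : Interval) : Prop := 1 ≤ I.lo

/-- The interval contains no number above `1`. -/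
def Bounded (I : Interval) : Prop := I.hi ≤ 1

/-- This is what is special about shape graphs: occurrence intervals impose only "at least one" and
"at most one", so that finding a witness becomes a matching problem. -/
theorem mem_toSet_iff {I : Interval} (hI : ∃ M : Basic, I = M.toInterval) {n : ℕ} :
    n ∈ I.toSet ↔ (I.Required → 1 ≤ n) ∧ (I.Bounded → n ≤ 1) := by
  obtain ⟨M, rfl⟩ := hI
  cases M <;> simp [toSet, Required, Bounded, Basic.toInterval]

/-- A sum of `n` copies of `[1;1]` is `[n;n]`, so for simple graphs the condition on sums of
intervals is one on cardinalities. -/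
theorem sum_toSet_subset {ι : Type} (A : Finset ι) (f : ι → Interval)
    (hf : ∀ e ∈ A, f e = Basic.one.toInterval) (J : Interval) :
    (∑ e ∈ A, f e).toSet ⊆ J.toSet ↔ A.card ∈ J.toSet := by
  classical
  have h : ∀ A : Finset ι, (∀ e ∈ A, f e = Basic.one.toInterval) →
      (∑ e ∈ A, f e).lo = A.card ∧ (∑ e ∈ A, f e).hi = A.card := by
    intro A
    induction A using Finset.induction_on with
    | empty => exact fun _ => ⟨rfl, rfl⟩
    | insert a A ha ih =>
      intro hA
      obtain ⟨h1, h2⟩ := ih fun e he => hA e (Finset.mem_insert_of_mem he)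
      rw [Finset.sum_insert ha, Finset.card_insert_of_notMem ha, hA a (Finset.mem_insert_self _ _)]
      constructor
      · show 1 + (∑ e ∈ A, f e).lo = _
        rw [h1, add_comm]
      · show 1 + (∑ e ∈ A, f e).hi = _
        rw [h2, add_comm]
        push_cast
        rfl
  obtain ⟨h1, h2⟩ := h A hf
  have : (∑ e ∈ A, f e).toSet = {A.card} := by
    ext i
    simp only [toSet, h1, h2, Set.mem_ofPred_eq, Set.mem_singleton_iff, Nat.cast_le]
    omega
  rw [this, Set.singleton_subset_iff]

end Interval

namespace Graph

variable {P : Type}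

open Classical in
theorem isWitness_iff {G H : Graph P} (hG : G.IsSimple) (R : G.N → H.N → Prop) (n : G.N)
    (m : H.N) (w : G.Out n → H.Out m) :
    IsWitness G H R n m w ↔ (∀ e : G.Out n, G.lab e.1 = H.lab (w e).1) ∧
      (∀ e : G.Out n, R (G.target e.1) (H.target (w e).1)) ∧
      ∀ f : H.Out m, (Finset.univ.filter fun e => w e = f).card ∈ (H.occur f.1).toSet := by
  unfold IsWitness
  refine and_congr_right fun _ => and_congr_right fun _ => forall_congr' fun f => ?_
  exact Interval.sum_toSet_subset _ _ (fun e _ => hG.1 e.1) _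

variable (H K : Graph P)

/-- An edge to the node with index `s'`, for the edge `f` of `H`, may be sent to the edge `g` of
`K`, as far as one knows at the index `s`. -/
def Fits (A : H.N → ℕ → K.N → Prop) (f : H.E) (s s' : ℕ) (g : K.E) : Prop :=
  H.lab f = K.lab g ∧ (s' < s → A (H.target f) s' (K.target g))

open Classical in
/-- The number of natural numbers below `n` with a property. -/
noncomputable def count (n : ℕ) (p : ℕ → Prop) : ℕ := ((Finset.range n).filter p).card

open Classical in
/-- Data that refute `L(H) ⊆ L(K)`. They describe a graph whose nodes are pairs of a node of `H` and
an index below `V`: the relation `M` tells its edges, each of which comes from an edge of `H`; the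
relation `A` tells which nodes of `K` may simulate a node; for all others a violation of one of the
conditions of Hall is given by `C`. -/
structure Refutes (V : ℕ) (M : H.E → ℕ → ℕ → Prop) (A : H.N → ℕ → K.N → Prop)
    (C : H.N → ℕ → K.N → K.E → Prop) : Prop where
  occur : ∀ f, ∀ s < V, (((H.occur f).Required → 1 ≤ count V (M f s)) ∧
    ((H.occur f).Bounded → count V (M f s) ≤ 1))
  hall : ∀ h, ∀ s < V, ∀ k, ¬ A h s k →
    ((∀ g, C h s k g → K.source g = k ∧ (K.occur g).Bounded) ∧
      (Finset.univ.filter (C h s k)).card < ∑ f, (count V fun s' =>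
        H.source f = h ∧ M f s s' ∧ ∀ g, K.source g = k → H.Fits K A f s s' g → C h s k g)) ∨
    ((∀ g, C h s k g → K.source g = k ∧ (K.occur g).Required) ∧
      ∑ f, (count V fun s' =>
        H.source f = h ∧ M f s s' ∧ ∃ g, C h s k g ∧ H.Fits K A f s s' g) <
          (Finset.univ.filter (C h s k)).card)
  root : ∃ h, ∃ s < V, ∀ k, ¬ A h s k

end Graph
end ShEx

/-! ### Soundness: the graph described by a refutation is a counterexample. -/

namespace ShEx
namespace Graph

variable {P : Type} {H K : Graph P} {V : ℕ} {M : H.E → ℕ → ℕ → Prop}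
  {A : H.N → ℕ → K.N → Prop} {C : H.N → ℕ → K.N → K.E → Prop}

open Classical in
/-- The graph described by the relation `M`. Nodes come in copies, one for each edge of `H`, to
avoid parallel edges. -/
noncomputable def unfolding (H : Graph P) (V : ℕ) (M : H.E → ℕ → ℕ → Prop) : Graph P where
  N := H.N × Fin V × Option H.E
  E := {x : Option H.E × H.E × Fin V × Fin V // M x.2.1 x.2.2.1 x.2.2.2}
  source x := (H.source x.1.2.1, x.1.2.2.1, x.1.1)
  target x := (H.target x.1.2.1, x.1.2.2.2, some x.1.2.1)
  lab x := H.lab x.1.2.1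
  occur _ := Basic.one.toInterval

theorem unfolding_isSimple : (H.unfolding V M).IsSimple := by
  refine ⟨fun _ => rfl, ?_⟩
  rintro ⟨⟨o, f, s, s'⟩, h⟩ ⟨⟨o₂, f₂, s₂, s₂'⟩, h₂⟩ h1 h2 -
  simp only [unfolding, Prod.mk.injEq, Option.some.injEq] at h1 h2
  obtain ⟨-, rfl, rfl⟩ := h1
  obtain ⟨-, rfl, rfl⟩ := h2
  rfl

/-- The edge of the unfolding for `f` and `s'`. -/
def unfoldingEdge (n : H.N × Fin V × Option H.E) {f : H.E} {s' : ℕ} (hs' : s' < V)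
    (hf : H.source f = n.1) (h : M f n.2.1 s') : (H.unfolding V M).Out n :=
  ⟨⟨(n.2.2, f, n.2.1, ⟨s', hs'⟩), h⟩, by simp only [unfolding, hf]⟩

theorem out_unfolding (n : H.N × Fin V × Option H.E) (e : (H.unfolding V M).Out n) :
    H.source e.1.1.2.1 = n.1 ∧ e.1.1.2.2.1 = n.2.1 ∧ e.1.1.1 = n.2.2 := by
  obtain ⟨e, rfl⟩ := e
  exact ⟨rfl, rfl, rfl⟩

theorem out_unfolding_ext {n : H.N × Fin V × Option H.E} {e e' : (H.unfolding V M).Out n}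
    (h : e.1.1.2.1 = e'.1.1.2.1) (h' : e.1.1.2.2.2 = e'.1.1.2.2.2) : e = e' := by
  obtain ⟨-, h1, h2⟩ := out_unfolding n e
  obtain ⟨-, h1', h2'⟩ := out_unfolding n e'
  exact Subtype.ext (Subtype.ext (Prod.ext (h2.trans h2'.symm) (Prod.ext h
    (Prod.ext (h1.trans h1'.symm) h'))))

/-- Projection to the nodes of `H` is a simulation: each edge goes to the edge of `H` that it comes
from, and `Refutes.occur` controls the multiplicities. -/
theorem unfolding_embeds (hH : H.IsShapeGraph) (h : H.Refutes K V M A C) :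
    (H.unfolding V M).Embeds H := by
  classical
  refine ⟨fun n m => n.1 = m, ?_, fun n => ⟨n.1, rfl⟩⟩
  rintro n _ rfl
  refine ⟨fun e => ⟨e.1.1.2.1, (out_unfolding n e).1⟩,
    (isWitness_iff unfolding_isSimple _ _ _ _).mpr
    ⟨fun e => rfl, fun e => rfl, fun f => ?_⟩⟩
  have hcard : (Finset.univ.filter fun e : (H.unfolding V M).Out n =>
      (⟨e.1.1.2.1, (out_unfolding n e).1⟩ : H.Out n.1) = f).card =
      count V (M f.1 n.2.1) := by
    unfold count
    refine Finset.card_bij (fun e _ => e.1.1.2.2.2) ?_ ?_ ?_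
    · intro e he
      simp only [Finset.mem_filter, Finset.mem_univ, true_and, Finset.mem_range] at he ⊢
      have h1 := e.1.2
      rw [(out_unfolding n e).2.1] at h1
      rw [← he]
      exact ⟨e.1.1.2.2.2.2, h1⟩
    · intro e he e' he' hee
      simp only [Finset.mem_filter, Finset.mem_univ, true_and] at he he'
      exact out_unfolding_ext (congrArg Subtype.val (he.trans he'.symm)) (Fin.ext hee)
    · intro s' hs'
      simp only [Finset.mem_filter, Finset.mem_range] at hs'
      exact ⟨unfoldingEdge n hs'.1 f.2 hs'.2, by simp [unfoldingEdge], rfl⟩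
  refine (Interval.mem_toSet_iff (hH f.1)).mpr ?_
  convert h.occur f.1 n.2.1 n.2.1.2

open Classical in
-- An outgoing edge of a node is determined by its edge `f` of `H` and the index `s'` of its end
-- point, so the sums of counts in `Refutes.hall` are numbers of outgoing edges.
theorem card_out_unfolding (n : H.N × Fin V × Option H.E) (D : H.E → ℕ → Prop) :
    ∑ f, (count V fun s' => H.source f = n.1 ∧ M f n.2.1 s' ∧ D f s') =
      (Finset.univ.filter fun e : (H.unfolding V M).Out n => D e.1.1.2.1 e.1.1.2.2.2).card := by
  simp only [count]
  rw [← Finset.card_sigma]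
  symm
  refine Finset.card_bij (fun e _ => ⟨e.1.1.2.1, e.1.1.2.2.2⟩) ?_ ?_ ?_
  · intro e he
    obtain ⟨h1, h2, -⟩ := out_unfolding n e
    have h3 := e.1.2
    rw [h2] at h3
    simp only [Finset.mem_filter, Finset.mem_univ, true_and] at he
    simp only [Finset.mem_sigma, Finset.mem_univ, true_and, Finset.mem_filter, Finset.mem_range]
    exact ⟨e.1.1.2.2.2.2, h1, h3, he⟩
  · intro e _ e' _ hee
    simp only [Sigma.mk.injEq, heq_eq_eq] at hee
    exact out_unfolding_ext hee.1 (Fin.ext hee.2)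
  · rintro ⟨f, s'⟩ hx
    simp only [Finset.mem_sigma, Finset.mem_univ, true_and, Finset.mem_filter,
      Finset.mem_range] at hx
    exact ⟨unfoldingEdge n hx.1 hx.2.1 hx.2.2.1, by simpa [unfoldingEdge] using hx.2.2.2, rfl⟩

/-- Strong induction on the index shows that `A` contains every simulation in `K`: where `A` fails,
a witness would contradict the recorded violation. As `A` is empty at the root, no simulation has
the root in its domain. -/
theorem unfolding_not_embeds (hK : K.IsShapeGraph) (h : H.Refutes K V M A C) :
    ¬ (H.unfolding V M).Embeds K := by
  classical
  rintro ⟨R, hR, htot⟩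
  have key : ∀ (s : ℕ) (n : H.N × Fin V × Option H.E) k, (n.2.1 : ℕ) = s → R n k → A n.1 s k := by
    intro s
    induction s using Nat.strong_induction_on with
    | _ s ih =>
    rintro n k rfl hk
    by_contra hA
    obtain ⟨w, hw⟩ := hR n k hk
    obtain ⟨hlab, htgt, hocc⟩ := (isWitness_iff unfolding_isSimple _ _ _ _).mp hw
    -- The induction hypothesis speaks of smaller indices only. `Fits` asks for nothing else:
    -- without information, an equal label is enough.
    have hfits : ∀ e : (H.unfolding V M).Out n,
        H.Fits K A e.1.1.2.1 n.2.1 e.1.1.2.2.2 (w e).1 := fun e =>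
      ⟨hlab e, fun hlt => ih _ hlt _ _ rfl (htgt e)⟩
    have hocc' := fun f : K.Out k => (Interval.mem_toSet_iff (hK f.1)).mp (hocc f)
    rcases h.hall n.1 n.2.1 n.2.1.2 k hA with ⟨hC, hlt⟩ | ⟨hC, hlt⟩
    · refine absurd hlt (not_lt.mpr ?_)
      rw [card_out_unfolding (M := M) n fun f s' => ∀ g, K.source g = k → H.Fits K A f n.2.1 s' g →
        C n.1 n.2.1 k g]
      -- The witness sends the edges that fit only into `C` to members of `C`, and injectively,
      -- since these are bounded.
      refine Finset.card_le_card_of_injOn (fun e => (w e).1) (fun e he => ?_) ?_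
      · simp only [Finset.coe_filter, Finset.mem_univ, true_and, Set.mem_ofPred_eq] at he ⊢
        exact he _ (w e).2 (hfits e)
      · intro e he e' _ hee
        simp only [Finset.coe_filter, Finset.mem_univ, true_and, Set.mem_ofPred_eq] at he
        have hb := (hC _ (he _ (w e).2 (hfits e))).2
        refine Finset.card_le_one.mp ((hocc' (w e)).2 hb) e ?_ e' ?_
        · simp
        · simp only [Finset.mem_filter, Finset.mem_univ, true_and]
          exact Subtype.ext hee.symm
    · refine absurd hlt (not_lt.mpr ?_)
      rw [card_out_unfolding (M := M) n fun f s' => ∃ g, C n.1 n.2.1 k g ∧ H.Fits K A f n.2.1 s' g]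
      -- Each member of `C` is required, so the witness hits it, by an edge that fits it.
      refine Finset.card_le_card_of_surjOn (fun e => (w e).1) fun g hg => ?_
      simp only [Finset.coe_filter, Finset.mem_univ, true_and, Set.mem_ofPred_eq] at hg
      obtain ⟨e, he⟩ := Finset.card_pos.mp ((hocc' ⟨g, (hC g hg).1⟩).1 (hC g hg).2)
      simp only [Finset.mem_filter, Finset.mem_univ, true_and] at he
      have he' : (w e).1 = g := congrArg Subtype.val he
      refine ⟨e, ?_, he'⟩
      simp only [Finset.coe_filter, Finset.mem_univ, true_and, Set.mem_ofPred_eq]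
      exact ⟨g, hg, he' ▸ hfits e⟩
  obtain ⟨h₀, s, hs, hroot⟩ := h.root
  obtain ⟨k, hk⟩ := htot (h₀, ⟨s, hs⟩, none)
  exact hroot k (key s _ k rfl hk)

theorem Refutes.not_contained (hH : H.IsShapeGraph) (hK : K.IsShapeGraph)
    (h : H.Refutes K V M A C) : ¬ H.Contained K := fun hc =>
  unfolding_not_embeds hK h (hc ⟨unfolding_isSimple, unfolding_embeds hH h⟩).2

end Graph
end ShEx

/-! ### Tools for completeness: numberings, truncated counting, approximations of simulations. -/

namespace ShEx

/-- Elements of a finite type can be numbered along a given rank. -/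
theorem exists_numbering {T : Type} [Fintype T] (r : T → ℕ) :
    ∃ idx : T → ℕ, Function.Injective idx ∧ (∀ t, idx t < Fintype.card T) ∧
      ∀ a b, r a < r b → idx a < idx b := by
  let ε := Fintype.equivFin T
  let σ := Tuple.sort (r ∘ ε.symm)
  have hσ : Monotone ((r ∘ ε.symm) ∘ σ) := Tuple.monotone_sort _
  refine ⟨fun t => σ.symm (ε t), fun a b h => ?_, fun t => (σ.symm (ε t)).2, fun a b h => ?_⟩
  · exact ε.injective (σ.symm.injective (Fin.ext h))
  · by_contra hle
    have := hσ (show σ.symm (ε b) ≤ σ.symm (ε a) from not_lt.mp hle)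
    simp only [Function.comp, Equiv.apply_symm_apply, Equiv.symm_apply_apply] at this
    omega

open Classical in
/-- If of each kind of elements at most `B` are kept, then the number of elements with a property
that depends on the kind only does not change, or it stays at least `B`. -/
theorem card_truncation {X κ : Type} [Fintype X] [Fintype κ] (kind : X → κ) (B : ℕ)
    (D : κ → Fin B → Prop) (D' : X → Prop) (hD : ∀ x j, D (kind x) j ↔ D' x) :
    (Finset.univ.filter fun y : κ × Fin B =>
      (y.2 : ℕ) < (Finset.univ.filter fun x => kind x = y.1).card ∧ D y.1 y.2).card ≤
        (Finset.univ.filter D').card ∧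
    min B (Finset.univ.filter D').card ≤ (Finset.univ.filter fun y : κ × Fin B =>
      (y.2 : ℕ) < (Finset.univ.filter fun x => kind x = y.1).card ∧ D y.1 y.2).card := by
  let Φ : κ → Finset X := fun c => Finset.univ.filter fun x => kind x = c
  have hΦ : ∀ {c x}, x ∈ Φ c ↔ kind x = c := by simp [Φ]
  -- The position of `x` among the elements of its kind: `x` is determined by its kind and this
  -- number.
  let num : X → ℕ := fun x => (Φ (kind x)).equivFin ⟨x, hΦ.mpr rfl⟩
  have hnum : ∀ {c x} (h : x ∈ Φ c), num x = (Φ c).equivFin ⟨x, h⟩ := by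
    intro c x h
    obtain rfl := hΦ.mp h
    rfl
  have hinj : ∀ x x', kind x = kind x' → num x = num x' → x = x' := by
    intro x x' h h'
    rw [hnum (c := kind x) (hΦ.mpr rfl), hnum (c := kind x) (hΦ.mpr h.symm)] at h'
    exact congrArg Subtype.val ((Φ (kind x)).equivFin.injective (Fin.ext h'))
  have hlt : ∀ x, num x < (Φ (kind x)).card := fun x => ((Φ (kind x)).equivFin ⟨x, _⟩).2
  have hsurj : ∀ c j, j < (Φ c).card → ∃ x, kind x = c ∧ num x = j := by
    intro c j hj
    let x := (Φ c).equivFin.symm ⟨j, hj⟩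
    refine ⟨x, hΦ.mp x.2, ?_⟩
    rw [hnum x.2]
    simp [x]
  let emb : κ × Fin B ↪ κ × ℕ := ⟨Prod.map id Fin.val, Function.injective_id.prodMap
    Fin.val_injective⟩
  constructor
  · rw [← Finset.card_map emb]
    refine Finset.card_le_card_of_surjOn (fun x => (kind x, num x)) fun y hy => ?_
    simp only [Finset.coe_map, Finset.coe_filter, Finset.mem_univ, true_and, Set.mem_image,
      Set.mem_ofPred_eq] at hy
    obtain ⟨⟨c, j⟩, ⟨hj, hDj⟩, rfl⟩ := hy
    obtain ⟨x, rfl, hx⟩ := hsurj c j hj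
    refine ⟨x, ?_, ?_⟩
    · simpa using (hD x j).mp hDj
    · show (kind x, num x) = (kind x, (j : ℕ))
      rw [hx]
  -- If some kind with the property has at least `B` elements, it alone contributes `B`. Otherwise
  -- truncation affects no kind with the property.
  · by_cases hB : ∃ x, D' x ∧ B ≤ (Φ (kind x)).card
    · obtain ⟨x, hx, hB⟩ := hB
      refine (min_le_left _ _).trans ?_
      refine le_of_eq_of_le (Finset.card_fin B).symm ?_
      refine Finset.card_le_card_of_injOn (fun j => (kind x, j)) (fun j _ => ?_) ?_
      · simp only [Finset.coe_filter, Finset.mem_univ, true_and, Set.mem_ofPred_eq]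
        exact ⟨j.2.trans_le hB, (hD x j).mpr hx⟩
      · exact fun j _ j' _ h => (Prod.mk.inj h).2
    · push Not at hB
      refine (min_le_right _ _).trans ?_
      rw [← Finset.card_map emb]
      refine Finset.card_le_card_of_injOn (fun x => (kind x, num x)) (fun x hx => ?_) ?_
      · simp only [Finset.coe_filter, Finset.mem_univ, true_and, Set.mem_ofPred_eq] at hx
        simp only [Finset.coe_map, Finset.coe_filter, Finset.mem_univ, true_and, Set.mem_image,
          Set.mem_ofPred_eq]
        exact ⟨(kind x, ⟨num x, (hlt x).trans (hB x hx)⟩), ⟨hlt x, (hD x _).mpr hx⟩, rfl⟩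
      · exact fun x _ x' _ h => hinj x x' (Prod.mk.inj h).1 (Prod.mk.inj h).2

namespace Graph

variable {P : Type} {G H K : Graph P}

section Approximation

/-- The approximations of the largest simulation. -/
def approx (G K : Graph P) : ℕ → G.N → K.N → Prop
  | 0, _, _ => True
  | i + 1, n, k => ∃ w, IsWitness G K (approx G K i) n k w

theorem IsWitness.mono {R R' : G.N → K.N → Prop} (h : ∀ n k, R n k → R' n k) {n : G.N} {k : K.N}
    {w : G.Out n → K.Out k} (hw : IsWitness G K R n k w) : IsWitness G K R' n k w :=
  ⟨hw.1, fun e => h _ _ (hw.2.1 e), hw.2.2⟩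

theorem approx_succ_le (i : ℕ) : ∀ n k, approx G K (i + 1) n k → approx G K i n k := by
  induction i with
  | zero => exact fun _ _ _ => trivial
  | succ i ih =>
    rintro n k ⟨w, hw⟩
    exact ⟨w, hw.mono ih⟩

theorem approx_antitone : Antitone (approx G K) :=
  antitone_nat_of_succ_le approx_succ_le

/-- There are finitely many relations, so two approximations agree. As they decrease, the earlier
one is contained in its successor and hence is a simulation; were every approximation total, `G`
would embed. -/
theorem exists_approx_empty (h : ¬ G.Embeds K) : ∃ i n, ∀ k, ¬ approx G K i n k := by
  by_contra hne
  push Not at hne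
  obtain ⟨i, j, hij, heq⟩ := Finite.exists_ne_map_eq_of_infinite (approx G K)
  wlog hlt : i < j generalizing i j
  · exact this j i hij.symm heq.symm (lt_of_le_of_ne (not_lt.mp hlt) hij.symm)
  refine h ⟨approx G K i, fun n k hk => ?_, hne i⟩
  exact approx_antitone hlt n k (heq ▸ hk)

end Approximation

/-! ### The compressed graph and its edge counts. -/

section Compression

variable {B : ℕ} (rank : H.N × Set K.N → ℕ) (idx : (H.N × Set K.N) × Fin B → ℕ)
  (num : H.N × Set K.N → H.E → Set K.N → ℕ)

/-- The index `s` belongs to a class of positive rank with first component `h`. -/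
def Proper (h : H.N) (s : ℕ) : Prop := ∃ S j, 0 < rank (h, S) ∧ idx ((h, S), j) = s

/-- The edges of a compressed graph: a node of the class `c` has `num c f S'` edges for `f` to nodes
with second component `S'`, but at most `B`. Other nodes have one edge each for all `f`. -/
def compressedEdge (f : H.E) (s s' : ℕ) : Prop :=
  (∃ S j, 0 < rank (H.source f, S) ∧ idx ((H.source f, S), j) = s ∧
    ∃ S' j', idx ((H.target f, S'), j') = s' ∧ (j' : ℕ) < num (H.source f, S) f S') ∨
  (¬ Proper rank idx (H.source f) s ∧ s' = s)

/-- The nodes that may simulate a node of a compressed graph. -/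
def compressedTypes (h : H.N) (s : ℕ) (k : K.N) : Prop :=
  ∀ S j, 0 < rank (h, S) → idx ((h, S), j) = s → k ∈ S

variable {rank idx num}

theorem compressedEdge_iff (hidx : Function.Injective idx) {f : H.E} {S : Set K.N} {j : Fin B}
    {s' : ℕ} (hr : 0 < rank (H.source f, S)) :
    compressedEdge rank idx num f (idx ((H.source f, S), j)) s' ↔
      ∃ S' j', idx ((H.target f, S'), j') = s' ∧ (j' : ℕ) < num (H.source f, S) f S' := by
  constructor
  · rintro (⟨S₁, j₁, -, h, h'⟩ | ⟨h, -⟩)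
    · obtain ⟨-, rfl⟩ := Prod.mk.inj (Prod.mk.inj (hidx h)).1
      exact h'
    · exact absurd ⟨S, j, hr, rfl⟩ h
  · exact fun h => Or.inl ⟨S, j, hr, rfl, h⟩

open Classical in
-- With `X` the outgoing edges of a representative of the class `c`, its compressed edges are those
-- of `X`, truncated to `B` of each kind, where the kind consists of the edge of `H` and the set of
-- the end point. By `hD`, the property does not depend on the copy of the end point, so
-- `card_truncation` applies.
theorem count_compressedEdge (hidx : Function.Injective idx) {V : ℕ} (hV : ∀ t, idx t < V)
    {c : H.N × Set K.N} {j : Fin B} (hr : 0 < rank c) {X : Type} [Fintype X] (edge : X → H.E)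
    (cls : X → Set K.N) (hsrc : ∀ x, H.source (edge x) = c.1)
    (hnum : ∀ f S', num c f S' = (Finset.univ.filter fun x => (edge x, cls x) = (f, S')).card)
    (D : H.E → ℕ → Prop) (D' : X → Prop)
    (hD : ∀ x j', D (edge x) (idx ((H.target (edge x), cls x), j')) ↔ D' x) :
    (∑ f, count V fun s' => H.source f = c.1 ∧ compressedEdge rank idx num f (idx (c, j)) s' ∧
      D f s') ≤ (Finset.univ.filter D').card ∧
    min B (Finset.univ.filter D').card ≤ ∑ f, count V fun s' => H.source f = c.1 ∧
      compressedEdge rank idx num f (idx (c, j)) s' ∧ D f s' := by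
  obtain ⟨h, S⟩ := c
  have key : (∑ f, count V fun s' => H.source f = h ∧
      compressedEdge rank idx num f (idx ((h, S), j)) s' ∧ D f s') =
      (Finset.univ.filter fun y : (H.E × Set K.N) × Fin B =>
        (y.2 : ℕ) < (Finset.univ.filter fun x => (edge x, cls x) = y.1).card ∧
          D y.1.1 (idx ((H.target y.1.1, y.1.2), y.2))).card := by
    simp only [count]
    rw [← Finset.card_sigma]
    symm
    refine Finset.card_bij (fun y _ => ⟨y.1.1, idx ((H.target y.1.1, y.1.2), y.2)⟩) ?_ ?_ ?_
    · rintro ⟨⟨f, S'⟩, j'⟩ hy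
      simp only [Finset.mem_filter, Finset.mem_univ, true_and] at hy
      obtain ⟨x, hx⟩ := Finset.card_pos.mp (Nat.zero_lt_of_lt hy.1)
      simp only [Finset.mem_filter, Finset.mem_univ, true_and, Prod.mk.injEq] at hx
      have hf : H.source f = h := hx.1 ▸ hsrc x
      subst hf
      simp only [Finset.mem_sigma, Finset.mem_univ, true_and, Finset.mem_filter, Finset.mem_range]
      refine ⟨hV _, (compressedEdge_iff hidx hr).mpr ⟨S', j', rfl, ?_⟩, hy.2⟩
      rw [hnum]
      exact hy.1
    · rintro ⟨⟨f, S'⟩, j'⟩ _ ⟨⟨f₂, S₂'⟩, j₂'⟩ _ hy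
      simp only [Sigma.mk.injEq, heq_eq_eq] at hy
      obtain ⟨rfl, hy⟩ := hy
      obtain ⟨h1, rfl⟩ := Prod.mk.inj (hidx hy)
      obtain ⟨-, rfl⟩ := Prod.mk.inj h1
      rfl
    · rintro ⟨f, s'⟩ hy
      simp only [Finset.mem_sigma, Finset.mem_univ, true_and, Finset.mem_filter,
        Finset.mem_range] at hy
      obtain ⟨-, rfl, he, hd⟩ := hy
      obtain ⟨S', j', rfl, hlt⟩ := (compressedEdge_iff hidx hr).mp he
      rw [hnum] at hlt
      refine ⟨((f, S'), j'), ?_, rfl⟩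
      simp only [Finset.mem_filter, Finset.mem_univ, true_and]
      exact ⟨hlt, hd⟩
  have := card_truncation (fun x => (edge x, cls x)) B
    (fun y j' => D y.1 (idx ((H.target y.1, y.2), j'))) D' hD
  simp only [key]
  convert this

end Compression

/-! ### Classes, their ranks, and violations of the conditions of Hall. -/

section Completeness

/-- The nodes of `K` that simulate `n` according to an approximation. -/
def typeSet (K : Graph P) (i : ℕ) (n : G.N) : Set K.N := {k | approx G K i n k}

/-- Some node with `H`-type `c.1` has the `i`-th approximation `c.2` of its set of `K`-types. -/
def Realized (K : Graph P) (R : G.N → H.N → Prop) (i : ℕ) (c : H.N × Set K.N) : Prop :=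
  ∃ n, R n c.1 ∧ typeSet K i n = c.2

open Classical in
/-- The first approximation where a class is realized. -/
noncomputable def classRank (K : Graph P) (R : G.N → H.N → Prop) (c : H.N × Set K.N) : ℕ :=
  if h : ∃ i, Realized K R i c then Nat.find h else 0

variable {R : G.N → H.N → Prop}

theorem classRank_le {i : ℕ} {c : H.N × Set K.N} (h : Realized K R i c) :
    classRank K R c ≤ i := by
  classical
  unfold classRank
  rw [dif_pos ⟨i, h⟩]
  exact Nat.find_min' _ h

theorem realized_of_le {i : ℕ} {c : H.N × Set K.N} (h : Realized K R i c) :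
    Realized K R (classRank K R c) c := by
  classical
  unfold classRank
  rw [dif_pos ⟨i, h⟩]
  exact Nat.find_spec (⟨i, h⟩ : ∃ i, Realized K R i c)

/-- The default value `0` for classes that never occur is ruled out by positivity. -/
theorem realized_of_classRank_pos {c : H.N × Set K.N} (h : 0 < classRank K R c) :
    Realized K R (classRank K R c) c := by
  by_cases hex : ∃ i, Realized K R i c
  · exact realized_of_le hex.choose_spec
  · simp [classRank, hex] at h

/-- In round `0` nothing has been lost, so a class that occurs then has the full set of nodes of
`K`. -/
theorem mem_of_classRank_eq_zero {i : ℕ} {c : H.N × Set K.N} (h : Realized K R i c)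
    (h0 : classRank K R c = 0) (k : K.N) : k ∈ c.2 := by
  have := realized_of_le h
  rw [h0] at this
  obtain ⟨n, -, hn⟩ := this
  rw [← hn]
  trivial

variable {B : ℕ} {idx : (H.N × Set K.N) × Fin B → ℕ}

/-- At rank `0` the left side is vacuous and `c.2` is everything. At positive rank, injectivity of
`idx` recovers the class from the index. -/
theorem compressedTypes_iff (hidx : Function.Injective idx) {i : ℕ} {c : H.N × Set K.N}
    (h : Realized K R i c) (j : Fin B) (k : K.N) :
    compressedTypes (classRank K R) idx c.1 (idx (c, j)) k ↔ k ∈ c.2 := by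
  constructor
  · intro hk
    rcases Nat.eq_zero_or_pos (classRank K R c) with h0 | h0
    · exact mem_of_classRank_eq_zero h h0 k
    · exact hk c.2 j h0 rfl
  · rintro hk S j' - hj
    have := (Prod.mk.inj (hidx hj)).1
    rw [← this] at hk
    exact hk

open Classical in
-- Contrapositive of `exists_assignment`, where an edge may be assigned to edges of equal label
-- whose end point still simulates its own in round `i`. An assignment that is injective over
-- bounded edges and hits all required ones is a witness for round `i + 1`.
theorem exists_hall_violation (hG : G.IsSimple) (hK : K.IsShapeGraph) {i : ℕ} {n : G.N} {k : K.N}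
    (h : ¬ approx G K (i + 1) n k) : ∃ C : Finset (K.Out k),
      ((∀ g ∈ C, (K.occur g.1).Bounded) ∧ C.card < (Finset.univ.filter fun e : G.Out n =>
        ∀ g : K.Out k, G.lab e.1 = K.lab g.1 ∧ approx G K i (G.target e.1) (K.target g.1) →
          g ∈ C).card) ∨
      ((∀ g ∈ C, (K.occur g.1).Required) ∧ (Finset.univ.filter fun e : G.Out n =>
        ∃ g ∈ C, G.lab e.1 = K.lab g.1 ∧ approx G K i (G.target e.1) (K.target g.1)).card <
          C.card) := by
  by_contra hne
  rw [not_exists] at hne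
  obtain ⟨w, h1, h2, h3⟩ := exists_assignment (X := G.Out n) (F := K.Out k)
    (fun e g => G.lab e.1 = K.lab g.1 ∧ approx G K i (G.target e.1) (K.target g.1))
    (fun g => (K.occur g.1).Bounded) (fun g => (K.occur g.1).Required)
    (fun C hC => Nat.not_lt.mp fun hlt => hne C (Or.inl ⟨hC, by convert hlt⟩))
    (fun C hC => Nat.not_lt.mp fun hlt => hne C (Or.inr ⟨hC, by convert hlt⟩))
  refine h ⟨w, (isWitness_iff hG _ _ _ _).mpr ⟨fun e => (h1 e).1, fun e => (h1 e).2, fun g => ?_⟩⟩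
  refine (Interval.mem_toSet_iff (hK g.1)).mpr ⟨fun hr => ?_, fun hb => ?_⟩
  · obtain ⟨e, he⟩ := h3 g hr
    exact Finset.card_pos.mpr ⟨e, by simp [he]⟩
  · refine Finset.card_le_one.mpr fun e he e' he' => ?_
    simp only [Finset.mem_filter, Finset.mem_univ, true_and] at he he'
    exact h2 e e' (he.trans he'.symm) (he ▸ hb)

end Completeness

end Graph
end ShEx

/-! ### Completeness: refutations of exponential size. -/

namespace ShEx
namespace Graph

variable {P : Type} {H K : Graph P}

open Classical in
-- From a counterexample of unknown size, choose one representative for each class of positive rank,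
-- copy its truncated edges, and let them lead to the classes of its successors one round earlier.
-- Those have smaller rank, so the local reasons for losing nodes of `K` survive.
theorem exists_refutes (hH : H.IsShapeGraph) (hK : K.IsShapeGraph) (hc : ¬ H.Contained K) {V : ℕ}
    (hV : Fintype.card H.N * 2 ^ Fintype.card K.N * (Fintype.card K.E + 1) ≤ V) :
    ∃ M A C, H.Refutes K V M A C := by
  obtain ⟨G, ⟨hG, R, hR, htot⟩, hGK⟩ := Set.not_subset.mp hc
  have hnK : ¬ G.Embeds K := fun h => hGK ⟨hG, h⟩
  -- A violation compares a number of edges with the size of a set of edges of `K`; counting up to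
  -- one more than `|E_K|` decides such comparisons.
  set B := Fintype.card K.E + 1 with hB
  set rank := classRank (H := H) K R with hrank
  obtain ⟨idx, hidx, hidxV, hmono⟩ :=
    exists_numbering fun t : (H.N × Set K.N) × Fin B => rank t.1
  have hidxV : ∀ t, idx t < V := fun t => (hidxV t).trans_le (by
    simpa [Fintype.card_prod, Fintype.card_set] using hV)
  have hrep : ∀ c, 0 < rank c → ∃ (n : G.N) (w : G.Out n → H.Out c.1),
      typeSet K (rank c) n = c.2 ∧ IsWitness G H R n c.1 w := by
    intro c hc
    obtain ⟨n, hn, hS⟩ := realized_of_classRank_pos hc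
    obtain ⟨w, hw⟩ := hR n c.1 hn
    exact ⟨n, w, hS, hw⟩
  choose n w hS hw using hrep
  let edge : ∀ c hc, G.Out (n c hc) → H.E := fun c hc x => (w c hc x).1
  -- Successors are classified one round before the rank of `c`: this is the round that decides what
  -- the representative keeps.
  let cls : ∀ c hc, G.Out (n c hc) → Set K.N := fun c hc x =>
    typeSet K (rank c - 1) (G.target x.1)
  let num : H.N × Set K.N → H.E → Set K.N → ℕ := fun c f S' =>
    if hc : 0 < rank c then
      (Finset.univ.filter fun x => (edge c hc x, cls c hc x) = (f, S')).card
    else 0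
  let M := compressedEdge rank idx num
  let A := compressedTypes rank idx
  have hcount := fun (c : H.N × Set K.N) (hc : 0 < rank c) (j : Fin B) =>
    count_compressedEdge (num := num) hidx hidxV (c := c) (j := j) hc (edge c hc) (cls c hc)
      (fun x => (w c hc x).2) (fun f S' => by simp only [num]; rw [dif_pos hc])
  have hreal : ∀ c hc x, Realized K R (rank c - 1) (H.target (edge c hc x), cls c hc x) :=
    fun c hc x => ⟨G.target x.1, (hw c hc).2.1 x, rfl⟩
  have hfits : ∀ c hc j x j' g, H.Fits K A (edge c hc x) (idx (c, j))
      (idx ((H.target (edge c hc x), cls c hc x), j')) g ↔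
      G.lab x.1 = K.lab g ∧ approx G K (rank c - 1) (G.target x.1) (K.target g) := by
    intro c hc j x j' g
    have hlt := hmono ((H.target (edge c hc x), cls c hc x), j') (c, j)
      ((classRank_le (hreal c hc x)).trans_lt (Nat.sub_lt hc one_pos))
    refine and_congr (by rw [(hw c hc).1 x]) ?_
    refine (imp_iff_right hlt).trans ?_
    exact compressedTypes_iff hidx (hreal c hc x) j' (K.target g)
  have hhall : ∀ h s k, ∃ C : K.E → Prop, ¬ A h s k →
      ((∀ g, C g → K.source g = k ∧ (K.occur g).Bounded) ∧
        (Finset.univ.filter C).card < ∑ f, (count V fun s' =>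
          H.source f = h ∧ M f s s' ∧ ∀ g, K.source g = k → H.Fits K A f s s' g → C g)) ∨
      ((∀ g, C g → K.source g = k ∧ (K.occur g).Required) ∧
        ∑ f, (count V fun s' =>
          H.source f = h ∧ M f s s' ∧ ∃ g, C g ∧ H.Fits K A f s s' g) <
            (Finset.univ.filter C).card) := by
    intro h s k
    by_cases hA : A h s k
    · exact ⟨fun _ => True, fun h => absurd hA h⟩
    have hA' := hA
    simp only [A, compressedTypes] at hA
    push Not at hA
    obtain ⟨S, j, hc, rfl, hk⟩ := hA
    have hk' : ¬ approx G K (rank (h, S) - 1 + 1) (n _ hc) k := by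
      rw [Nat.sub_add_cancel hc]
      intro hk'
      refine hk ?_
      have := hS _ hc
      rw [show S = typeSet K (rank (h, S)) (n _ hc) from this.symm]
      exact hk'
    obtain ⟨C, hC⟩ := exists_hall_violation hG hK hk'
    obtain ⟨C', hC'⟩ : ∃ C' : K.E → Prop, ∀ g, C' g ↔ ∃ hg, (⟨g, hg⟩ : K.Out k) ∈ C :=
      ⟨_, fun _ => Iff.rfl⟩
    have hcard : (Finset.univ.filter C').card = C.card := by
      rw [← Finset.card_map (Function.Embedding.subtype _)]
      congr 1
      ext g
      simp [hC']
    refine ⟨C', fun _ => ?_⟩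
    rcases hC with ⟨hC, hlt⟩ | ⟨hC, hlt⟩
    · refine Or.inl ⟨fun g hg => ⟨((hC' g).mp hg).1, hC _ ((hC' g).mp hg).2⟩, ?_⟩
      have := (hcount (h, S) hc j (fun f s' => ∀ g, K.source g = k →
        H.Fits K A f (idx ((h, S), j)) s' g → C' g) (fun e =>
        ∀ g : K.Out k, G.lab e.1 = K.lab g.1 ∧ approx G K (rank (h, S) - 1) (G.target e.1)
          (K.target g.1) → g ∈ C) (fun x j' => ?_)).2
      · rw [hcard]
        -- The truncated count is at least the minimum of `B` and the original count, and `C` has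
        -- fewer elements than either.
        refine lt_of_lt_of_le (lt_min ?_ ?_) this
        · refine Nat.lt_succ_of_le ((Finset.card_le_univ _).trans ?_)
          exact Fintype.card_subtype_le _
        · refine lt_of_lt_of_eq hlt ?_
          convert rfl
      · simp only [hfits, hC']
        constructor
        · intro hx g hg
          exact (hx g.1 g.2 hg).2
        · intro hx g hgk hg
          exact ⟨hgk, hx ⟨g, hgk⟩ hg⟩
    · refine Or.inr ⟨fun g hg => ⟨((hC' g).mp hg).1, hC _ ((hC' g).mp hg).2⟩, ?_⟩
      have := (hcount (h, S) hc j (fun f s' => ∃ g, C' g ∧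
        H.Fits K A f (idx ((h, S), j)) s' g) (fun e =>
        ∃ g ∈ C, G.lab e.1 = K.lab g.1 ∧ approx G K (rank (h, S) - 1) (G.target e.1)
          (K.target g.1)) (fun x j' => ?_)).1
      · rw [hcard]
        refine lt_of_le_of_lt this ?_
        refine lt_of_eq_of_lt ?_ hlt
        convert rfl
      · simp only [hfits, hC']
        constructor
        · rintro ⟨g, ⟨hg, hgC⟩, hx⟩
          exact ⟨_, hgC, hx⟩
        · rintro ⟨g, hgC, hx⟩
          exact ⟨g.1, ⟨g.2, hgC⟩, hx⟩
  choose C hC using hhall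
  refine ⟨M, A, C, ⟨fun f s hs => ?_, fun h s _ k hk => hC h s k hk, ?_⟩⟩
  · by_cases hp : Proper rank idx (H.source f) s
    · obtain ⟨S, j, hc, rfl⟩ := hp
      -- The number of edges for `f` alone; truncation at `B ≥ 1` affects neither "at least one" nor
      -- "at most one".
      have := hcount (H.source f, S) hc j (fun f' _ => f' = f)
        (fun x => w _ hc x = ⟨f, rfl⟩)
        (fun x j' => (Subtype.ext_iff (a1 := w _ hc x) (a2 := ⟨f, rfl⟩)).symm)
      rw [Finset.sum_eq_single f] at this
      · simp only [true_and, and_true] at this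
        have hocc := (Interval.mem_toSet_iff (hH f)).mp
          (((isWitness_iff hG _ _ _ _).mp (hw _ hc)).2.2 ⟨f, rfl⟩)
        refine ⟨fun hr => le_trans (le_min ?_ ?_) this.2, fun hb => this.1.trans ?_⟩
        · omega
        · exact hocc.1 hr
        · exact hocc.2 hb
      · intro f' _ hf'
        simp [count, hf']
      · simp
    -- Other indices carry no information. They get a single edge for each `f`, back to the same
    -- index, and `1` lies in every basic interval.
    · have hone : count V (M f s) = 1 := by
        rw [count, Finset.card_eq_one]
        refine ⟨s, ?_⟩
        ext s'
        simp only [Finset.mem_filter, Finset.mem_range, Finset.mem_singleton, M, compressedEdge]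
        constructor
        · rintro ⟨-, ⟨S, j, hr, hj, -⟩ | h⟩
          · exact absurd ⟨S, j, hr, hj⟩ hp
          · exact h.2
        · rintro rfl
          exact ⟨hs, Or.inr ⟨hp, rfl⟩⟩
      exact ⟨fun _ => hone.ge, fun _ => hone.le⟩
  -- The root is the class of a node that has lost all nodes of `K`.
  · obtain ⟨i, n₀, hn₀⟩ := exists_approx_empty hnK
    obtain ⟨h₀, hh₀⟩ := htot n₀
    refine ⟨h₀, idx ((h₀, typeSet K i n₀), 0), hidxV _, fun k hk => ?_⟩
    exact hn₀ k ((compressedTypes_iff hidx (c := (h₀, typeSet K i n₀)) ⟨n₀, hh₀, rfl⟩ 0 k).mp hk)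

end Graph
end ShEx

namespace ShEx

/-! ### Functions and predicates that are definable by terms -/

section Definable

variable {A : Type}

/-- The valuation without the variable `0`. -/
def rest (e : ℕ → ℕ) : ℕ → ℕ := fun i => e (i + 1)

namespace Term

/-- Renaming of variables. -/
def rename {Γ : Type} : Term Γ → (ℕ → ℕ) → Term Γ
  | var i, r => var (r i)
  | one, _ => one
  | add a b, r => add (a.rename r) (b.rename r)
  | sub a b, r => sub (a.rename r) (b.rename r)
  | sum a b, r => sum (a.rename r) (b.rename (extend 0 fun i => r i + 1))
  | read k c a, r => read k c (a.rename r)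
  | len k, _ => len k

theorem eval_rename {Γ : Type} (T : Fin 3 → List Γ) (t : Term Γ) : ∀ (r : ℕ → ℕ) (e : ℕ → ℕ),
    eval T (t.rename r) e = eval T t fun i => e (r i) := by
  induction t with
  | var i => exact fun _ _ => rfl
  | one => exact fun _ _ => rfl
  | add a b iha ihb => exact fun r e => by simp only [rename, eval, iha, ihb]
  | sub a b iha ihb => exact fun r e => by simp only [rename, eval, iha, ihb]
  | sum a b iha ihb =>
    intro r e
    simp only [rename, eval, iha, ihb]
    refine Finset.sum_congr rfl fun x _ => congrArg _ ?_
    funext i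
    cases i <;> rfl
  | read k c a iha =>
    intro r e
    simp only [rename, eval]
    rw [iha]
  | len k => exact fun _ _ => rfl

end Term

/-- A function of a word, a list of bits and a valuation is the value of some term. -/
def Def (f : List A × List Bool → (ℕ → ℕ) → ℕ) : Prop :=
  ∃ t : Term (A ⊕ Bool), ∀ x e, t.eval (Term.workTapes x.1 x.2) e = f x e

/-- A predicate on a word, a list of bits and a valuation holds if some term is not `0`. -/
def DefP (p : List A × List Bool → (ℕ → ℕ) → Prop) : Prop :=
  ∃ t : Term (A ⊕ Bool), ∀ x e, t.eval (Term.workTapes x.1 x.2) e ≠ 0 ↔ p x e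

variable {f g : List A × List Bool → (ℕ → ℕ) → ℕ} {p q : List A × List Bool → (ℕ → ℕ) → Prop}

namespace Def

theorem var (i : ℕ) : Def fun (_ : List A × List Bool) e => e i := ⟨.var i, fun _ _ => rfl⟩

theorem const (n : ℕ) : Def fun (_ : List A × List Bool) _ => n :=
  ⟨.const n, fun _ _ => Term.eval_const _ _ _⟩

theorem length : Def fun (x : List A × List Bool) _ => x.1.length :=
  ⟨.len 0, fun x _ => by simp [Term.eval, Term.workTapes]⟩

theorem pow_length : Def fun (x : List A × List Bool) _ => 16 ^ x.1.length :=
  ⟨.len 2, fun x _ => by simp [Term.eval, Term.workTapes]⟩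

theorem add (hf : Def f) (hg : Def g) : Def fun x e => f x e + g x e := by
  obtain ⟨s, hs⟩ := hf
  obtain ⟨t, ht⟩ := hg
  exact ⟨.add s t, fun x e => congrArg₂ _ (hs x e) (ht x e)⟩

theorem sub (hf : Def f) (hg : Def g) : Def fun x e => f x e - g x e := by
  obtain ⟨s, hs⟩ := hf
  obtain ⟨t, ht⟩ := hg
  exact ⟨.sub s t, fun x e => congrArg₂ _ (hs x e) (ht x e)⟩

theorem weaken (hf : Def f) : Def fun x e => f x (rest e) := by
  obtain ⟨t, ht⟩ := hf
  exact ⟨t.rename Nat.succ, fun x e => (Term.eval_rename _ t _ e).trans (ht x _)⟩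

/-- The bound variable is an argument of `u`, and `rest (extend i e)` is `e` by definition. Thus
definability of nested expressions follows their syntax, with de Bruijn indices as leaves. -/
theorem sum {u : List A × List Bool → ℕ → (ℕ → ℕ) → ℕ} (hf : Def f)
    (hu : Def fun x e => u x (e 0) (rest e)) :
    Def fun x e => ∑ i ∈ Finset.range (f x e), u x i e := by
  obtain ⟨s, hs⟩ := hf
  obtain ⟨t, ht⟩ := hu
  refine ⟨.sum s t, fun x e => ?_⟩
  simp only [Term.eval, hs, ht]
  rfl

theorem mul (hf : Def f) (hg : Def g) : Def fun x e => f x e * g x e := by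
  obtain ⟨t, ht⟩ := sum hf (u := fun x _ e => g x e) hg.weaken
  exact ⟨t, fun x e => (ht x e).trans (by simp)⟩

theorem count {u : List A × List Bool → ℕ → (ℕ → ℕ) → Prop} (hf : Def f)
    (hu : DefP fun x e => u x (e 0) (rest e)) :
    Def fun x e => Graph.count (f x e) fun i => u x i e := by
  obtain ⟨s, hs⟩ := hf
  obtain ⟨t, ht⟩ := hu
  -- With truncated subtraction, `1 - (1 - t)` is `1` if `t` is not `0` and `0` otherwise.
  refine ⟨.sum s (.sub .one (.sub .one t)), fun x e => ?_⟩
  classical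
  simp only [Term.eval, hs, Graph.count, Finset.card_filter]
  refine Finset.sum_congr rfl fun i _ => ?_
  have : _ ↔ u x i e := ht x (extend i e)
  split_ifs with h
  · have := this.mpr h
    omega
  · have := not_not.mp (mt this.mp h)
    omega

end Def

namespace DefP

theorem of_iff (hp : DefP p) (h : ∀ x e, p x e ↔ q x e) : DefP q := by
  obtain ⟨t, ht⟩ := hp
  exact ⟨t, fun x e => (ht x e).trans (h x e)⟩

theorem lt (hf : Def f) (hg : Def g) : DefP fun x e => f x e < g x e := by
  obtain ⟨t, ht⟩ := hg.sub hf
  exact ⟨t, fun x e => by rw [ht]; show _ - _ ≠ 0 ↔ _ < _; omega⟩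

theorem not (hp : DefP p) : DefP fun x e => ¬ p x e := by
  obtain ⟨t, ht⟩ := hp
  refine ⟨.sub .one t, fun x e => ?_⟩
  show 1 - _ ≠ 0 ↔ ¬ p x e
  rw [← ht]
  omega

theorem and (hp : DefP p) (hq : DefP q) : DefP fun x e => p x e ∧ q x e := by
  obtain ⟨s, hs⟩ := hp
  obtain ⟨t, ht⟩ := hq
  obtain ⟨u, hu⟩ := Def.mul (f := fun x e => s.eval (Term.workTapes x.1 x.2) e)
    (g := fun x e => t.eval (Term.workTapes x.1 x.2) e) ⟨s, fun _ _ => rfl⟩ ⟨t, fun _ _ => rfl⟩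
  exact ⟨u, fun x e => by rw [hu, mul_ne_zero_iff, hs, ht]⟩

theorem or (hp : DefP p) (hq : DefP q) : DefP fun x e => p x e ∨ q x e :=
  (hp.not.and hq.not).not.of_iff fun _ _ => by tauto

theorem imp (hp : DefP p) (hq : DefP q) : DefP fun x e => p x e → q x e :=
  (hp.not.or hq).of_iff fun _ _ => by tauto

theorem iff (hp : DefP p) (hq : DefP q) : DefP fun x e => (p x e ↔ q x e) :=
  ((hp.imp hq).and (hq.imp hp)).of_iff fun _ _ => by tauto

theorem le (hf : Def f) (hg : Def g) : DefP fun x e => f x e ≤ g x e :=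
  (lt hg hf).not.of_iff fun _ _ => not_lt

theorem eq (hf : Def f) (hg : Def g) : DefP fun x e => f x e = g x e :=
  ((le hf hg).and (le hg hf)).of_iff fun _ _ => le_antisymm_iff.symm

theorem exists_lt {u : List A × List Bool → ℕ → (ℕ → ℕ) → Prop} (hf : Def f)
    (hu : DefP fun x e => u x (e 0) (rest e)) : DefP fun x e => ∃ i < f x e, u x i e := by
  obtain ⟨t, ht⟩ := Def.count hf hu
  refine ⟨t, fun x e => ?_⟩
  classical
  rw [ht]
  simp [Graph.count]

theorem forall_lt {u : List A × List Bool → ℕ → (ℕ → ℕ) → Prop} (hf : Def f)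
    (hu : DefP fun x e => u x (e 0) (rest e)) : DefP fun x e => ∀ i < f x e, u x i e :=
  (exists_lt (u := fun x i e => ¬ u x i e) hf hu.not).not.of_iff fun _ _ => by simp

theorem symbol (hf : Def f) (a : A) : DefP fun x e => x.1[f x e]? = some a := by
  classical
  obtain ⟨t, ht⟩ := hf
  refine ⟨.read 0 (Sum.inl a) t, fun x e => ?_⟩
  simp only [Term.eval, ht]
  simp [Term.workTapes]

theorem bit (hf : Def f) : DefP fun x e => x.2[f x e]? = some true := by
  classical
  obtain ⟨t, ht⟩ := hf
  refine ⟨.read 1 (Sum.inr true) t, fun x e => ?_⟩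
  simp only [Term.eval, ht]
  simp [Term.workTapes]

end DefP

theorem mem_NEXP_of_def [Finite A] {L : Set (List A)}
    {l : List A × List Bool → (ℕ → ℕ) → ℕ} {p : List A × List Bool → (ℕ → ℕ) → Prop} (hl : Def l)
    (hp : DefP p) (hL : ∀ w, w ∈ L ↔ ∃ bits : List Bool,
      bits.length = l (w, []) (fun _ => 0) ∧ p (w, bits) fun _ => 0) : L ∈ NEXP A := by
  obtain ⟨s, hs⟩ := hl
  obtain ⟨t, ht⟩ := hp
  refine Term.mem_NEXP s t fun w => (hL w).trans (exists_congr fun bits => ?_)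
  rw [hs (w, []), ht (w, bits)]

end Definable

end ShEx

namespace ShEx

/-! ### Runs of symbols in a word -/

section Runs

variable {A : Type}

/-- At position `k` there is a symbol with the property `p`. -/
def SymbolAt (w : List A) (k : ℕ) (p : A → Prop) : Prop := ∃ a, w[k]? = some a ∧ p a

open Classical in
/-- The number of consecutive symbols from position `k` on that have the property `p`. -/
noncomputable def run (p : A → Prop) (w : List A) (k : ℕ) : ℕ :=
  ((w.drop k).takeWhile fun a => decide (p a)).length

theorem exists_run (p : A → Prop) (w : List A) (k : ℕ) :
    ∃ X, w.drop k = X ++ w.drop (k + run p w k) ∧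
    X.length = run p w k ∧ ∀ a ∈ X, p a := by
  classical
  refine ⟨(w.drop k).takeWhile fun a => decide (p a), ?_, rfl, fun a ha => ?_⟩
  · have h := List.takeWhile_append_dropWhile (p := fun a => decide (p a)) (l := w.drop k)
    rw [← List.drop_drop]
    conv_lhs => rw [← h]
    congr 1
    conv_rhs => rw [← h]
    exact List.drop_left.symm
  · simpa using List.mem_takeWhile_imp ha

theorem run_eq {p : A → Prop} {w X Y : List A} {k : ℕ} (h : w.drop k = X ++ Y) (hX : ∀ a ∈ X, p a)
    (hY : ∀ a ∈ Y.head?, ¬ p a) : run p w k = X.length := by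
  classical
  rw [run, h, List.takeWhile_append_of_pos (by simpa using hX)]
  cases Y with
  | nil => simp
  | cons y Y => simp [hY y (by simp)]

theorem lt_length_takeWhile_iff (p : A → Bool) (l : List A) (j : ℕ) :
    j < (l.takeWhile p).length ↔ ∀ i < j + 1, SymbolAt l i fun a => p a := by
  induction l generalizing j with
  | nil =>
    simp only [List.takeWhile_nil, List.length_nil, Nat.not_lt_zero, false_iff]
    intro h
    obtain ⟨a, ha, -⟩ := h 0 (by omega)
    simp at ha
  | cons a l ih =>
    rw [Nat.forall_lt_succ_left]
    by_cases h : p a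
    · cases j with
      | zero => simp [h, SymbolAt]
      | succ j => simpa [h, SymbolAt] using ih j
    · simp [h, SymbolAt]

theorem count_lt {m n : ℕ} (h : m ≤ n) : Graph.count n (fun i => i < m) = m := by
  classical
  rw [Graph.count]
  convert Finset.card_range m using 2
  ext i
  simp only [Finset.mem_filter, Finset.mem_range]
  omega

/-- The length of a maximal run is the number of `j` such that the symbols from `k` to `k + j` all
have the property; in this form it is definable. -/
theorem run_eq_count (p : A → Prop) (w : List A) (k : ℕ) :
    run p w k = Graph.count w.length fun j => ∀ i < j + 1, SymbolAt w (k + i) p := by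
  classical
  have h : run p w k ≤ w.length :=
    (List.takeWhile_prefix _).length_le.trans (by simp)
  rw [← count_lt h]
  congr 1
  funext j
  rw [run, lt_length_takeWhile_iff]
  simp [SymbolAt]

/-- The alphabet is finite, so the property is a finite disjunction of tests for single symbols. -/
theorem DefP.symbolAt [Finite A] {f : List A × List Bool → (ℕ → ℕ) → ℕ} (hf : Def f)
    (p : A → Prop) : DefP fun x e => SymbolAt x.1 (f x e) p := by
  classical
  have key : ∀ s : Set A, s.Finite → DefP fun x e => ∃ a ∈ s, x.1[f x e]? = some a := by
    intro s hs
    induction s, hs using Set.Finite.induction_on with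
    | empty => exact (DefP.lt (.const 0) (.const 0)).of_iff fun x e => by simp
    | @insert a _ _ _ ih => exact ((DefP.symbol hf a).or ih).of_iff fun x e => by simp
  exact (key {a | p a} (Set.toFinite _)).of_iff fun x e => by simp [SymbolAt, and_comm]

theorem Def.run [Finite A] {f : List A × List Bool → (ℕ → ℕ) → ℕ} (hf : Def f) (p : A → Prop) :
    Def fun x e => run p x.1 (f x e) := by
  simp only [run_eq_count]
  refine Def.count .length (DefP.forall_lt ((Def.var 0).add (.const 1)) ?_)
  exact .symbolAt (hf.weaken.weaken.add (.var 0)) p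

end Runs

end ShEx

namespace ShEx

/-! ### Words for shape graphs -/

namespace Symbol

/-- The number of symbols is finite. -/
instance : Finite Symbol := by
  have : Finite Basic := Finite.of_surjective
    (fun b : Bool × Bool => match b with
      | (false, false) => Basic.one
      | (false, true) => Basic.opt
      | (true, false) => Basic.plus
      | (true, true) => Basic.star) (by
    rintro (_ | _ | _ | _)
    exacts [⟨(false, false), rfl⟩, ⟨(false, true), rfl⟩, ⟨(true, false), rfl⟩, ⟨(true, true), rfl⟩])
  refine Finite.of_surjective (α := Fin 4 ⊕ Basic ⊕ Bool) (fun x => match x with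
      | .inl 0 => node
      | .inl 1 => arc
      | .inl 2 => tally
      | .inl 3 => sep
      | .inr (.inl M) => occ M
      | .inr (.inr b) => bit b) ?_
  rintro (_ | _ | _ | M | b | _)
  exacts [⟨.inl 0, rfl⟩, ⟨.inl 1, rfl⟩, ⟨.inl 2, rfl⟩, ⟨.inr (.inl M), rfl⟩, ⟨.inr (.inr b), rfl⟩,
    ⟨.inl 3, rfl⟩]

/-- Marks for occurrence intervals. -/
def IsOcc (x : Symbol) : Prop := ∃ M, x = occ M

/-- Symbols of labels. -/
def IsBit (x : Symbol) : Prop := ∃ b, x = bit b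

/-- The symbols with which an edge or a separator starts. -/
def IsStart (x : Symbol) : Prop := x = arc ∨ x = sep

end Symbol

open ShEx.Symbol

/-- The word is empty or starts with an edge or with a separator. -/
def Starts (w : List Symbol) : Prop := ∀ x ∈ w.head?, x.IsStart

theorem starts_encodeEdge {n : ℕ} (es : List (Fin n × List Bool × Basic × Fin n))
    {r : List Symbol} (hr : Starts r) : Starts (es.flatMap encodeEdge ++ r) := by
  cases es with
  | nil => exact hr
  | cons e es => simp [Starts, encodeEdge, IsStart]

theorem sep_notMem_encodeEdge {n : ℕ} (e : Fin n × List Bool × Basic × Fin n) :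
    sep ∉ encodeEdge e := by
  simp [encodeEdge]

theorem sep_notMem_encode (D : ShapeGraph) : sep ∉ D.encode := by
  simp only [ShapeGraph.encode, List.mem_append, List.mem_flatMap, not_or, not_exists, not_and]
  exact ⟨by simp, fun e _ => sep_notMem_encodeEdge e⟩

/-- A word splits into the words for edges if at each mark for an edge there is an edge. -/
theorem exists_edges {n : ℕ} (m : ℕ) : ∀ l : List Symbol, m ≤ l.length → Starts l →
    (∀ i < m, l[i]? ≠ some sep) → (∀ x ∈ (l.drop m).head?, x = sep) →
    (∀ i < m, l[i]? = some arc → ∃ (e : Fin n × List Bool × Basic × Fin n) (r : List Symbol),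
      l.drop i = encodeEdge e ++ r ∧ Starts r) →
    ∃ es : List (Fin n × List Bool × Basic × Fin n), l = es.flatMap encodeEdge ++ l.drop m := by
  induction m using Nat.strong_induction_on with
  | _ m ih =>
    intro l hm hs hsep hend hedge
    obtain rfl | hm0 := Nat.eq_zero_or_pos m
    · exact ⟨[], rfl⟩
    obtain _ | ⟨x, l⟩ := l
    · simp at hm
      omega
    have hx : x = arc := (hs x rfl).resolve_right fun h => hsep 0 hm0 (by simp [h])
    obtain ⟨e, r, hl, hr⟩ := hedge 0 hm0 (by simp [hx])
    rw [List.drop_zero] at hl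
    rw [hl] at hm hsep hend hedge ⊢
    have hc : 0 < (encodeEdge e).length := by simp [encodeEdge]
    -- If the edge reached beyond position `m`, it would contain the separator that stands there.
    have hle : (encodeEdge e).length ≤ m := by
      by_contra h
      push Not at h
      rw [List.head?_drop, List.getElem?_append_left h] at hend
      exact sep_notMem_encodeEdge e
        (hend _ (List.getElem?_eq_getElem h) ▸ List.getElem_mem h)
    obtain ⟨k, rfl⟩ := Nat.exists_eq_add_of_le hle
    have hget : ∀ i, (encodeEdge e ++ r)[(encodeEdge e).length + i]? = r[i]? := fun i => by
      rw [List.getElem?_append_right (by omega), Nat.add_sub_cancel_left]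
    have hdrop : ∀ i, (encodeEdge e ++ r).drop ((encodeEdge e).length + i) = r.drop i := fun i =>
      List.drop_length_add_append _
    obtain ⟨es, hes⟩ := ih k (by omega) r (by simpa using hm) hr
      (fun i hi => hget i ▸ hsep _ (by omega)) (hdrop k ▸ hend)
      (fun i hi => hget i ▸ hdrop i ▸ hedge _ (by omega))
    exact ⟨e :: es, by rw [hdrop, List.flatMap_cons, List.append_assoc, ← hes]⟩

/-- The positions of the edges in a word. -/
theorem exists_positions {n : ℕ} {r : List Symbol} (hr : Starts r) :
    ∀ es : List (Fin n × List Bool × Basic × Fin n), ∃ pos : Fin es.length → ℕ,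
      Function.Injective pos ∧ (∀ i, (i < (es.flatMap encodeEdge).length ∧
        (es.flatMap encodeEdge ++ r)[i]? = some arc) ↔ ∃ j, pos j = i) ∧
      ∀ j, ∃ r', (es.flatMap encodeEdge ++ r).drop (pos j) = encodeEdge (es.get j) ++ r' ∧
        Starts r' := by
  intro es
  induction es with
  | nil => exact ⟨Fin.elim0, fun i => i.elim0, fun i => by simp, fun j => j.elim0⟩
  | cons e es ih =>
    obtain ⟨pos, hinj, harc, hpos⟩ := ih
    have hc : 0 < (encodeEdge e).length := by simp [encodeEdge]
    have hget : ∀ {l : List Symbol} i, (encodeEdge e ++ l)[(encodeEdge e).length + i]? = l[i]? :=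
      fun i => by rw [List.getElem?_append_right (by omega), Nat.add_sub_cancel_left]
    refine ⟨Fin.cons 0 fun j => (encodeEdge e).length + pos j, ?_, fun i => ?_, fun j => ?_⟩
    · refine Fin.cons_injective_iff.mpr ⟨?_, fun j j' h => hinj (Nat.add_left_cancel h)⟩
      rintro ⟨j, hj⟩
      simp only at hj
      omega
    · refine Iff.trans ?_ (Fin.exists_fin_succ (n := es.length)).symm
      simp only [Fin.cons_zero, Fin.cons_succ, List.flatMap_cons, List.append_assoc,
        List.length_append]
      by_cases hi : i < (encodeEdge e).length
      · rw [List.getElem?_append_left hi]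
        have : ∀ j : Fin es.length, (encodeEdge e).length + pos j ≠ i := fun j => by omega
        simp only [this, exists_false, or_false]
        obtain _ | i := i
        · simp [encodeEdge]
        · have hne : (encodeEdge e)[i + 1]? ≠ some arc := by
            intro h
            rw [encodeEdge, List.getElem?_cons_succ] at h
            have := List.mem_of_getElem? h
            simp at this
          simp [hne]
      · obtain ⟨i, rfl⟩ := Nat.exists_eq_add_of_le (not_lt.mp hi)
        rw [hget, Nat.add_lt_add_iff_left, harc]
        have : (0 : ℕ) ≠ (encodeEdge e).length + i := by omega
        simp [this]
    · induction j using Fin.cases with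
      | zero =>
        exact ⟨es.flatMap encodeEdge ++ r, by simp, starts_encodeEdge es hr⟩
      | succ j =>
        obtain ⟨r', h, hr'⟩ := hpos j
        refine ⟨r', ?_, hr'⟩
        simp only [Fin.cons_succ, List.flatMap_cons, List.append_assoc]
        rw [List.drop_length_add_append _]
        exact h

end ShEx

namespace ShEx

open ShEx.Symbol

/-! ### The edge at a position of a word -/

section EdgeAt

variable (w : List Symbol) (i : ℕ)

/-- The origin of the edge at position `i`. -/
noncomputable def srcAt : ℕ := run (· = tally) w (i + 1)

/-- The position of the occurrence interval of the edge at position `i`. -/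
noncomputable def occPos : ℕ := i + 1 + srcAt w i

/-- The position of the label of the edge at position `i`. -/
noncomputable def labPos : ℕ := occPos w i + 1

/-- The length of the label of the edge at position `i`. -/
noncomputable def labLen : ℕ := run IsBit w (labPos w i)

/-- The position of the end point of the edge at position `i`. -/
noncomputable def tgtPos : ℕ := labPos w i + labLen w i

/-- The end point of the edge at position `i`. -/
noncomputable def tgtAt : ℕ := run (· = tally) w (tgtPos w i)

/-- The position after the edge at position `i`. -/
noncomputable def nextPos : ℕ := tgtPos w i + tgtAt w i

/-- The word ends at position `i` or has an edge or a separator there. -/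
def StartsAt : Prop := w.length ≤ i ∨ SymbolAt w i IsStart

variable {w i}

theorem startsAt_iff : StartsAt w i ↔ Starts (w.drop i) := by
  rw [StartsAt, Starts, List.head?_drop]
  by_cases h : i < w.length
  · simp [SymbolAt, h]
  · simp [SymbolAt, not_lt.mp h]

theorem drop_eq_of_drop_eq_append {X Y : List Symbol} (h : w.drop i = X ++ Y) :
    w.drop (i + X.length) = Y := by
  rw [← List.drop_drop, h, List.drop_left]

theorem getElem?_of_drop_eq_cons {x : Symbol} {Y : List Symbol} (h : w.drop i = x :: Y) :
    w[i]? = some x ∧ w.drop (i + 1) = Y :=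
  ⟨by rw [← List.head?_drop, h]; rfl, drop_eq_of_drop_eq_append (X := [x]) h⟩

/-- The edge at a position is read off correctly. -/
theorem fields_of_drop {n : ℕ} {e : Fin n × List Bool × Basic × Fin n} {r : List Symbol}
    (h : w.drop i = encodeEdge e ++ r) (hr : Starts r) : srcAt w i = e.1 ∧
      w[occPos w i]? = some (occ e.2.2.1) ∧ labLen w i = e.2.1.length ∧
      (∀ x < e.2.1.length, w[labPos w i + x]? = e.2.1[x]?.map bit) ∧ tgtAt w i = e.2.2.2 ∧
      w.drop (nextPos w i) = r := by
  rw [encodeEdge, List.cons_append] at h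
  obtain ⟨-, h₁⟩ := getElem?_of_drop_eq_cons h
  rw [List.append_assoc] at h₁
  have hs : srcAt w i = e.1 := (run_eq h₁ (by simp) (by simp)).trans (by simp)
  have h₂ := drop_eq_of_drop_eq_append h₁
  rw [List.length_replicate, ← hs] at h₂
  rw [List.cons_append] at h₂
  obtain ⟨ho, h₃⟩ := getElem?_of_drop_eq_cons h₂
  rw [List.append_assoc] at h₃
  have hstart : ∀ a ∈ r.head?, ¬ a.IsBit ∧ ¬ a = tally := by
    intro a ha
    rcases hr a ha with rfl | rfl <;> simp [IsBit]
  have hl : labLen w i = e.2.1.length := by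
    refine (run_eq h₃ (fun a ha => ?_) ?_).trans (by simp)
    · obtain ⟨b, -, rfl⟩ := List.mem_map.mp ha
      exact ⟨b, rfl⟩
    cases h : (e.2.2.2 : ℕ) with
    | zero => simpa [h] using fun a ha => (hstart a ha).1
    | succ k => simp [List.replicate_succ, IsBit]
  have h₄ := drop_eq_of_drop_eq_append h₃
  rw [List.length_map, ← hl] at h₄
  have ht : tgtAt w i = e.2.2.2 :=
    (run_eq h₄ (by simp) fun a ha => (hstart a ha).2).trans (by simp)
  have h₅ := drop_eq_of_drop_eq_append h₄
  rw [List.length_replicate, ← ht] at h₅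
  refine ⟨hs, ho, hl, fun x hx => ?_, ht, h₅⟩
  rw [← List.getElem?_map, ← List.getElem?_drop]
  change (w.drop (occPos w i + 1))[x]? = _
  rw [show occPos w i = i + 1 + srcAt w i from rfl, h₃, List.getElem?_append_left (by simpa)]

/-- There is an edge at position `i`, with origin and end point below `n`. -/
structure EdgeAt (w : List Symbol) (n i : ℕ) : Prop where
  occ : SymbolAt w (occPos w i) IsOcc
  src : srcAt w i < n
  tgt : tgtAt w i < n
  next : StartsAt w (nextPos w i)

/-- The fields are read as maximal runs of symbols. Since the next symbol starts an edge or is a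
separator, or the word ends, the runs are exactly the fields of an encoded edge. The left side is
definable by terms. -/
theorem edgeAt_iff {n : ℕ} (hi : w[i]? = some arc) : EdgeAt w n i ↔
    ∃ (e : Fin n × List Bool × Basic × Fin n) (r : List Symbol),
      w.drop i = encodeEdge e ++ r ∧ Starts r := by
  constructor
  · rintro ⟨⟨_, ho, M, rfl⟩, hs, ht, hn⟩
    obtain ⟨X, hX, hXl, hXp⟩ := exists_run (· = tally) w (i + 1)
    obtain ⟨Y, hY, hYl, hYp⟩ := exists_run IsBit w (labPos w i)
    obtain ⟨Z, hZ, hZl, hZp⟩ := exists_run (· = tally) w (tgtPos w i)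
    have hX' : X = List.replicate (srcAt w i) tally := List.eq_replicate_iff.mpr ⟨hXl, hXp⟩
    have hZ' : Z = List.replicate (tgtAt w i) tally := List.eq_replicate_iff.mpr ⟨hZl, hZp⟩
    obtain ⟨l, rfl⟩ : ∃ l : List Bool, Y = l.map bit := by
      clear hY hYl
      induction Y with
      | nil => exact ⟨[], rfl⟩
      | cons y Y ih =>
        obtain ⟨l, rfl⟩ := ih fun a ha => hYp a (List.mem_cons_of_mem _ ha)
        obtain ⟨b, rfl⟩ := hYp y List.mem_cons_self
        exact ⟨b :: l, rfl⟩
    have hcons : ∀ {k x}, w[k]? = some x → w.drop k = x :: w.drop (k + 1) := by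
      intro k x h
      obtain ⟨hk, rfl⟩ := List.getElem?_eq_some_iff.mp h
      exact List.drop_eq_getElem_cons hk
    refine ⟨(⟨_, hs⟩, l, M, ⟨_, ht⟩), w.drop (nextPos w i), ?_, startsAt_iff.mp hn⟩
    rw [hcons hi, hX, hX']
    change _ :: (_ ++ w.drop (occPos w i)) = _
    rw [hcons ho]
    change _ :: (_ ++ _ :: w.drop (labPos w i)) = _
    rw [hY]
    change _ :: (_ ++ _ :: (_ ++ w.drop (tgtPos w i))) = _
    rw [hZ, hZ']
    simp [encodeEdge]
    rfl
  · rintro ⟨e, r, h, hr⟩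
    obtain ⟨hs, ho, -, -, ht, hn⟩ := fields_of_drop h hr
    exact ⟨⟨_, ho, _, rfl⟩, hs ▸ e.1.2, ht ▸ e.2.2.2.2, startsAt_iff.mpr (hn ▸ hr)⟩

end EdgeAt

/-! ### Words for pairs of shape graphs -/

section WellFormed

variable (w : List Symbol)

/-- The position of the separator. -/
noncomputable def sepPos : ℕ := run (· ≠ sep) w 0

/-- The number of nodes of the first graph. -/
noncomputable def nodesFst : ℕ := run (· = node) w 0

/-- The number of nodes of the second graph. -/
noncomputable def nodesSnd : ℕ := run (· = node) w (sepPos w + 1)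

/-- The word encodes a pair of shape graphs. -/
structure WellFormed : Prop where
  sep : w[sepPos w]? = some sep
  unique : ∀ i < w.length, sepPos w < i → w[i]? ≠ some Symbol.sep
  fst : StartsAt w (nodesFst w)
  snd : StartsAt w (sepPos w + 1 + nodesSnd w)
  edge : ∀ i < w.length, w[i]? = some arc → (i < sepPos w → EdgeAt w (nodesFst w) i) ∧
    (sepPos w < i → EdgeAt w (nodesSnd w) i)

variable {w}

theorem encode_pair {H K : ShapeGraph} (hw : w = H.encode ++ sep :: K.encode) :
    sepPos w = H.encode.length ∧ nodesFst w = H.nodes ∧ nodesSnd w = K.nodes ∧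
    w.drop (nodesFst w) = H.edges.flatMap encodeEdge ++ sep :: K.encode ∧
    w.drop (sepPos w + 1 + nodesSnd w) = K.edges.flatMap encodeEdge := by
  have hq : sepPos w = H.encode.length := by
    refine run_eq (X := H.encode) (Y := sep :: K.encode) (by simp [hw]) ?_ (by simp)
    rintro _ h rfl
    exact sep_notMem_encode H h
  have hnode : ∀ {n : ℕ} (es : List (Fin n × List Bool × Basic × Fin n)) (r : List Symbol),
      Starts r → ∀ a ∈ (es.flatMap encodeEdge ++ r).head?, ¬ a = node := by
    intro n es r hr a ha
    rcases starts_encodeEdge es hr a ha with rfl | rfl <;> simp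
  have h₁ : w.drop 0 = List.replicate H.nodes node ++
      (H.edges.flatMap encodeEdge ++ sep :: K.encode) := by
    simp [hw, ShapeGraph.encode]
  have hH : nodesFst w = H.nodes := by
    refine (run_eq h₁ (by simp) (hnode _ _ ?_)).trans (by simp)
    simp [Starts, IsStart]
  have h₂ : w.drop (sepPos w + 1) = List.replicate K.nodes node ++
      (K.edges.flatMap encodeEdge ++ []) := by
    rw [hq, hw, ← List.drop_drop, List.drop_left]
    simp [ShapeGraph.encode]
  have hK : nodesSnd w = K.nodes := by
    refine (run_eq h₂ (by simp) (hnode _ _ ?_)).trans (by simp)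
    simp [Starts]
  refine ⟨hq, hH, hK, ?_, ?_⟩
  · have := drop_eq_of_drop_eq_append h₁
    rw [zero_add, List.length_replicate] at this
    rwa [hH]
  · have := drop_eq_of_drop_eq_append h₂
    rw [List.append_nil, List.length_replicate] at this
    rwa [hK]

theorem getElem?_ne_arc {D : ShapeGraph} {i : ℕ} {l r : List Symbol} (hl : l.drop i = D.encode ++ r)
    {j : ℕ} (hij : i ≤ j) (hj : j < i + D.nodes) : l[j]? ≠ some arc := by
  obtain ⟨j, rfl⟩ := Nat.exists_eq_add_of_le hij
  rw [← List.getElem?_drop, hl, ShapeGraph.encode, List.append_assoc,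
    List.getElem?_append_left (by simp; omega)]
  intro h
  simpa using List.mem_of_getElem? h

theorem exists_positions_of_drop {D : ShapeGraph} {k : ℕ} {r : List Symbol} (hr : Starts r)
    (hw : w.drop k = D.encode ++ r) : ∃ pos : Fin D.edges.length → ℕ, Function.Injective pos ∧
      (∀ i, (k ≤ i ∧ i < k + D.encode.length ∧ w[i]? = some arc) ↔ ∃ j, pos j = i) ∧
      ∀ j, ∃ r', w.drop (pos j) = encodeEdge (D.edges.get j) ++ r' ∧ Starts r' := by
  obtain ⟨pos, hinj, harc, hpos⟩ := exists_positions hr D.edges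
  have hk : w.drop (k + D.nodes) = D.edges.flatMap encodeEdge ++ r := by
    have := drop_eq_of_drop_eq_append (X := List.replicate D.nodes node) (w := w) (i := k)
      (by rw [hw, ShapeGraph.encode, List.append_assoc])
    rwa [List.length_replicate] at this
  refine ⟨fun j => k + D.nodes + pos j, fun j j' h => hinj (Nat.add_left_cancel h), fun i => ?_,
    fun j => ?_⟩
  · constructor
    · rintro ⟨h₁, h₂, h₃⟩
      have hle : k + D.nodes ≤ i := by
        by_contra h
        exact getElem?_ne_arc hw h₁ (not_le.mp h) h₃
      obtain ⟨i, rfl⟩ := Nat.exists_eq_add_of_le hle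
      rw [← List.getElem?_drop, hk] at h₃
      simp only [ShapeGraph.encode, List.length_append, List.length_replicate] at h₂
      obtain ⟨j, rfl⟩ := (harc i).mp ⟨by omega, h₃⟩
      exact ⟨j, rfl⟩
    · rintro ⟨j, rfl⟩
      obtain ⟨h₁, h₂⟩ := (harc _).mpr ⟨j, rfl⟩
      refine ⟨by simp only; omega, ?_, ?_⟩
      · simp only [ShapeGraph.encode, List.length_append, List.length_replicate]
        omega
      · rw [← List.getElem?_drop, hk, h₂]
  · rw [← List.drop_drop, hk]
    exact hpos j

/-- Local conditions suffice for parsing: after the node marks an edge must start, and each edge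
ends where the next one starts, or at the separator, or at the end of the word. -/
theorem wellFormed_iff : WellFormed w ↔ ∃ H K : ShapeGraph, w = H.encode ++ sep :: K.encode := by
  constructor
  · rintro ⟨hsep, huniq, hfst, hsnd, hedge⟩
    obtain ⟨X, hX, hXl, hXp⟩ := exists_run (· = node) w 0
    obtain ⟨Y, hY, hYl, hYp⟩ := exists_run (· = node) w (sepPos w + 1)
    obtain ⟨Z, hZ, hZl, hZp⟩ := exists_run (· ≠ Symbol.sep) w 0
    rw [zero_add] at hX hZ
    change _ = _ ++ w.drop (nodesFst w) at hX
    change _ = _ ++ w.drop (sepPos w) at hZ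
    change _ = _ ++ w.drop (sepPos w + 1 + nodesSnd w) at hY
    change _ = nodesFst w at hXl
    change _ = sepPos w at hZl
    change _ = nodesSnd w at hYl
    rw [List.drop_zero] at hX hZ
    have hq : sepPos w < w.length := (List.getElem?_eq_some_iff.mp hsep).1
    have hlt : ∀ i < sepPos w, w[i]? ≠ some Symbol.sep := by
      intro i hi h
      rw [hZ, List.getElem?_append_left (by omega)] at h
      exact hZp _ (List.mem_of_getElem? h) rfl
    -- The initial run of node marks cannot contain the separator.
    have hnq : nodesFst w ≤ sepPos w := by
      by_contra h
      have hX' : w[sepPos w]? = X[sepPos w]? := by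
        have := congrArg (fun l : List Symbol => l[sepPos w]?) hX
        rwa [List.getElem?_append_left (by omega)] at this
      exact Symbol.noConfusion (hXp _ (List.mem_of_getElem? (hX'.symm.trans hsep)))
    have hYlen : sepPos w + 1 + nodesSnd w ≤ w.length := by
      have := congrArg List.length hY
      rw [List.length_append, List.length_drop, hYl] at this
      omega
    obtain ⟨es, hes⟩ := exists_edges (n := nodesFst w) (sepPos w - nodesFst w)
      (w.drop (nodesFst w)) (by simp; omega) (startsAt_iff.mp hfst)
      (fun i hi => by rw [List.getElem?_drop]; exact hlt _ (by omega))
      (by rw [List.drop_drop, Nat.add_sub_cancel' hnq, List.head?_drop, hsep]; simp)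
      (fun i hi h => by
        rw [List.getElem?_drop] at h
        rw [List.drop_drop, ← edgeAt_iff h]
        exact (hedge _ (by omega) h).1 (by omega))
    obtain ⟨es', hes'⟩ := exists_edges (n := nodesSnd w) (w.length - (sepPos w + 1 + nodesSnd w))
      (w.drop (sepPos w + 1 + nodesSnd w)) (by simp) (startsAt_iff.mp hsnd)
      (fun i hi => by rw [List.getElem?_drop]; exact huniq _ (by omega) (by omega))
      (by rw [List.drop_drop, Nat.add_sub_cancel' hYlen]; simp)
      (fun i hi h => by
        rw [List.getElem?_drop] at h
        rw [List.drop_drop, ← edgeAt_iff h]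
        exact (hedge _ (by omega) h).2 (by omega))
    rw [List.drop_drop, Nat.add_sub_cancel' hnq] at hes
    rw [List.drop_drop, Nat.add_sub_cancel' hYlen, List.drop_length, List.append_nil] at hes'
    refine ⟨⟨_, es⟩, ⟨_, es'⟩, ?_⟩
    conv_lhs => rw [hX]
    rw [hes, List.drop_eq_getElem_cons hq, (List.getElem?_eq_some_iff.mp hsep).2, hY, hes',
      List.eq_replicate_iff.mpr ⟨hXl, hXp⟩, List.eq_replicate_iff.mpr ⟨hYl, hYp⟩]
    simp [ShapeGraph.encode]
  · rintro ⟨H, K, hw⟩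
    obtain ⟨hq, hH, hK, hdH, hdK⟩ := encode_pair hw
    have hr : Starts (sep :: K.encode) := by simp [Starts, IsStart]
    have hr' : Starts [] := by simp [Starts]
    have h₂ : w.drop (sepPos w + 1) = K.encode ++ [] := by
      rw [hq, hw, ← List.drop_drop, List.drop_left]
      simp
    refine ⟨by rw [hq, hw]; simp, fun i hi h => ?_, ?_, ?_,
      fun i hi h => ⟨fun hlt => ?_, fun hlt => ?_⟩⟩
    · obtain ⟨i, rfl⟩ := Nat.exists_eq_add_of_lt h
      rw [Nat.add_right_comm, ← List.getElem?_drop, h₂, List.append_nil]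
      exact fun h => sep_notMem_encode K (List.mem_of_getElem? h)
    · exact startsAt_iff.mpr (hdH ▸ starts_encodeEdge _ hr)
    · rw [startsAt_iff, hdK, ← List.append_nil (List.flatMap _ _)]
      exact starts_encodeEdge _ hr'
    · rw [edgeAt_iff h, hH]
      obtain ⟨pos, -, harc, hpos⟩ := exists_positions_of_drop (k := 0) hr hw
      obtain ⟨j, rfl⟩ := (harc i).mp ⟨by omega, by omega, h⟩
      exact ⟨_, hpos j⟩
    · rw [edgeAt_iff h, hK]
      obtain ⟨pos, -, harc, hpos⟩ := exists_positions_of_drop hr' h₂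
      have : w.length = sepPos w + 1 + K.encode.length := by rw [hq, hw]; simp; omega
      obtain ⟨j, rfl⟩ := (harc i).mp ⟨by omega, by omega, h⟩
      exact ⟨_, hpos j⟩

end WellFormed

end ShEx

/-! ### Passage from nodes and edges of graphs to numbers and positions. -/

namespace ShEx

namespace Graph

theorem count_congr {n : ℕ} {p q : ℕ → Prop} (h : ∀ i < n, (p i ↔ q i)) :
    count n p = count n q := by
  classical
  unfold count
  congr 1
  exact Finset.filter_congr fun i hi => h i (Finset.mem_range.mp hi)

/-- Only indices below `V` are ever consulted; finite arrays can represent the data only there. -/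
theorem Refutes.congr {P : Type} {H K : Graph P} {V : ℕ} {M M' : H.E → ℕ → ℕ → Prop}
    {A A' : H.N → ℕ → K.N → Prop} {C C' : H.N → ℕ → K.N → K.E → Prop}
    (hR : H.Refutes K V M A C) (hM : ∀ f, ∀ s < V, ∀ s' < V, (M f s s' ↔ M' f s s'))
    (hA : ∀ h, ∀ s < V, ∀ k, (A h s k ↔ A' h s k))
    (hC : ∀ h, ∀ s < V, ∀ k g, (C h s k g ↔ C' h s k g)) : H.Refutes K V M' A' C' := by
  have hfits : ∀ f, ∀ s < V, ∀ s' g, (H.Fits K A f s s' g ↔ H.Fits K A' f s s' g) :=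
    fun f s hs s' g => and_congr_right fun _ => forall_congr' fun h => hA _ _ (h.trans hs) _
  refine ⟨fun f s hs => ?_, fun h s hs k hk => ?_, ?_⟩
  · rw [← count_congr (hM f s hs)]
    exact hR.occur f s hs
  · have hC' : C' h s k = C h s k := funext fun g => propext (hC h s hs k g).symm
    have := hR.hall h s hs k (mt (hA h s hs k).mp hk)
    rw [hC']
    have h₁ := fun f => count_congr (n := V)
      (p := fun s' => H.source f = h ∧ M f s s' ∧ ∀ g, K.source g = k → H.Fits K A f s s' g →
        C h s k g)
      (q := fun s' => H.source f = h ∧ M' f s s' ∧ ∀ g, K.source g = k → H.Fits K A' f s s' g →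
        C h s k g) fun s' hs' => by simp only [hM f s hs s' hs', hfits f s hs]
    have h₂ := fun f => count_congr (n := V)
      (p := fun s' => H.source f = h ∧ M f s s' ∧ ∃ g, C h s k g ∧ H.Fits K A f s s' g)
      (q := fun s' => H.source f = h ∧ M' f s s' ∧ ∃ g, C h s k g ∧ H.Fits K A' f s s' g)
      fun s' hs' => by simp only [hM f s hs s' hs', hfits f s hs]
    simp only [h₁, h₂] at this
    exact this
  · obtain ⟨h, s, hs, hr⟩ := hR.root
    exact ⟨h, s, hs, fun k => mt (hA h s hs k).mpr (hr k)⟩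

end Graph

section Reindex

variable {E : Type} {L : ℕ} {pos : E → ℕ} {p : ℕ → Prop}

theorem sum_range_count [Fintype E] (hinj : Function.Injective pos) (hp : ∀ i, p i ↔ ∃ j, pos j = i)
    (hL : ∀ i, p i → i < L) (V : ℕ) (u : ℕ → ℕ → Prop) :
    ∑ i ∈ Finset.range L, Graph.count V (fun s => p i ∧ u i s) =
      ∑ j, Graph.count V (u (pos j)) := by
  classical
  have h : ∀ i, Graph.count V (fun s => p i ∧ u i s) = if p i then Graph.count V (u i) else 0 := by
    intro i
    by_cases hi : p i <;> simp [hi, Graph.count]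
  simp only [h]
  rw [← Finset.sum_filter, ← Finset.sum_image (f := fun i => Graph.count V (u i)) hinj.injOn]
  refine Finset.sum_congr ?_ fun _ _ => rfl
  ext i
  simp only [Finset.mem_filter, Finset.mem_range, Finset.mem_image, Finset.mem_univ, true_and]
  rw [← hp]
  exact ⟨fun h => h.2, fun h => ⟨hL i h, h⟩⟩

open Classical in
theorem count_and_eq_card [Fintype E] (hinj : Function.Injective pos)
    (hp : ∀ i, p i ↔ ∃ j, pos j = i)
    (hL : ∀ i, p i → i < L) (u : ℕ → Prop) :
    Graph.count L (fun i => p i ∧ u i) = (Finset.univ.filter fun j => u (pos j)).card := by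
  rw [Graph.count, ← Finset.card_image_of_injective _ hinj]
  congr 1
  ext i
  simp only [Finset.mem_filter, Finset.mem_range, Finset.mem_image, Finset.mem_univ, true_and]
  rw [hp]
  constructor
  · rintro ⟨-, ⟨j, rfl⟩, h⟩
    exact ⟨j, h, rfl⟩
  · rintro ⟨j, h, rfl⟩
    exact ⟨hL _ ((hp _).mpr ⟨j, rfl⟩), ⟨j, rfl⟩, h⟩

theorem forall_lt_iff (hp : ∀ i, p i ↔ ∃ j, pos j = i) (hL : ∀ i, p i → i < L) {u : ℕ → Prop} :
    (∀ i < L, p i → u i) ↔ ∀ j, u (pos j) := by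
  constructor
  · intro h j
    have := (hp (pos j)).mpr ⟨j, rfl⟩
    exact h _ (hL _ this) this
  · rintro h i - hi
    obtain ⟨j, rfl⟩ := (hp i).mp hi
    exact h j

theorem exists_lt_iff (hp : ∀ i, p i ↔ ∃ j, pos j = i) (hL : ∀ i, p i → i < L) {u : ℕ → Prop} :
    (∃ i < L, p i ∧ u i) ↔ ∃ j, u (pos j) := by
  constructor
  · rintro ⟨i, -, hi, h⟩
    obtain ⟨j, rfl⟩ := (hp i).mp hi
    exact ⟨j, h⟩
  · rintro ⟨j, h⟩
    have := (hp (pos j)).mpr ⟨j, rfl⟩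
    exact ⟨_, hL _ this, this, h⟩

end Reindex

open ShEx.Symbol

/-! ### Refutations as properties of words -/

section Words

variable (w : List Symbol)

/-- At position `i` there is an edge of the first graph. -/
def FstArc (i : ℕ) : Prop := i < sepPos w ∧ w[i]? = some arc

/-- At position `i` there is an edge of the second graph. -/
def SndArc (i : ℕ) : Prop := sepPos w < i ∧ w[i]? = some arc

/-- The edge at position `i` is required. -/
def RequiredAt (i : ℕ) : Prop :=
  w[occPos w i]? = some (occ .one) ∨ w[occPos w i]? = some (occ .plus)

/-- The edge at position `i` is bounded. -/
def BoundedAt (i : ℕ) : Prop :=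
  w[occPos w i]? = some (occ .one) ∨ w[occPos w i]? = some (occ .opt)

/-- The edges at positions `i` and `j` have the same label. -/
def SameLabel (i j : ℕ) : Prop := labLen w i = labLen w j ∧ ∀ x < labLen w i,
  (w[labPos w i + x]? = some (bit true) ↔ w[labPos w j + x]? = some (bit true))

/-- The counterpart of `Graph.Fits`. -/
def FitsAt (A : ℕ → ℕ → ℕ → Prop) (f s s' g : ℕ) : Prop :=
  SameLabel w f g ∧ (s' < s → A (tgtAt w f) s' (tgtAt w g))

/-- The counterpart of `Graph.Refutes`. -/
structure RefutesAt (V : ℕ) (M A : ℕ → ℕ → ℕ → Prop) (C : ℕ → ℕ → ℕ → ℕ → Prop) : Prop where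
  occur : ∀ f < w.length, FstArc w f → ∀ s < V,
    ((RequiredAt w f → 1 ≤ Graph.count V (M f s)) ∧ (BoundedAt w f → Graph.count V (M f s) ≤ 1))
  hall : ∀ h < nodesFst w, ∀ s < V, ∀ k < nodesSnd w, ¬ A h s k →
    ((∀ g < w.length, SndArc w g → C h s k g → srcAt w g = k ∧ BoundedAt w g) ∧
      Graph.count w.length (fun g => SndArc w g ∧ C h s k g) <
        ∑ f ∈ Finset.range w.length, Graph.count V fun s' => FstArc w f ∧ srcAt w f = h ∧ M f s s' ∧
          ∀ g < w.length, SndArc w g → srcAt w g = k → FitsAt w A f s s' g → C h s k g) ∨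
    ((∀ g < w.length, SndArc w g → C h s k g → srcAt w g = k ∧ RequiredAt w g) ∧
      (∑ f ∈ Finset.range w.length, Graph.count V fun s' => FstArc w f ∧ srcAt w f = h ∧ M f s s' ∧
          ∃ g < w.length, SndArc w g ∧ C h s k g ∧ FitsAt w A f s s' g) <
        Graph.count w.length fun g => SndArc w g ∧ C h s k g)
  root : ∃ h < nodesFst w, ∃ s < V, ∀ k < nodesSnd w, ¬ A h s k

variable {w}

/-- The nodes of `G` are the numbers below `n`, and its edges are those at the positions with the
property `p`. -/
structure Describes (w : List Symbol) (n : ℕ) (p : ℕ → Prop) (G : Graph (List Bool))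
    (num : G.N → ℕ) (pos : G.E → ℕ) : Prop where
  num_injective : Function.Injective num
  num_range : ∀ i, i < n ↔ ∃ v, num v = i
  injective : Function.Injective pos
  range : ∀ i, p i ↔ ∃ e, pos e = i
  src : ∀ e, srcAt w (pos e) = num (G.source e)
  tgt : ∀ e, tgtAt w (pos e) = num (G.target e)
  required : ∀ e, RequiredAt w (pos e) ↔ (G.occur e).Required
  bounded : ∀ e, BoundedAt w (pos e) ↔ (G.occur e).Bounded
  labLen : ∀ e, labLen w (pos e) = (G.lab e).length
  lab : ∀ e, ∀ x < (G.lab e).length, w[labPos w (pos e) + x]? = (G.lab e)[x]?.map bit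

namespace Describes

variable {H K : Graph (List Bool)} {p q : ℕ → Prop} {n m : ℕ} {num : H.N → ℕ} {num' : K.N → ℕ}
  {pos : H.E → ℕ} {pos' : K.E → ℕ}

/-- Within labels all symbols are bits, so labels of equal length agree if `bit true` occurs at the
same places. -/
theorem sameLabel (h : Describes w n p H num pos) (h' : Describes w m q K num' pos') (i : H.E)
    (j : K.E) : SameLabel w (pos i) (pos' j) ↔ H.lab i = K.lab j := by
  rw [SameLabel, h.labLen, h'.labLen]
  constructor
  · rintro ⟨hlen, hb⟩
    refine List.ext_getElem hlen fun x h₁ h₂ => ?_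
    have := hb x h₁
    rw [h.lab i x h₁, h'.lab j x h₂, List.getElem?_eq_getElem h₁, List.getElem?_eq_getElem h₂]
      at this
    simp only [Option.map_some, Option.some.injEq, bit.injEq] at this
    exact Bool.eq_iff_iff.mpr this
  · intro he
    refine ⟨congrArg _ he, fun x hlt => ?_⟩
    rw [h.lab i x hlt, h'.lab j x (he ▸ hlt), he]

/-- The bijections in `Describes` turn quantifiers, counts and sums over numbers and positions into
those over nodes and edges. -/
theorem refutesAt_iff (h₁ : Describes w (nodesFst w) (FstArc w) H num pos)
    (h₂ : Describes w (nodesSnd w) (SndArc w) K num' pos') (V : ℕ) (M A : ℕ → ℕ → ℕ → Prop)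
    (C : ℕ → ℕ → ℕ → ℕ → Prop) : RefutesAt w V M A C ↔
      H.Refutes K V (fun f => M (pos f)) (fun h s k => A (num h) s (num' k))
        (fun h s k g => C (num h) s (num' k) (pos' g)) := by
  have hL : ∀ i, FstArc w i → i < w.length := fun i h => (List.getElem?_eq_some_iff.mp h.2).1
  have hL' : ∀ i, SndArc w i → i < w.length := fun i h => (List.getElem?_eq_some_iff.mp h.2).1
  have hfits : ∀ f s s' g, FitsAt w A (pos f) s s' (pos' g) ↔
      H.Fits K (fun h s k => A (num h) s (num' k)) f s s' g := by
    intro f s s' g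
    rw [FitsAt, h₁.sameLabel h₂, h₁.tgt, h₂.tgt]
    rfl
  have hforall : ∀ {u : ℕ → Prop}, (∀ i < nodesFst w, u i) ↔ ∀ v, u (num v) :=
    ⟨fun h v => h _ ((h₁.num_range _).mpr ⟨v, rfl⟩), fun h i hi => by
      obtain ⟨v, rfl⟩ := (h₁.num_range i).mp hi
      exact h v⟩
  have hforall' : ∀ {u : ℕ → Prop}, (∀ i < nodesSnd w, u i) ↔ ∀ v, u (num' v) :=
    ⟨fun h v => h _ ((h₂.num_range _).mpr ⟨v, rfl⟩), fun h i hi => by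
      obtain ⟨v, rfl⟩ := (h₂.num_range i).mp hi
      exact h v⟩
  have hexists : ∀ {u : ℕ → Prop}, (∃ i < nodesFst w, u i) ↔ ∃ v, u (num v) := by
    intro u
    have := not_congr (hforall (u := fun i => ¬ u i))
    push Not at this
    exact this
  have hsum := fun u => sum_range_count h₁.injective h₁.range hL V u
  have hcount := fun u => count_and_eq_card h₂.injective h₂.range hL' u
  have key : RefutesAt w V M A C ↔ _ :=
    ⟨fun h => And.intro h.occur (And.intro h.hall h.root), fun h => ⟨h.1, h.2.1, h.2.2⟩⟩
  rw [key]
  simp only [hforall, hforall', hexists, forall_lt_iff h₁.range hL, forall_lt_iff h₂.range hL',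
    exists_lt_iff h₂.range hL', hsum, hcount, h₁.src, h₂.src, h₁.num_injective.eq_iff,
    h₂.num_injective.eq_iff, h₁.required, h₁.bounded, h₂.required, h₂.bounded, hfits]
  exact ⟨fun h => ⟨h.1, h.2.1, h.2.2⟩, fun h => ⟨h.occur, h.hall, h.root⟩⟩

theorem of_edges {D : ShapeGraph} {pos : Fin D.edges.length → ℕ} (hn : n = D.nodes)
    (hinj : Function.Injective pos) (hp : ∀ i, p i ↔ ∃ j, pos j = i)
    (hpos : ∀ j, ∃ r, w.drop (pos j) = encodeEdge (D.edges.get j) ++ r ∧ Starts r) :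
    Describes w n p D.toGraph (fun v : Fin D.nodes => v) pos where
  num_injective := Fin.val_injective
  num_range i := ⟨fun h => ⟨⟨i, hn ▸ h⟩, rfl⟩, by
    rintro ⟨v, rfl⟩
    exact v.2.trans_eq hn.symm⟩
  injective := hinj
  range := hp
  src e := by
    obtain ⟨r, h, hr⟩ := hpos e
    exact (fields_of_drop h hr).1
  tgt e := by
    obtain ⟨r, h, hr⟩ := hpos e
    exact (fields_of_drop h hr).2.2.2.2.1
  required e := by
    obtain ⟨r, h, hr⟩ := hpos e
    rw [RequiredAt, (fields_of_drop h hr).2.1]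
    change _ ↔ ((D.edges.get e).2.2.1.toInterval).Required
    cases (D.edges.get e).2.2.1 <;> simp [Interval.Required, Basic.toInterval]
  bounded e := by
    obtain ⟨r, h, hr⟩ := hpos e
    rw [BoundedAt, (fields_of_drop h hr).2.1]
    change _ ↔ ((D.edges.get e).2.2.1.toInterval).Bounded
    cases (D.edges.get e).2.2.1 <;> simp [Interval.Bounded, Basic.toInterval]
  labLen e := by
    obtain ⟨r, h, hr⟩ := hpos e
    exact (fields_of_drop h hr).2.2.1
  lab e := by
    obtain ⟨r, h, hr⟩ := hpos e
    exact (fields_of_drop h hr).2.2.2.1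

end Describes

theorem exists_describes {H K : ShapeGraph} (hw : w = H.encode ++ sep :: K.encode) :
    (∃ pos, Describes w (nodesFst w) (FstArc w) H.toGraph (fun v : Fin H.nodes => v) pos) ∧
      ∃ pos, Describes w (nodesSnd w) (SndArc w) K.toGraph (fun v : Fin K.nodes => v) pos := by
  obtain ⟨hq, hH, hK, -⟩ := encode_pair hw
  obtain ⟨pos, h₁, h₂, h₃⟩ := exists_positions_of_drop (D := H) (k := 0) (r := sep :: K.encode)
    (by simp [Starts, IsStart]) hw
  obtain ⟨pos', h₁', h₂', h₃'⟩ := exists_positions_of_drop (w := w) (D := K) (k := sepPos w + 1)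
    (r := []) (by simp [Starts]) (by rw [hq, hw, ← List.drop_drop, List.drop_left]; simp)
  have hlen : w.length = sepPos w + 1 + K.encode.length := by rw [hq, hw]; simp; omega
  refine ⟨⟨pos, .of_edges hH h₁ (fun i => ?_) h₃⟩, ⟨pos', .of_edges hK h₁' (fun i => ?_) h₃'⟩⟩
  · rw [← h₂, FstArc, hq]
    simp
  · rw [← h₂', SndArc]
    refine ⟨fun h => ⟨h.1, ?_, h.2⟩, fun h => ⟨h.1, h.2.2⟩⟩
    have := (List.getElem?_eq_some_iff.mp h.2).1
    omega

end Words

end ShEx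

namespace ShEx

open ShEx.Symbol

/-! ### Arrays of bits -/

/-- The index of an entry of an array of dimension five. -/
def pack (N t a b c d : ℕ) : ℕ := (((t * N + a) * N + b) * N + c) * N + d

/-- The arguments are the digits in base `N` of the index, recovered by division with remainder. -/
theorem exists_bits (N : ℕ) (P : ℕ → ℕ → ℕ → ℕ → ℕ → Prop) : ∃ bits : List Bool,
    bits.length = N ^ 5 ∧ ∀ t < N, ∀ a < N, ∀ b < N, ∀ c < N, ∀ d < N,
      (bits[pack N t a b c d]? = some true ↔ P t a b c d) := by
  classical
  refine ⟨List.ofFn fun i : Fin (N ^ 5) => decide (P (i / N / N / N / N) (i / N / N / N % N)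
    (i / N / N % N) (i / N % N) (i % N)), List.length_ofFn, fun t ht a ha b hb c hc d hd => ?_⟩
  have hdiv : ∀ x y, y < N → (x * N + y) / N = x := fun x y hy => by
    rw [mul_comm, Nat.mul_add_div (by omega), Nat.div_eq_of_lt hy, add_zero]
  have hmod : ∀ x y, y < N → (x * N + y) % N = y := fun x y hy => by
    rw [mul_comm, Nat.mul_add_mod, Nat.mod_eq_of_lt hy]
  have hlt : ∀ {x y z}, x < z → y < N → x * N + y < z * N := fun {x y z} hx hy => by
    have := Nat.mul_le_mul_right N (Nat.succ_le_of_lt hx)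
    rw [Nat.succ_mul] at this
    omega
  have hp : pack N t a b c d < N ^ 5 := by
    have := hlt (hlt (hlt (hlt ht ha) hb) hc) hd
    exact this.trans_eq (by ring)
  rw [List.getElem?_ofFn, dif_pos hp]
  simp only [pack, hdiv _ _ hd, hmod _ _ hd, hdiv _ _ hc, hmod _ _ hc, hdiv _ _ hb, hmod _ _ hb,
    hdiv _ _ ha, hmod _ _ ha, Option.some.injEq, decide_eq_true_eq]

/-- An entry of the array that is given by a list of bits. -/
def Entry (x : List Symbol × List Bool) (t a b c d : ℕ) : Prop :=
  x.2[pack (16 ^ x.1.length) t a b c d]? = some true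

/-- The data given by a list of bits refute the containment given by a word. -/
def RefutedBy (x : List Symbol × List Bool) : Prop :=
  RefutesAt x.1 (16 ^ x.1.length) (fun f s s' => Entry x 0 f s s' 0)
    (fun h s k => Entry x 1 h s k 0) (fun h s k g => Entry x 2 h s k g)

/-- Words that encode no pair belong to the complement and are accepted with any bits. For all
others the bits hold a refutation. -/
theorem notMem_containmentProblem_iff (w : List Symbol) : w ∉ containmentProblem ↔
    ∃ bits : List Bool, bits.length = (16 ^ w.length) ^ 5 ∧
      (¬ WellFormed w ∨ RefutedBy (w, bits)) := by
  constructor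
  · intro hw
    by_cases hwf : WellFormed w
    · obtain ⟨H, K, he⟩ := wellFormed_iff.mp hwf
      have hc : ¬ H.toGraph.Contained K.toGraph := fun hc => hw ⟨H, K, he, hc⟩
      obtain ⟨⟨pos, h₁⟩, pos', h₂⟩ := exists_describes he
      have hpos : ∀ f, pos f < w.length := fun f =>
        (List.getElem?_eq_some_iff.mp ((h₁.range _).mpr ⟨f, rfl⟩).2).1
      have hpos' : ∀ g, pos' g < w.length := fun g =>
        (List.getElem?_eq_some_iff.mp ((h₂.range _).mpr ⟨g, rfl⟩).2).1
      have hlen : w.length = H.encode.length + (K.encode.length + 1) := by simp [he]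
      have hH : H.nodes ≤ w.length := by
        rw [hlen, ShapeGraph.encode, List.length_append, List.length_replicate]
        omega
      have hK : K.nodes ≤ w.length := by
        refine le_trans ?_ (hlen.ge.trans' (Nat.le_add_left _ _))
        rw [ShapeGraph.encode, List.length_append, List.length_replicate]
        omega
      have hlt : w.length < 2 ^ w.length := Nat.lt_two_pow_self
      -- The word contains a separator and is not empty; so the base exceeds `2`, and the tags `0`,
      -- `1`, `2` are digits.
      have hlt'' : 16 ^ 1 ≤ 16 ^ w.length := Nat.pow_le_pow_right (by omega) (by omega)
      have hlt' : 2 ^ w.length ≤ 16 ^ w.length := Nat.pow_le_pow_left (by omega) _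
      have hE : Fintype.card K.toGraph.E ≤ w.length := by
        have := Fintype.card_le_of_injective (fun g => (⟨pos' g, hpos' g⟩ : Fin w.length))
          fun g g' h => h₂.injective (Fin.mk.inj_iff.mp h)
        rwa [Fintype.card_fin] at this
      have hV : Fintype.card H.toGraph.N * 2 ^ Fintype.card K.toGraph.N *
          (Fintype.card K.toGraph.E + 1) ≤ 16 ^ w.length := by
        have hNH : Fintype.card H.toGraph.N = H.nodes := Fintype.card_fin _
        have hNK : Fintype.card K.toGraph.N = K.nodes := Fintype.card_fin _
        -- Each of the three factors is at most `2 ^ |w|`, so `8 ^ |w|` would be enough.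
        calc _ ≤ 2 ^ w.length * 2 ^ w.length * 2 ^ w.length :=
              Nat.mul_le_mul (Nat.mul_le_mul (by omega)
                (Nat.pow_le_pow_right (by omega) (by omega))) (by omega)
          _ = (2 * 2 * 2) ^ w.length := by rw [mul_pow, mul_pow]
          _ ≤ 16 ^ w.length := Nat.pow_le_pow_left (by omega) _
      obtain ⟨M, A, C, hR⟩ :=
        Graph.exists_refutes H.isShapeGraph K.isShapeGraph hc hV
      -- One list of bits holds all three relations, with first coordinate `0` for `M`, `1` for `A`
      -- and `2` for `C`; unused coordinates are set to `0`.
      obtain ⟨bits, hbits, hP⟩ := exists_bits (16 ^ w.length) fun t a b c d => match t with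
        | 0 => ∃ f, pos f = a ∧ M f b c
        | 1 => ∃ (h : Fin H.nodes) (k : Fin K.nodes), h = a ∧ k = c ∧ A h b k
        | _ => ∃ (h : Fin H.nodes) (k : Fin K.nodes) (g : _), h = a ∧ k = c ∧ pos' g = d ∧ C h b k g
      refine ⟨bits, hbits, Or.inr ((h₁.refutesAt_iff h₂ _ _ _ _).mpr (hR.congr ?_ ?_ ?_))⟩
      · intro f s hs s' hs'
        have := hpos f
        refine Iff.trans ?_ (hP 0 ?_ _ ?_ _ hs _ hs' 0 ?_).symm
        · exact ⟨fun h => ⟨f, rfl, h⟩, fun ⟨f', e, h⟩ => h₁.injective e ▸ h⟩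
        all_goals omega
      · intro (h : Fin H.nodes) s hs (k : Fin K.nodes)
        have h1 := h.2
        have h2 := k.2
        refine Iff.trans ?_ (hP 1 ?_ h ?_ _ hs k ?_ 0 ?_).symm
        · exact ⟨fun hA => ⟨h, k, rfl, rfl, hA⟩, fun ⟨h', k', e, e', hA⟩ =>
            Fin.ext e ▸ Fin.ext e' ▸ hA⟩
        all_goals omega
      · intro (h : Fin H.nodes) s hs (k : Fin K.nodes) g
        have := hpos' g
        have h1 := h.2
        have h2 := k.2
        refine Iff.trans ?_ (hP 2 ?_ h ?_ _ hs k ?_ _ ?_).symm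
        · refine ⟨fun hC => ⟨h, k, g, rfl, rfl, rfl, hC⟩, ?_⟩
          rintro ⟨h', k', g', e, e', e'', hC⟩
          rwa [← Fin.ext e, ← Fin.ext e', ← h₂.injective e'']
        all_goals omega
    · exact ⟨List.replicate _ true, List.length_replicate, Or.inl hwf⟩
  · rintro ⟨bits, -, h⟩ ⟨H, K, he, hc⟩
    obtain ⟨⟨pos, h₁⟩, pos', h₂⟩ := exists_describes he
    have := h.resolve_left (not_not.mpr (wellFormed_iff.mpr ⟨H, K, he⟩))
    exact ((h₁.refutesAt_iff h₂ _ _ _ _).mp this).not_contained H.isShapeGraph K.isShapeGraph hc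

/-! ### Definability of refutations -/

section Definability

variable {f g h k t s s' : List Symbol × List Bool → (ℕ → ℕ) → ℕ}

theorem Def.sepPos : Def fun (x : List Symbol × List Bool) _ => sepPos x.1 := .run (.const 0) _

theorem Def.nodesFst : Def fun (x : List Symbol × List Bool) _ => nodesFst x.1 := .run (.const 0) _

theorem Def.nodesSnd : Def fun (x : List Symbol × List Bool) _ => nodesSnd x.1 :=
  .run (Def.sepPos.add (.const 1)) _

theorem Def.srcAt (hf : Def f) : Def fun x e => srcAt x.1 (f x e) := .run (hf.add (.const 1)) _

theorem Def.occPos (hf : Def f) : Def fun x e => occPos x.1 (f x e) :=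
  (hf.add (.const 1)).add hf.srcAt

theorem Def.labPos (hf : Def f) : Def fun x e => labPos x.1 (f x e) := hf.occPos.add (.const 1)

theorem Def.labLen (hf : Def f) : Def fun x e => labLen x.1 (f x e) := .run hf.labPos _

theorem Def.tgtPos (hf : Def f) : Def fun x e => tgtPos x.1 (f x e) := hf.labPos.add hf.labLen

theorem Def.tgtAt (hf : Def f) : Def fun x e => tgtAt x.1 (f x e) := .run hf.tgtPos _

theorem Def.nextPos (hf : Def f) : Def fun x e => nextPos x.1 (f x e) := hf.tgtPos.add hf.tgtAt

theorem DefP.startsAt (hf : Def f) : DefP fun x e => StartsAt x.1 (f x e) :=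
  .or (.le .length hf) (.symbolAt hf _)

theorem DefP.edgeAt (hf : Def f) (hg : Def g) : DefP fun x e => EdgeAt x.1 (g x e) (f x e) :=
  ((symbolAt hf.occPos IsOcc).and ((lt hf.srcAt hg).and
    ((lt hf.tgtAt hg).and (startsAt hf.nextPos)))).of_iff fun _ _ =>
      ⟨fun h => ⟨h.1, h.2.1, h.2.2.1, h.2.2.2⟩, fun h => ⟨h.occ, h.src, h.tgt, h.next⟩⟩

theorem DefP.wellFormed : DefP fun (x : List Symbol × List Bool) _ => WellFormed x.1 := by
  have h₁ : DefP fun (x : List Symbol × List Bool) _ => ∀ i < x.1.length, ShEx.sepPos x.1 < i →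
      x.1[i]? ≠ some sep :=
    .forall_lt .length (.imp (.lt .sepPos (.var 0)) (.not (.symbol (.var 0) _)))
  have h₂ : DefP fun (x : List Symbol × List Bool) _ => ∀ i < x.1.length, x.1[i]? = some arc →
      (i < ShEx.sepPos x.1 → EdgeAt x.1 (ShEx.nodesFst x.1) i) ∧
        (ShEx.sepPos x.1 < i → EdgeAt x.1 (ShEx.nodesSnd x.1) i) :=
    .forall_lt .length (.imp (.symbol (.var 0) _)
      (.and (.imp (.lt (.var 0) .sepPos) (.edgeAt (.var 0) .nodesFst))
        (.imp (.lt .sepPos (.var 0)) (.edgeAt (.var 0) .nodesSnd))))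
  exact ((DefP.symbol .sepPos sep).and (h₁.and ((DefP.startsAt .nodesFst).and
    ((DefP.startsAt ((Def.sepPos.add (.const 1)).add .nodesSnd)).and h₂)))).of_iff fun _ _ =>
      ⟨fun h => ⟨h.1, h.2.1, h.2.2.1, h.2.2.2.1, h.2.2.2.2⟩,
        fun h => ⟨h.sep, h.unique, h.fst, h.snd, h.edge⟩⟩

theorem DefP.fstArc (hf : Def f) : DefP fun x e => FstArc x.1 (f x e) :=
  .and (.lt hf .sepPos) (.symbol hf _)

theorem DefP.sndArc (hf : Def f) : DefP fun x e => SndArc x.1 (f x e) :=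
  .and (.lt .sepPos hf) (.symbol hf _)

theorem DefP.requiredAt (hf : Def f) : DefP fun x e => RequiredAt x.1 (f x e) :=
  .or (.symbol hf.occPos _) (.symbol hf.occPos _)

theorem DefP.boundedAt (hf : Def f) : DefP fun x e => BoundedAt x.1 (f x e) :=
  .or (.symbol hf.occPos _) (.symbol hf.occPos _)

theorem DefP.sameLabel (hf : Def f) (hg : Def g) :
    DefP fun x e => SameLabel x.1 (f x e) (g x e) :=
  .and (.eq hf.labLen hg.labLen) (.forall_lt hf.labLen
    (.iff (.symbol (hf.labPos.weaken.add (.var 0)) _) (.symbol (hg.labPos.weaken.add (.var 0)) _)))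

theorem DefP.entry {a b c d : List Symbol × List Bool → (ℕ → ℕ) → ℕ} (n : ℕ) (ha : Def a)
    (hb : Def b) (hc : Def c) (hd : Def d) :
    DefP fun x e => Entry x n (a x e) (b x e) (c x e) (d x e) :=
  .bit (((((((((Def.const n).mul .pow_length).add ha).mul .pow_length).add hb).mul
    .pow_length).add hc).mul .pow_length).add hd)

theorem DefP.fitsAt (hf : Def f) (hs : Def s) (hs' : Def s') (hg : Def g) :
    DefP fun x e => FitsAt x.1 (fun h s k => Entry x 1 h s k 0) (f x e) (s x e) (s' x e) (g x e) :=
  .and (.sameLabel hf hg) (.imp (.lt hs' hs) (.entry 1 hf.tgtAt hs' hg.tgtAt (.const 0)))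

theorem DefP.refutedBy : DefP fun (x : List Symbol × List Bool) _ => RefutedBy x := by
  have h₁ : DefP fun (x : List Symbol × List Bool) _ => ∀ f < x.1.length, FstArc x.1 f →
      ∀ s < 16 ^ x.1.length,
        ((RequiredAt x.1 f → 1 ≤ Graph.count (16 ^ x.1.length) fun s' => Entry x 0 f s s' 0) ∧
          (BoundedAt x.1 f → Graph.count (16 ^ x.1.length) (fun s' => Entry x 0 f s s' 0) ≤ 1)) :=
    have hc : Def fun (x : List Symbol × List Bool) e =>
        Graph.count (16 ^ x.1.length) fun s' => Entry x 0 (e 1) (e 0) s' 0 :=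
      .count .pow_length (.entry 0 (.var 2) (.var 1) (.var 0) (.const 0))
    .forall_lt .length (.imp (.fstArc (.var 0)) (.forall_lt .pow_length
      (.and (.imp (.requiredAt (.var 1)) (.le (.const 1) hc))
        (.imp (.boundedAt (.var 1)) (.le hc (.const 1))))))
  have h₂ : DefP fun (x : List Symbol × List Bool) _ => ∃ h < ShEx.nodesFst x.1,
      ∃ s < 16 ^ x.1.length, ∀ k < ShEx.nodesSnd x.1, ¬ Entry x 1 h s k 0 :=
    .exists_lt .nodesFst (.exists_lt .pow_length (.forall_lt .nodesSnd
      (.not (.entry 1 (.var 2) (.var 1) (.var 0) (.const 0)))))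
  -- In this and the following pieces, the variables `2`, `1`, `0` stand for `h`, `s`, `k`, and each
  -- further binder shifts them by one.
  have hc : Def fun (x : List Symbol × List Bool) e =>
      Graph.count x.1.length fun g => SndArc x.1 g ∧ Entry x 2 (e 2) (e 1) (e 0) g :=
    .count .length (.and (.sndArc (.var 0)) (.entry 2 (.var 3) (.var 2) (.var 1) (.var 0)))
  have h₃ : DefP fun (x : List Symbol × List Bool) e =>
      (∀ g < x.1.length, SndArc x.1 g → Entry x 2 (e 2) (e 1) (e 0) g →
        ShEx.srcAt x.1 g = e 0 ∧ BoundedAt x.1 g) :=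
    .forall_lt .length (.imp (.sndArc (.var 0)) (.imp (.entry 2 (.var 3) (.var 2) (.var 1) (.var 0))
      (.and (.eq (.srcAt (.var 0)) (.var 1)) (.boundedAt (.var 0)))))
  have h₄ : DefP fun (x : List Symbol × List Bool) e =>
      (∀ g < x.1.length, SndArc x.1 g → Entry x 2 (e 2) (e 1) (e 0) g →
        ShEx.srcAt x.1 g = e 0 ∧ RequiredAt x.1 g) :=
    .forall_lt .length (.imp (.sndArc (.var 0)) (.imp (.entry 2 (.var 3) (.var 2) (.var 1) (.var 0))
      (.and (.eq (.srcAt (.var 0)) (.var 1)) (.requiredAt (.var 0)))))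
  have h₅ : Def fun (x : List Symbol × List Bool) e => ∑ f ∈ Finset.range x.1.length,
      Graph.count (16 ^ x.1.length) fun s' => FstArc x.1 f ∧ ShEx.srcAt x.1 f = e 2 ∧
        Entry x 0 f (e 1) s' 0 ∧ ∀ g < x.1.length, SndArc x.1 g → ShEx.srcAt x.1 g = e 0 →
          FitsAt x.1 (fun h s k => Entry x 1 h s k 0) f (e 1) s' g →
            Entry x 2 (e 2) (e 1) (e 0) g :=
    .sum .length (.count .pow_length (.and (.fstArc (.var 1)) (.and (.eq (.srcAt (.var 1)) (.var 4))
      (.and (.entry 0 (.var 1) (.var 3) (.var 0) (.const 0)) (.forall_lt .length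
        (.imp (.sndArc (.var 0)) (.imp (.eq (.srcAt (.var 0)) (.var 3))
          (.imp (.fitsAt (.var 2) (.var 4) (.var 1) (.var 0))
            (.entry 2 (.var 5) (.var 4) (.var 3) (.var 0))))))))))
  have h₆ : Def fun (x : List Symbol × List Bool) e => ∑ f ∈ Finset.range x.1.length,
      Graph.count (16 ^ x.1.length) fun s' => FstArc x.1 f ∧ ShEx.srcAt x.1 f = e 2 ∧
        Entry x 0 f (e 1) s' 0 ∧ ∃ g < x.1.length, SndArc x.1 g ∧ Entry x 2 (e 2) (e 1) (e 0) g ∧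
          FitsAt x.1 (fun h s k => Entry x 1 h s k 0) f (e 1) s' g :=
    .sum .length (.count .pow_length (.and (.fstArc (.var 1)) (.and (.eq (.srcAt (.var 1)) (.var 4))
      (.and (.entry 0 (.var 1) (.var 3) (.var 0) (.const 0)) (.exists_lt .length
        (.and (.sndArc (.var 0)) (.and (.entry 2 (.var 5) (.var 4) (.var 3) (.var 0))
          (.fitsAt (.var 2) (.var 4) (.var 1) (.var 0)))))))))
  have h₇ : DefP fun (x : List Symbol × List Bool) _ => ∀ h < ShEx.nodesFst x.1,
      ∀ s < 16 ^ x.1.length, ∀ k < ShEx.nodesSnd x.1, ¬ Entry x 1 h s k 0 →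
        ((∀ g < x.1.length, SndArc x.1 g → Entry x 2 h s k g →
            ShEx.srcAt x.1 g = k ∧ BoundedAt x.1 g) ∧
          Graph.count x.1.length (fun g => SndArc x.1 g ∧ Entry x 2 h s k g) <
            ∑ f ∈ Finset.range x.1.length, Graph.count (16 ^ x.1.length) fun s' =>
              FstArc x.1 f ∧ ShEx.srcAt x.1 f = h ∧ Entry x 0 f s s' 0 ∧
                ∀ g < x.1.length, SndArc x.1 g → ShEx.srcAt x.1 g = k →
                  FitsAt x.1 (fun h s k => Entry x 1 h s k 0) f s s' g → Entry x 2 h s k g) ∨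
        ((∀ g < x.1.length, SndArc x.1 g → Entry x 2 h s k g →
            ShEx.srcAt x.1 g = k ∧ RequiredAt x.1 g) ∧
          (∑ f ∈ Finset.range x.1.length, Graph.count (16 ^ x.1.length) fun s' =>
              FstArc x.1 f ∧ ShEx.srcAt x.1 f = h ∧ Entry x 0 f s s' 0 ∧
                ∃ g < x.1.length, SndArc x.1 g ∧ Entry x 2 h s k g ∧
                  FitsAt x.1 (fun h s k => Entry x 1 h s k 0) f s s' g) <
            Graph.count x.1.length fun g => SndArc x.1 g ∧ Entry x 2 h s k g) :=
    .forall_lt .nodesFst (.forall_lt .pow_length (.forall_lt .nodesSnd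
      (.imp (.not (.entry 1 (.var 2) (.var 1) (.var 0) (.const 0)))
        (.or (h₃.and (.lt hc h₅)) (h₄.and (.lt h₆ hc))))))
  exact (h₁.and (h₇.and h₂)).of_iff fun x e =>
    ⟨fun h => ⟨h.1, h.2.1, h.2.2⟩, fun h => ⟨h.occur, h.hall, h.root⟩⟩

end Definability

theorem containmentProblem_mem_coNEXP : containmentProblem ∈ coNEXP Symbol := by
  have hl : Def fun (x : List Symbol × List Bool) _ => (16 ^ x.1.length) ^ 5 := by
    -- The number of guessed bits, that of the entries of an array of dimension five, has to be a
    -- term itself; powers are spelled out as products.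
    simp only [pow_succ _ 4, pow_succ _ 3, pow_succ _ 2, pow_succ _ 1, pow_one]
    exact (((Def.pow_length.mul .pow_length).mul .pow_length).mul .pow_length).mul .pow_length
  exact mem_NEXP_of_def hl (DefP.wellFormed.not.or DefP.refutedBy) notMem_containmentProblem_iff

end ShEx

theorem mainTheorem5 : ShEx.containmentProblem ∈ ShEx.coNEXP ShEx.Symbol :=
  ShEx.containmentProblem_mem_coNEXP
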